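/- Conventions. A family $\mathfrak F$ of subgroups of a group $G$ is a non-empty set of subgroups closed under conjugation; it is semi-full if it is closed under binary intersections. The orbit category $\mathcal O_{\mathfrak F}G$ has as objects the $G$-sets $G/H$ with $H\in\mathfrak F$ and as morphisms the $G$-maps. Left (right) modules are covariant (contravariant) functors from $\mathcal O_{\mathfrak F}G$ to abelian groups; a right module is free if it is isomorphic to a coproduct of modules $\mathbb Z[?,G/K]$ with $K\in\mathfrak F$; the trivial module $\underline{\mathbb Z}_{\mathfrak F}$ is the right module that is constant with value $\mathbb Z$. For a right module $A$ and a left module $B$, $A\otimes_{\mathfrak F}B$ is the quotient of $\coprod_{H\in\mathfrak F}A(G/H)\otimes B(G/H)$ by the relations $\varphi^*(a)\otimes b=a\otimes\varphi_*(b)$, and $\otimes$ (over $\mathbb Z$) of two left or two right modules is formed pointwise. The Bredon homology $H^{\mathfrak F}_n(G;M)=\operatorname{Tor}^{\mathfrak F}_n(\underline{\mathbb Z}_{\mathfrak F},M)$ is the $n$-th left derived functor of $?\otimes_{\mathfrak F}M$ evaluated at $\underline{\mathbb Z}_{\mathfrak F}$. For families $\mathfrak F_i$ of subgroups of $G_i$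 ($i=1,2$) let $\mathfrak F_1\times\mathfrak F_2=\{H_1\times H_2: H_i\in\mathfrak F_i\}$, and let $\operatorname{res}_{p_i}$ be restriction along the functor of orbit categories induced by the projection $p_i\colon G_1\times G_2\to G_i$. If $F_*\to\underline{\mathbb Z}_{\mathfrak F_1}$ and $F'_*\to\underline{\mathbb Z}_{\mathfrak F_2}$ are free resolutions, then the total complex $T_*=\operatorname{Tot}(\operatorname{res}_{p_1}F_*\otimes\operatorname{res}_{p_2}F'_*)$ with the product augmentation is a projective resolution of $\underline{\mathbb Z}_{\mathfrak F_1\times\mathfrak F_2}$, so that $H_n(T_*\otimes_{\mathfrak F_1\times\mathfrak F_2}(\operatorname{res}_{p_1}M\otimes\operatorname{res}_{p_2}M'))=H_n^{\mathfrak F_1\times\mathfrak F_2}(G_1\times G_2;\operatorname{res}_{p_1}M\otimes\operatorname{res}_{p_2}M')$. The homology cross product $H_p^{\mathfrak F_1}(G_1;M)\otimes H_q^{\mathfrak F_2}(G_2;M')\to H_{p+q}^{\mathfrak F_1\times\mathfrak F_2}(G_1\times G_2;\operatorname{res}_{p_1}M\otimes\operatorname{res}_{p_2}M')$ is $[z]\otimes[z']\mapsto[z\times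 z']$, where on chains $(a\otimes m)\times(b\otimes m')=(a\otimes b)\otimes(m\otimes m')$. Theorem (Künneth formula for Bredon homology). Let $G_1,G_2$ be groups, $\mathfrak F_1,\mathfrak F_2$ families of subgroups of $G_1$ and $G_2$, $M$ a left $\mathcal O_{\mathfrak F_1}G_1$-module and $M'$ a left $\mathcal O_{\mathfrak F_2}G_2$-module. Let $F_*\to\underline{\mathbb Z}_{\mathfrak F_1}$ and $F'_*\to\underline{\mathbb Z}_{\mathfrak F_2}$ be free resolutions such that $F_*\otimes_{\mathfrak F_1}M$ or $F'_*\otimes_{\mathfrak F_2}M'$ is a chain complex of free abelian groups. Then $T_*$ is a projective resolution of $\underline{\mathbb Z}_{\mathfrak F_1\times\mathfrak F_2}$ as above, and for every $n\in\mathbb N$ there is a short exact sequence of abelian groups $$0\to\coprod_{k=0}^{n}H_k^{\mathfrak F_1}(G_1;M)\otimes H_{n-k}^{\mathfrak F_2}(G_2;M')\xrightarrow{\ \alpha\ }H_n^{\mathfrak F_1\times\mathfrak F_2}(G_1\times G_2;\operatorname{res}_{p_1}M\otimes\operatorname{res}_{p_2}M')\to\coprod_{k=0}^{n-1}\operatorname{Tor}_1\bigl(H_k^{\mathfrak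 F_1}(G_1;M),H_{n-k-1}^{\mathfrak F_2}(G_2;M')\bigr)\to0$$ in which $\alpha$ is the homology cross product on each summand. If both $F_*\otimes_{\mathfrak F_1}M$ and $F'_*\otimes_{\mathfrak F_2}M'$ are chain complexes of free abelian groups, then this sequence splits. The splitting is not natural: there are groups $G_1,G_2$, semi-full families $\mathfrak F_1,\mathfrak F_2$, free resolutions $F_*,F'_*$ of the trivial modules and an $n\in\mathbb N$ for which it is impossible to choose, for all pairs $(M,M')$ such that both $F_*\otimes_{\mathfrak F_1}M$ and $F'_*\otimes_{\mathfrak F_2}M'$ are chain complexes of free abelian groups, a left inverse of $\alpha$ that is natural in $M$ and $M'$. -/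

import Mathlib

open CategoryTheory Limits TensorProduct

universe u

/-- A family of subgroups: a non-empty set of subgroups closed under conjugation. -/
structure SubgroupFamily (G : Type u) [Group G] where
  carrier : Set (Subgroup G)
  nonempty : carrier.Nonempty
  conj_mem : ∀ H ∈ carrier, ∀ g : G, H.map (MulAut.conj g).toMonoidHom ∈ carrier

namespace SubgroupFamily

/-- Semi-full families are those closed under binary intersections. -/
def IsSemiFull {G : Type u} [Group G] (F : SubgroupFamily G) : Prop :=
  ∀ H ∈ F.carrier, ∀ K ∈ F.carrier, H ⊓ K ∈ F.carrier

/-- The cartesian product family `{H₁ × H₂ | H₁ ∈ F₁, H₂ ∈ F₂}` of subgroups of `G₁ × G₂`. -/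
def prod {G₁ G₂ : Type u} [Group G₁] [Group G₂]
    (F₁ : SubgroupFamily G₁) (F₂ : SubgroupFamily G₂) : SubgroupFamily (G₁ × G₂) where
  carrier := {H | ∃ H₁ ∈ F₁.carrier, ∃ H₂ ∈ F₂.carrier, H = H₁.prod H₂}
  nonempty := by
    obtain ⟨H₁, h₁⟩ := F₁.nonempty
    obtain ⟨H₂, h₂⟩ := F₂.nonempty
    exact ⟨_, H₁, h₁, H₂, h₂, rfl⟩
  conj_mem := by
    rintro _ ⟨H₁, h₁, H₂, h₂, rfl⟩ g
    refine ⟨_, F₁.conj_mem H₁ h₁ g.1, _, F₂.conj_mem H₂ h₂ g.2, ?_⟩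
    ext ⟨x, y⟩
    constructor
    · rintro ⟨⟨a, b⟩, ⟨ha, hb⟩, h⟩
      exact ⟨⟨a, ha, congrArg Prod.fst h⟩, ⟨b, hb, congrArg Prod.snd h⟩⟩
    · rintro ⟨⟨a, ha, rfl⟩, ⟨b, hb, rfl⟩⟩
      exact ⟨(a, b), ⟨ha, hb⟩, rfl⟩

theorem map_fst_mem {G₁ G₂ : Type u} [Group G₁] [Group G₂]
    (F₁ : SubgroupFamily G₁) (F₂ : SubgroupFamily G₂) :
    ∀ H ∈ (F₁.prod F₂).carrier, H.map (MonoidHom.fst G₁ G₂) ∈ F₁.carrier := by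
  rintro _ ⟨H₁, h₁, H₂, h₂, rfl⟩
  convert h₁
  ext x
  exact ⟨by rintro ⟨⟨a, b⟩, ⟨ha, hb⟩, rfl⟩; exact ha, fun hx => ⟨(x, 1), ⟨hx, H₂.one_mem⟩, rfl⟩⟩

theorem map_snd_mem {G₁ G₂ : Type u} [Group G₁] [Group G₂]
    (F₁ : SubgroupFamily G₁) (F₂ : SubgroupFamily G₂) :
    ∀ H ∈ (F₁.prod F₂).carrier, H.map (MonoidHom.snd G₁ G₂) ∈ F₂.carrier := by
  rintro _ ⟨H₁, h₁, H₂, h₂, rfl⟩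
  convert h₂
  ext x
  exact ⟨by rintro ⟨⟨a, b⟩, ⟨ha, hb⟩, rfl⟩; exact hb, fun hx => ⟨(1, x), ⟨H₁.one_mem, hx⟩, rfl⟩⟩

end SubgroupFamily

/-- The objects `G/H`, `H ∈ F`, of the orbit category; `X` stands for the homogeneous
space `G ⧸ X.sub`. -/
structure Orb {G : Type u} [Group G] (F : SubgroupFamily G) : Type u where
  sub : Subgroup G
  mem : sub ∈ F.carrier

namespace Orb

section
variable {G : Type u} [Group G] {F : SubgroupFamily G}

/-- The orbit category: morphisms are the `G`-equivariant maps. -/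
instance : SmallCategory (Orb F) where
  Hom X Y := (G ⧸ X.sub) →[G] (G ⧸ Y.sub)
  id X := MulActionHom.id G
  comp f g := MulActionHom.comp g f

/-- The equivariant map underlying a morphism of the orbit category. -/
def toMap {X Y : Orb F} (f : X ⟶ Y) : (G ⧸ X.sub) →[G] (G ⧸ Y.sub) := f

@[simp] theorem toMap_id (X : Orb F) (x : G ⧸ X.sub) : toMap (𝟙 X) x = x := rfl

@[simp] theorem toMap_comp {X Y Z : Orb F} (f : X ⟶ Y) (g : Y ⟶ Z) (x : G ⧸ X.sub) :
    toMap (f ≫ g) x = toMap g (toMap f x) := rfl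

theorem hom_ext {X Y : Orb F} {f g : X ⟶ Y}
    (h : toMap f ((1 : G) : G ⧸ X.sub) = toMap g ((1 : G) : G ⧸ X.sub)) : f = g := by
  apply MulActionHom.ext (f := toMap f) (g := toMap g)
  intro x
  induction x using QuotientGroup.induction_on with
  | H z =>
    have e : ((z : G) : G ⧸ X.sub) = z • ((1 : G) : G ⧸ X.sub) := by simp
    rw [e, map_smul, map_smul, h]

/-- The equivariant map `G/H → G/K` sending the coset `H` to a point `y` fixed by `H`. -/
def ofFixed (X Y : Orb F) (y : G ⧸ Y.sub) (hy : ∀ h ∈ X.sub, h • y = y) : X ⟶ Y :=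
  { toFun := Quotient.lift (fun g : G => g • y) (by
      intro a b hab
      have h := hy _ (QuotientGroup.leftRel_apply.mp hab)
      change a • y = b • y
      conv_lhs => rw [← h]
      rw [smul_smul, mul_inv_cancel_left])
    map_smul' := by
      intro g x
      induction x using QuotientGroup.induction_on with
      | H z => exact mul_smul g z y }

@[simp] theorem ofFixed_mk (X Y : Orb F) (y : G ⧸ Y.sub) (hy : ∀ h ∈ X.sub, h • y = y) (g : G) :
    toMap (ofFixed X Y y hy) ((g : G) : G ⧸ X.sub) = g • y := rfl

theorem fixed_of_hom {X Y : Orb F} (f : X ⟶ Y) (h : G) (hh : h ∈ X.sub) :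
    h • toMap f ((1 : G) : G ⧸ X.sub) = toMap f ((1 : G) : G ⧸ X.sub) := by
  rw [← map_smul]
  congr 1
  change ((h * 1 : G) : G ⧸ X.sub) = _
  rw [QuotientGroup.eq]
  simpa using hh

theorem toMap_mk {X Y : Orb F} (f : X ⟶ Y) (g : G) :
    toMap f ((g : G) : G ⧸ X.sub) = g • toMap f ((1 : G) : G ⧸ X.sub) := by
  rw [← map_smul]
  simp

/-- The canonical projection `G/H → G/K` for `H ≤ K`. -/
def ofLE (X Y : Orb F) (h : X.sub ≤ Y.sub) : X ⟶ Y :=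
  ofFixed X Y ((1 : G) : G ⧸ Y.sub) (by
    intro k hk
    change ((k * 1 : G) : G ⧸ Y.sub) = _
    rw [QuotientGroup.eq]
    simpa using h hk)

theorem ofLE_one (X Y : Orb F) (h : X.sub ≤ Y.sub) :
    toMap (ofLE X Y h) ((1 : G) : G ⧸ X.sub) = ((1 : G) : G ⧸ Y.sub) := by
  simp [ofLE]

theorem ofLE_mk (X Y : Orb F) (h : X.sub ≤ Y.sub) (g : G) :
    toMap (ofLE X Y h) ((g : G) : G ⧸ X.sub) = ((g : G) : G ⧸ Y.sub) := by
  simp [ofLE]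

theorem ofLE_comp (X Y : Orb F) (h : X.sub ≤ Y.sub) (h' : Y.sub ≤ X.sub) :
    ofLE X Y h ≫ ofLE Y X h' = 𝟙 X := by
  apply hom_ext
  simp [ofLE_mk]

end

section
variable {G K : Type u} [Group G] [Group K] (f : G →* K)

/-- The map `G/H → K/f(H)` induced by a group homomorphism `f : G → K`. -/
def cosetMap (H : Subgroup G) : G ⧸ H → K ⧸ (H.map f) :=
  Quotient.map f (by
    intro a b hab
    apply QuotientGroup.leftRel_apply.mpr
    refine ⟨a⁻¹ * b, QuotientGroup.leftRel_apply.mp hab, by simp⟩)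

@[simp] theorem cosetMap_mk (H : Subgroup G) (g : G) :
    cosetMap f H (g : G ⧸ H) = ((f g : K) : K ⧸ (H.map f)) := rfl

theorem cosetMap_smul (H : Subgroup G) (g : G) (x : G ⧸ H) :
    cosetMap f H (g • x) = f g • cosetMap f H x := by
  induction x using QuotientGroup.induction_on with
  | H z =>
    change ((f (g * z) : K) : K ⧸ (H.map f)) = ((f g * f z : K) : K ⧸ (H.map f))
    rw [map_mul]

variable {F : SubgroupFamily G} {F' : SubgroupFamily K}

/-- The object `K/f(H)`. -/
abbrev mapObj (hf : ∀ H ∈ F.carrier, H.map f ∈ F'.carrier) (X : Orb F) : Orb F' :=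
  ⟨X.sub.map f, hf _ X.mem⟩

/-- The `K`-map `K/f(H) → K/f(L)`, `f(H) ↦ f(g)f(L)`, induced by the `G`-map `G/H → G/L`,
`H ↦ gL`. -/
def mapHom (hf : ∀ H ∈ F.carrier, H.map f ∈ F'.carrier) {X Y : Orb F} (φ : X ⟶ Y) :
    mapObj f hf X ⟶ mapObj f hf Y :=
  ofFixed (mapObj f hf X) (mapObj f hf Y)
    (cosetMap f Y.sub (toMap φ ((1 : G) : G ⧸ X.sub))) (by
      rintro _ ⟨h, hh, rfl⟩
      exact (cosetMap_smul f _ _ _).symm.trans (congrArg _ (fixed_of_hom φ h hh)))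

theorem mapHom_cosetMap (hf : ∀ H ∈ F.carrier, H.map f ∈ F'.carrier) {X Y : Orb F}
    (φ : X ⟶ Y) (x : G ⧸ X.sub) :
    toMap (mapHom f hf φ) (cosetMap f X.sub x) = cosetMap f Y.sub (toMap φ x) := by
  induction x using QuotientGroup.induction_on with
  | H g =>
    rw [toMap_mk]
    exact (cosetMap_smul f _ _ _).symm

theorem map_hom_ext (hf : ∀ H ∈ F.carrier, H.map f ∈ F'.carrier) {X : Orb F} {Y : Orb F'}
    {φ ψ : mapObj f hf X ⟶ Y}
    (h : toMap φ (cosetMap f X.sub ((1 : G) : G ⧸ X.sub)) =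
      toMap ψ (cosetMap f X.sub ((1 : G) : G ⧸ X.sub))) : φ = ψ := by
  apply hom_ext
  have e : cosetMap f X.sub ((1 : G) : G ⧸ X.sub) = ((1 : K) : K ⧸ (X.sub.map f)) := by
    rw [cosetMap_mk, map_one]
  rw [e] at h
  exact h

/-- The functor of orbit categories induced by a group homomorphism `f : G → K` with
`f(F) ⊆ F'`. -/
def mapFunctor (hf : ∀ H ∈ F.carrier, H.map f ∈ F'.carrier) : Orb F ⥤ Orb F' where
  obj X := mapObj f hf X
  map φ := mapHom f hf φ
  map_id X := map_hom_ext f hf (mapHom_cosetMap f hf (𝟙 X) _)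
  map_comp φ ψ := map_hom_ext f hf (by
    rw [mapHom_cosetMap, toMap_comp, toMap_comp, mapHom_cosetMap, mapHom_cosetMap])

end

section
variable {G₁ G₂ : Type u} [Group G₁] [Group G₂]

/-- The projection functor of orbit categories induced by `G₁ × G₂ → G₁`. -/
def fst (F₁ : SubgroupFamily G₁) (F₂ : SubgroupFamily G₂) : Orb (F₁.prod F₂) ⥤ Orb F₁ :=
  mapFunctor (MonoidHom.fst G₁ G₂) (F₁.map_fst_mem F₂)

/-- The projection functor of orbit categories induced by `G₁ × G₂ → G₂`. -/
def snd (F₁ : SubgroupFamily G₁) (F₂ : SubgroupFamily G₂) : Orb (F₁.prod F₂) ⥤ Orb F₂ :=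
  mapFunctor (MonoidHom.snd G₁ G₂) (F₁.map_snd_mem F₂)

variable {F₁ : SubgroupFamily G₁} {F₂ : SubgroupFamily G₂}

/-- The object `(G₁ × G₂)/(H₁ × H₂)`. -/
abbrev pair (X : Orb F₁) (Y : Orb F₂) : Orb (F₁.prod F₂) :=
  ⟨X.sub.prod Y.sub, X.sub, X.mem, Y.sub, Y.mem, rfl⟩

theorem fst_pair_sub (X : Orb F₁) (Y : Orb F₂) : ((fst F₁ F₂).obj (pair X Y)).sub = X.sub := by
  ext x
  exact ⟨by rintro ⟨⟨a, b⟩, ⟨ha, hb⟩, rfl⟩; exact ha,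
    fun hx => ⟨(x, 1), ⟨hx, Y.sub.one_mem⟩, rfl⟩⟩

theorem snd_pair_sub (X : Orb F₁) (Y : Orb F₂) : ((snd F₁ F₂).obj (pair X Y)).sub = Y.sub := by
  ext x
  exact ⟨by rintro ⟨⟨a, b⟩, ⟨ha, hb⟩, rfl⟩; exact hb,
    fun hx => ⟨(1, x), ⟨X.sub.one_mem, hx⟩, rfl⟩⟩

/-- The identification of `G₁/p₁(H₁ × H₂)` with `G₁/H₁`. -/
def fstIso (X : Orb F₁) (Y : Orb F₂) : (fst F₁ F₂).obj (pair X Y) ≅ X where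
  hom := ofLE _ _ (fst_pair_sub X Y).le
  inv := ofLE _ _ (fst_pair_sub X Y).ge
  hom_inv_id := ofLE_comp _ _ _ _
  inv_hom_id := ofLE_comp _ _ _ _

/-- The identification of `G₂/p₂(H₁ × H₂)` with `G₂/H₂`. -/
def sndIso (X : Orb F₁) (Y : Orb F₂) : (snd F₁ F₂).obj (pair X Y) ≅ Y where
  hom := ofLE _ _ (snd_pair_sub X Y).le
  inv := ofLE _ _ (snd_pair_sub X Y).ge
  hom_inv_id := ofLE_comp _ _ _ _
  inv_hom_id := ofLE_comp _ _ _ _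

/-- The canonical map `G₁/H₁ × G₂/H₂ → (G₁ × G₂)/(H₁ × H₂)`. -/
def cosetPair (H₁ : Subgroup G₁) (H₂ : Subgroup G₂) :
    G₁ ⧸ H₁ → G₂ ⧸ H₂ → (G₁ × G₂) ⧸ (H₁.prod H₂) :=
  Quotient.map₂ Prod.mk (by
    intro a b hab c d hcd
    apply QuotientGroup.leftRel_apply.mpr
    exact ⟨QuotientGroup.leftRel_apply.mp hab, QuotientGroup.leftRel_apply.mp hcd⟩)

theorem cosetPair_smul (H₁ : Subgroup G₁) (H₂ : Subgroup G₂) (g : G₁ × G₂)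
    (x : G₁ ⧸ H₁) (y : G₂ ⧸ H₂) :
    g • cosetPair H₁ H₂ x y = cosetPair H₁ H₂ (g.1 • x) (g.2 • y) := by
  induction x using QuotientGroup.induction_on with
  | H z =>
    induction y using QuotientGroup.induction_on with
    | H w => rfl

/-- The product of two morphisms of orbit categories. -/
def pairMap {X X' : Orb F₁} {Y Y' : Orb F₂} (φ : X ⟶ X') (ψ : Y ⟶ Y') : pair X Y ⟶ pair X' Y' :=
  ofFixed (pair X Y) (pair X' Y') (cosetPair X'.sub Y'.sub (toMap φ ((1 : G₁) : G₁ ⧸ X.sub))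
    (toMap ψ ((1 : G₂) : G₂ ⧸ Y.sub))) (by
      rintro h ⟨h₁, h₂⟩
      refine (cosetPair_smul _ _ _ _ _).trans ?_
      rw [fixed_of_hom φ _ h₁, fixed_of_hom ψ _ h₂])

theorem fstIso_hom_mk (X : Orb F₁) (Y : Orb F₂) (a : G₁) (b : G₂) :
    toMap (fstIso X Y).hom (cosetMap (MonoidHom.fst G₁ G₂) (pair X Y).sub
      (((a, b) : G₁ × G₂) : (G₁ × G₂) ⧸ (pair X Y).sub)) =
      ((a : G₁) : G₁ ⧸ X.sub) :=
  ofLE_mk ((fst F₁ F₂).obj (pair X Y)) X (fst_pair_sub X Y).le a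

theorem fst_map_pairMap {X X' : Orb F₁} {Y Y' : Orb F₂} (φ : X ⟶ X') (ψ : Y ⟶ Y') :
    (fst F₁ F₂).map (pairMap φ ψ) ≫ (fstIso X' Y').hom = (fstIso X Y).hom ≫ φ := by
  apply map_hom_ext (MonoidHom.fst G₁ G₂) (F₁.map_fst_mem F₂)
  obtain ⟨a, ha⟩ := QuotientGroup.mk_surjective (toMap φ ((1 : G₁) : G₁ ⧸ X.sub))
  obtain ⟨b, hb⟩ := QuotientGroup.mk_surjective (toMap ψ ((1 : G₂) : G₂ ⧸ Y.sub))
  have h1 : toMap (pairMap φ ψ) ((1 : G₁ × G₂) : (G₁ × G₂) ⧸ (pair X Y).sub) =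
      (((a, b) : G₁ × G₂) : (G₁ × G₂) ⧸ (pair X' Y').sub) := by
    rw [pairMap, ofFixed_mk, ← ha, ← hb, one_smul]
    rfl
  have h2 : toMap ((fst F₁ F₂).map (pairMap φ ψ))
      (cosetMap (MonoidHom.fst G₁ G₂) (pair X Y).sub ((1 : G₁ × G₂) : (G₁ × G₂) ⧸ (pair X Y).sub)) =
      cosetMap (MonoidHom.fst G₁ G₂) (pair X' Y').sub
        (((a, b) : G₁ × G₂) : (G₁ × G₂) ⧸ (pair X' Y').sub) :=
    (mapHom_cosetMap _ _ _ _).trans (congrArg _ h1)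
  have h3 := congrArg (toMap (fstIso X' Y').hom) h2
  exact h3.trans (((fstIso_hom_mk X' Y' a b).trans ha).trans
    (congrArg (toMap φ) (fstIso_hom_mk X Y 1 1).symm))

theorem sndIso_hom_mk (X : Orb F₁) (Y : Orb F₂) (a : G₁) (b : G₂) :
    toMap (sndIso X Y).hom (cosetMap (MonoidHom.snd G₁ G₂) (pair X Y).sub
      (((a, b) : G₁ × G₂) : (G₁ × G₂) ⧸ (pair X Y).sub)) =
      ((b : G₂) : G₂ ⧸ Y.sub) :=
  ofLE_mk ((snd F₁ F₂).obj (pair X Y)) Y (snd_pair_sub X Y).le b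

theorem snd_map_pairMap {X X' : Orb F₁} {Y Y' : Orb F₂} (φ : X ⟶ X') (ψ : Y ⟶ Y') :
    (snd F₁ F₂).map (pairMap φ ψ) ≫ (sndIso X' Y').hom = (sndIso X Y).hom ≫ ψ := by
  apply map_hom_ext (MonoidHom.snd G₁ G₂) (F₁.map_snd_mem F₂)
  obtain ⟨a, ha⟩ := QuotientGroup.mk_surjective (toMap φ ((1 : G₁) : G₁ ⧸ X.sub))
  obtain ⟨b, hb⟩ := QuotientGroup.mk_surjective (toMap ψ ((1 : G₂) : G₂ ⧸ Y.sub))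
  have h1 : toMap (pairMap φ ψ) ((1 : G₁ × G₂) : (G₁ × G₂) ⧸ (pair X Y).sub) =
      (((a, b) : G₁ × G₂) : (G₁ × G₂) ⧸ (pair X' Y').sub) := by
    rw [pairMap, ofFixed_mk, ← ha, ← hb, one_smul]
    rfl
  have h2 : toMap ((snd F₁ F₂).map (pairMap φ ψ))
      (cosetMap (MonoidHom.snd G₁ G₂) (pair X Y).sub ((1 : G₁ × G₂) : (G₁ × G₂) ⧸ (pair X Y).sub)) =
      cosetMap (MonoidHom.snd G₁ G₂) (pair X' Y').sub
        (((a, b) : G₁ × G₂) : (G₁ × G₂) ⧸ (pair X' Y').sub) :=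
    (mapHom_cosetMap _ _ _ _).trans (congrArg _ h1)
  have h3 := congrArg (toMap (sndIso X' Y').hom) h2
  exact h3.trans (((sndIso_hom_mk X' Y' a b).trans hb).trans
    (congrArg (toMap ψ) (sndIso_hom_mk X Y 1 1).symm))

end

end Orb

section Tensor
variable (R : Type) [CommRing R]

/-- The tensor product bifunctor on `R`-modules. -/
def modTensor : ModuleCat.{u} R ⥤ ModuleCat.{u} R ⥤ ModuleCat.{u} R where
  obj A :=
    { obj := fun B => ModuleCat.of R (A ⊗[R] B)
      map := fun g => ModuleCat.ofHom (TensorProduct.map LinearMap.id g.hom)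
      map_id := fun B => by ext : 1; exact TensorProduct.map_id
      map_comp := fun g h => by
        ext : 1
        exact TensorProduct.ext' fun x y => rfl }
  map f :=
    { app := fun B => ModuleCat.ofHom (TensorProduct.map f.hom LinearMap.id)
      naturality := fun B B' g => by
        ext : 1
        exact TensorProduct.ext' fun x y => rfl }
  map_id A := by
    ext B : 3
    exact TensorProduct.map_id
  map_comp f g := by
    ext B : 3
    exact TensorProduct.ext' fun x y => rfl

theorem modTensor_map_app_tmul {A A' : ModuleCat.{u} R} (f : A ⟶ A') (B : ModuleCat.{u} R)
    (a : A) (b : B) :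
    (((modTensor R).map f).app B).hom (a ⊗ₜ[R] b) = f.hom a ⊗ₜ[R] b := rfl

theorem modTensor_obj_map_tmul (A : ModuleCat.{u} R) {B B' : ModuleCat.{u} R} (g : B ⟶ B')
    (a : A) (b : B) :
    (((modTensor R).obj A).map g).hom (a ⊗ₜ[R] b) = a ⊗ₜ[R] g.hom b := rfl

instance : (modTensor.{u} R).Additive where
  map_add {A A' f g} := by
    ext B : 3
    exact TensorProduct.ext' fun x y => TensorProduct.add_tmul (R := R) (f.hom x) (g.hom x) y

instance (A : ModuleCat.{u} R) : ((modTensor.{u} R).obj A).Additive where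
  map_add {B B' f g} := by
    ext : 1
    exact TensorProduct.ext' fun x y => TensorProduct.tmul_add (R := R) x (f.hom y) (g.hom y)

instance (B : ModuleCat.{u} R) : ((modTensor.{u} R).flip.obj B).Additive where
  map_add {A A' f g} := by
    ext : 1
    exact TensorProduct.ext' fun x y => TensorProduct.add_tmul (R := R) (f.hom x) (g.hom x) y

/-- `Tor₁` of `R`-modules: the first left derived functor of `? ⊗ B`, evaluated at `A`. -/
noncomputable def modTorOne (A B : ModuleCat.{u} R) : ModuleCat.{u} R :=
  (((modTensor R).flip.obj B).leftDerived 1).obj A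

end Tensor

section CoTensor
variable {R : Type} [CommRing R] {C : Type u} [SmallCategory C]

open scoped Classical in
/-- The relations `φ^*(m) ⊗ n - m ⊗ φ_*(n)` in `∐_c M(c) ⊗ N(c)`. -/
def coTensorRel (M : Cᵒᵖ ⥤ ModuleCat.{u} R) (N : C ⥤ ModuleCat.{u} R) :
    Submodule R (DirectSum C fun c => M.obj (Opposite.op c) ⊗[R] N.obj c) :=
  Submodule.span R {x | ∃ (c d : C) (φ : c ⟶ d) (m : M.obj (Opposite.op d)) (n : N.obj c),
    x = DirectSum.lof R C (fun c => M.obj (Opposite.op c) ⊗[R] N.obj c) c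
          ((M.map φ.op).hom m ⊗ₜ[R] n) -
        DirectSum.lof R C (fun c => M.obj (Opposite.op c) ⊗[R] N.obj c) d
          (m ⊗ₜ[R] (N.map φ).hom n)}

/-- The tensor product over a small category `C` of a contravariant functor `M` and a
covariant functor `N`. -/
abbrev CoTensor (M : Cᵒᵖ ⥤ ModuleCat.{u} R) (N : C ⥤ ModuleCat.{u} R) : Type u :=
  (DirectSum C fun c => M.obj (Opposite.op c) ⊗[R] N.obj c) ⧸ coTensorRel M N

namespace CoTensor

variable {M M' M'' : Cᵒᵖ ⥤ ModuleCat.{u} R} {N N' : C ⥤ ModuleCat.{u} R}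

open scoped Classical in
/-- The canonical map `M(c) ⊗ N(c) → M ⊗_C N`. -/
noncomputable def ι (M : Cᵒᵖ ⥤ ModuleCat.{u} R) (N : C ⥤ ModuleCat.{u} R) (c : C) :
    M.obj (Opposite.op c) ⊗[R] N.obj c →ₗ[R] CoTensor M N :=
  (coTensorRel M N).mkQ ∘ₗ
    DirectSum.lof R C (fun c => M.obj (Opposite.op c) ⊗[R] N.obj c) c

theorem ι_rel {c d : C} (φ : c ⟶ d) (m : M.obj (Opposite.op d)) (n : N.obj c) :
    ι M N c ((M.map φ.op).hom m ⊗ₜ[R] n) = ι M N d (m ⊗ₜ[R] (N.map φ).hom n) := by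
  rw [← sub_eq_zero, ι, ι, LinearMap.comp_apply, LinearMap.comp_apply, ← map_sub]
  rw [Submodule.mkQ_apply, Submodule.Quotient.mk_eq_zero]
  exact Submodule.subset_span ⟨c, d, φ, m, n, rfl⟩

open scoped Classical in
theorem hom_ext {X : Type*} [AddCommGroup X] [Module R X] {f g : CoTensor M N →ₗ[R] X}
    (h : ∀ c m n, f (ι M N c (m ⊗ₜ[R] n)) = g (ι M N c (m ⊗ₜ[R] n))) : f = g := by
  apply Submodule.linearMap_qext
  apply DirectSum.linearMap_ext
  intro c
  apply TensorProduct.ext'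
  intro m n
  exact h c m n

open scoped Classical in
/-- The universal property of the tensor product over `C`. -/
noncomputable def desc {X : Type*} [AddCommGroup X] [Module R X]
    (f : ∀ c, M.obj (Opposite.op c) ⊗[R] N.obj c →ₗ[R] X)
    (hf : ∀ (c d : C) (φ : c ⟶ d) (m : M.obj (Opposite.op d)) (n : N.obj c),
      f c ((M.map φ.op).hom m ⊗ₜ[R] n) = f d (m ⊗ₜ[R] (N.map φ).hom n)) :
    CoTensor M N →ₗ[R] X :=
  (coTensorRel M N).liftQ (DirectSum.toModule R C X f) (by
    rw [coTensorRel, Submodule.span_le]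
    rintro _ ⟨c, d, φ, m, n, rfl⟩
    rw [SetLike.mem_coe, LinearMap.mem_ker, map_sub, sub_eq_zero]
    have h := hf c d φ m n
    rw [← DirectSum.toModule_lof (R := R) (ι := C) (φ := f) c,
      ← DirectSum.toModule_lof (R := R) (ι := C) (φ := f) d] at h
    exact h)

open scoped Classical in
@[simp] theorem desc_ι {X : Type*} [AddCommGroup X] [Module R X]
    (f : ∀ c, M.obj (Opposite.op c) ⊗[R] N.obj c →ₗ[R] X)
    (hf : ∀ (c d : C) (φ : c ⟶ d) (m : M.obj (Opposite.op d)) (n : N.obj c),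
      f c ((M.map φ.op).hom m ⊗ₜ[R] n) = f d (m ⊗ₜ[R] (N.map φ).hom n)) (c : C)
    (x : M.obj (Opposite.op c) ⊗[R] N.obj c) :
    desc f hf (ι M N c x) = f c x := by
  simp only [desc, ι, LinearMap.comp_apply, Submodule.mkQ_apply]
  exact DirectSum.toModule_lof (R := R) (ι := C) (φ := f) c x

/-- The map `M ⊗_C N → M' ⊗_C N'` induced by natural transformations. -/
noncomputable def map (f : M ⟶ M') (g : N ⟶ N') : CoTensor M N →ₗ[R] CoTensor M' N' :=
  desc (fun c => ι M' N' c ∘ₗ TensorProduct.map (f.app (Opposite.op c)).hom (g.app c).hom) (by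
    intro c d φ m n
    have h1 : (f.app (Opposite.op c)).hom ((M.map φ.op).hom m) =
        (M'.map φ.op).hom ((f.app (Opposite.op d)).hom m) :=
      congrArg (fun k => k.hom m) (f.naturality φ.op)
    have h2 : (g.app d).hom ((N.map φ).hom n) = (N'.map φ).hom ((g.app c).hom n) :=
      congrArg (fun k => k.hom n) (g.naturality φ)
    rw [LinearMap.comp_apply, LinearMap.comp_apply, TensorProduct.map_tmul,
      TensorProduct.map_tmul, h1, h2, ι_rel])

@[simp] theorem map_ι (f : M ⟶ M') (g : N ⟶ N') (c : C) (m : M.obj (Opposite.op c))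
    (n : N.obj c) :
    map f g (ι M N c (m ⊗ₜ[R] n)) =
      ι M' N' c ((f.app (Opposite.op c)).hom m ⊗ₜ[R] (g.app c).hom n) := by
  simp [map]

end CoTensor

/-- The functor `? ⊗_C N`. -/
noncomputable def tensorOver (N : C ⥤ ModuleCat.{u} R) :
    (Cᵒᵖ ⥤ ModuleCat.{u} R) ⥤ ModuleCat.{u} R where
  obj M := ModuleCat.of R (CoTensor M N)
  map f := ModuleCat.ofHom (CoTensor.map f (𝟙 N))
  map_id M := by
    ext : 1
    exact CoTensor.hom_ext fun c m n => by simp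
  map_comp f g := by
    ext : 1
    exact CoTensor.hom_ext fun c m n => by simp

instance (N : C ⥤ ModuleCat.{u} R) : (tensorOver N).Additive where
  map_add {M M' f g} := by
    ext : 1
    refine CoTensor.hom_ext fun c m n => ?_
    change CoTensor.map (f + g) (𝟙 N) _ = CoTensor.map f (𝟙 N) _ + CoTensor.map g (𝟙 N) _
    rw [CoTensor.map_ι, CoTensor.map_ι, CoTensor.map_ι, ← map_add, ← TensorProduct.add_tmul]
    rfl

/-- The natural transformation `? ⊗_C N → ? ⊗_C N'` induced by `N → N'`. -/
noncomputable def tensorOverMap {N N' : C ⥤ ModuleCat.{u} R} (g : N ⟶ N') :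
    tensorOver N ⟶ tensorOver N' where
  app M := ModuleCat.ofHom (CoTensor.map (𝟙 M) g)
  naturality M M' f := by
    ext : 1
    refine CoTensor.hom_ext fun c m n => ?_
    change CoTensor.map (𝟙 M') g (CoTensor.map f (𝟙 N) (CoTensor.ι M N c (m ⊗ₜ[R] n))) =
      CoTensor.map f (𝟙 N') (CoTensor.map (𝟙 M) g (CoTensor.ι M N c (m ⊗ₜ[R] n)))
    simp

theorem tensorOver_map_ι {N : C ⥤ ModuleCat.{u} R} {M M' : Cᵒᵖ ⥤ ModuleCat.{u} R} (f : M ⟶ M')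
    (c : C) (m : M.obj (Opposite.op c)) (n : N.obj c) :
    ((tensorOver N).map f).hom (CoTensor.ι M N c (m ⊗ₜ[R] n)) =
      CoTensor.ι M' N c ((f.app (Opposite.op c)).hom m ⊗ₜ[R] n) :=
  CoTensor.map_ι _ _ _ _ _

/-- The functor `R[?, c]`, sending `d` to the free `R`-module on the set of morphisms `d → c`. -/
noncomputable def freeOn (R : Type) [CommRing R] (c : C) : Cᵒᵖ ⥤ ModuleCat.{u} R where
  obj d := ModuleCat.of R ((d.unop ⟶ c) →₀ R)
  map φ := ModuleCat.ofHom (Finsupp.lmapDomain R R fun f => φ.unop ≫ f)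
  map_id d := by
    ext : 1
    refine Finsupp.lhom_ext' fun f => LinearMap.ext_ring ?_
    simp
  map_comp φ ψ := by
    ext : 1
    refine Finsupp.lhom_ext' fun f => LinearMap.ext_ring ?_
    simp

/-- A contravariant functor is free if it is a coproduct of functors `R[?, c]`. -/
def IsFreeFunctor (M : Cᵒᵖ ⥤ ModuleCat.{u} R) : Prop :=
  ∃ (I : Type u) (c : I → C), Nonempty (M ≅ ∐ fun i => freeOn R (c i))

/-- The morphism `R[?, c] → M` sending the identity of `c` to `m ∈ M(c)`. -/
noncomputable def freeOnDesc {c : C} {M : Cᵒᵖ ⥤ ModuleCat.{u} R} (m : M.obj (Opposite.op c)) :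
    freeOn R c ⟶ M where
  app d := ModuleCat.ofHom
    (Finsupp.lift (M.obj d) R _ fun φ => (M.map (Quiver.Hom.op φ)).hom m)
  naturality d d' φ := by
    ext : 1
    refine Finsupp.lhom_ext' fun f => LinearMap.ext_ring ?_
    simp [freeOn]

theorem freeOnDesc_id {c : C} {M : Cᵒᵖ ⥤ ModuleCat.{u} R} (m : M.obj (Opposite.op c)) :
    ((freeOnDesc m).app (Opposite.op c)).hom (Finsupp.single (𝟙 c) (1 : R)) = m := by
  refine (Finsupp.lift_apply _ _ _ _ _).trans ?_
  rw [Finsupp.sum_single_index] <;> simp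

theorem freeOn_hom_ext {c : C} {M : Cᵒᵖ ⥤ ModuleCat.{u} R} {f g : freeOn R c ⟶ M}
    (h : (f.app (Opposite.op c)).hom (Finsupp.single (𝟙 c) (1 : R)) =
      (g.app (Opposite.op c)).hom (Finsupp.single (𝟙 c) (1 : R))) : f = g := by
  ext d : 3
  refine Finsupp.lhom_ext' fun φ => LinearMap.ext_ring ?_
  have e : Finsupp.single φ (1 : R) =
      ((freeOn R c).map (Quiver.Hom.op φ)).hom (Finsupp.single (𝟙 c) (1 : R)) := by
    refine Eq.trans ?_ (Finsupp.mapDomain_single (f := fun f => φ ≫ f)).symm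
    rw [Category.comp_id]
  have hf := congrArg (fun k => k.hom (Finsupp.single (𝟙 c) (1 : R)))
    (f.naturality (Quiver.Hom.op φ))
  have hg := congrArg (fun k => k.hom (Finsupp.single (𝟙 c) (1 : R)))
    (g.naturality (Quiver.Hom.op φ))
  change (f.app d).hom (Finsupp.single φ (1 : R)) = (g.app d).hom (Finsupp.single φ (1 : R))
  rw [e]
  exact hf.trans ((congrArg _ h).trans hg.symm)

instance (c : C) : Projective (freeOn R c) where
  factors {E X} f e he := by
    have h1 : Function.Surjective (e.app (Opposite.op c)).hom :=
      (ModuleCat.epi_iff_surjective _).mp inferInstance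
    obtain ⟨m, hm⟩ := h1 ((f.app (Opposite.op c)).hom (Finsupp.single (𝟙 c) (1 : R)))
    refine ⟨freeOnDesc m, freeOn_hom_ext ?_⟩
    refine Eq.trans ?_ hm
    exact congrArg (e.app (Opposite.op c)).hom (freeOnDesc_id m)

theorem epi_desc_freeOnDesc (M : Cᵒᵖ ⥤ ModuleCat.{u} R) :
    Epi (Sigma.desc fun i : (Σ c : C, M.obj (Opposite.op c)) => freeOnDesc i.2) := by
  have : ∀ d, Epi ((Sigma.desc fun i : (Σ c : C, M.obj (Opposite.op c)) =>
      freeOnDesc i.2).app d) := by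
    intro d
    rw [ModuleCat.epi_iff_surjective]
    intro m
    let i : (Σ c : C, M.obj (Opposite.op c)) := ⟨d.unop, m⟩
    refine ⟨((Sigma.ι (fun i : (Σ c : C, M.obj (Opposite.op c)) => freeOn R i.1) i).app d).hom
      (Finsupp.single (𝟙 d.unop) (1 : R)), ?_⟩
    have h := Sigma.ι_desc (fun i : (Σ c : C, M.obj (Opposite.op c)) => freeOnDesc i.2) i
    have h' := congrArg (fun k => (k.app d).hom (Finsupp.single (𝟙 d.unop) (1 : R))) h
    exact h'.trans (freeOnDesc_id m)
  exact NatTrans.epi_of_epi_app _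

instance : EnoughProjectives (Cᵒᵖ ⥤ ModuleCat.{u} R) where
  presentation M := ⟨{
    p := ∐ fun i : (Σ c : C, M.obj (Opposite.op c)) => freeOn R i.1
    projective := inferInstance
    f := Sigma.desc fun i => freeOnDesc i.2
    epi := epi_desc_freeOnDesc M }⟩

end CoTensor

section Pointwise
variable {R : Type} [CommRing R] {D : Type u} [SmallCategory D]

/-- The pointwise tensor product of two functors. -/
noncomputable def pwTensor (A B : D ⥤ ModuleCat.{u} R) : D ⥤ ModuleCat.{u} R where
  obj d := ModuleCat.of R (A.obj d ⊗[R] B.obj d)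
  map φ := ModuleCat.ofHom (TensorProduct.map (A.map φ).hom (B.map φ).hom)
  map_id d := by
    ext : 1
    exact TensorProduct.ext' fun x y => by simp
  map_comp φ ψ := by
    ext : 1
    exact TensorProduct.ext' fun x y => by simp

/-- The pointwise tensor product of two natural transformations. -/
noncomputable def pwTensorMap {A A' B B' : D ⥤ ModuleCat.{u} R} (f : A ⟶ A') (g : B ⟶ B') :
    pwTensor A B ⟶ pwTensor A' B' where
  app d := ModuleCat.ofHom (TensorProduct.map (f.app d).hom (g.app d).hom)
  naturality d d' φ := by
    ext : 1
    refine TensorProduct.ext' fun x y => ?_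
    have h1 : (f.app d').hom ((A.map φ).hom x) = (A'.map φ).hom ((f.app d).hom x) :=
      congrArg (fun k => k.hom x) (f.naturality φ)
    have h2 : (g.app d').hom ((B.map φ).hom y) = (B'.map φ).hom ((g.app d).hom y) :=
      congrArg (fun k => k.hom y) (g.naturality φ)
    change (f.app d').hom ((A.map φ).hom x) ⊗ₜ[R] (g.app d').hom ((B.map φ).hom y) =
      (A'.map φ).hom ((f.app d).hom x) ⊗ₜ[R] (B'.map φ).hom ((g.app d).hom y)
    rw [h1, h2]

end Pointwise

section External
variable {R : Type} [CommRing R] {G₁ G₂ : Type u} [Group G₁] [Group G₂]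
  (F₁ : SubgroupFamily G₁) (F₂ : SubgroupFamily G₂)

/-- The right module `res_{p₁} P ⊗ res_{p₂} Q` over the orbit category of `G₁ × G₂`, as a
bifunctor in `P` and `Q`. -/
noncomputable def extRight : ((Orb F₁)ᵒᵖ ⥤ ModuleCat.{u} R) ⥤ ((Orb F₂)ᵒᵖ ⥤ ModuleCat.{u} R) ⥤
    ((Orb (F₁.prod F₂))ᵒᵖ ⥤ ModuleCat.{u} R) where
  obj P :=
    { obj := fun Q => pwTensor ((Orb.fst F₁ F₂).op ⋙ P) ((Orb.snd F₁ F₂).op ⋙ Q)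
      map := fun g => pwTensorMap (𝟙 _) (Functor.whiskerLeft (Orb.snd F₁ F₂).op g)
      map_id := fun Q => by
        ext d : 3
        exact TensorProduct.ext' fun x y => rfl
      map_comp := fun g h => by
        ext d : 3
        exact TensorProduct.ext' fun x y => rfl }
  map f :=
    { app := fun Q => pwTensorMap (Functor.whiskerLeft (Orb.fst F₁ F₂).op f) (𝟙 _)
      naturality := fun Q Q' g => by
        ext d : 3
        exact TensorProduct.ext' fun x y => rfl }
  map_id P := by
    ext Q d : 5
    exact TensorProduct.ext' fun x y => rfl
  map_comp f g := by
    ext Q d : 5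
    exact TensorProduct.ext' fun x y => rfl

instance : (extRight (R := R) F₁ F₂).Additive where
  map_add {P P' f g} := by
    ext Q d : 5
    exact TensorProduct.ext' fun x y => TensorProduct.add_tmul (R := R) _ _ _

instance (P : (Orb F₁)ᵒᵖ ⥤ ModuleCat.{u} R) : ((extRight (R := R) F₁ F₂).obj P).Additive where
  map_add {Q Q' f g} := by
    ext d : 3
    exact TensorProduct.ext' fun x y => TensorProduct.tmul_add (R := R) _ _ _

/-- The left module `res_{p₁} M ⊗ res_{p₂} M'` over the orbit category of `G₁ × G₂`. -/
noncomputable def extLeft (M : Orb F₁ ⥤ ModuleCat.{u} R) (M' : Orb F₂ ⥤ ModuleCat.{u} R) :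
    Orb (F₁.prod F₂) ⥤ ModuleCat.{u} R :=
  pwTensor (Orb.fst F₁ F₂ ⋙ M) (Orb.snd F₁ F₂ ⋙ M')

/-- Functoriality of `res_{p₁} M ⊗ res_{p₂} M'` in `M` and `M'`. -/
noncomputable def extLeftMap {M N : Orb F₁ ⥤ ModuleCat.{u} R} {M' N' : Orb F₂ ⥤ ModuleCat.{u} R}
    (f : M ⟶ N) (f' : M' ⟶ N') : extLeft F₁ F₂ M M' ⟶ extLeft F₁ F₂ N N' :=
  pwTensorMap (Functor.whiskerLeft (Orb.fst F₁ F₂) f) (Functor.whiskerLeft (Orb.snd F₁ F₂) f')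

variable {F₁ F₂}

/-- The element `a ⊗ b` of `res_{p₁} P ⊗ res_{p₂} Q`. -/
noncomputable def extRightMk {P : (Orb F₁)ᵒᵖ ⥤ ModuleCat.{u} R} {Q : (Orb F₂)ᵒᵖ ⥤ ModuleCat.{u} R}
    {Z : Orb (F₁.prod F₂)} (a : P.obj (Opposite.op ((Orb.fst F₁ F₂).obj Z)))
    (b : Q.obj (Opposite.op ((Orb.snd F₁ F₂).obj Z))) :
    (((extRight F₁ F₂).obj P).obj Q).obj (Opposite.op Z) := a ⊗ₜ[R] b

/-- The element `m ⊗ m'` of `res_{p₁} M ⊗ res_{p₂} M'`. -/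
noncomputable def extLeftMk {M : Orb F₁ ⥤ ModuleCat.{u} R} {M' : Orb F₂ ⥤ ModuleCat.{u} R}
    {Z : Orb (F₁.prod F₂)} (m : M.obj ((Orb.fst F₁ F₂).obj Z))
    (m' : M'.obj ((Orb.snd F₁ F₂).obj Z)) : (extLeft F₁ F₂ M M').obj Z := m ⊗ₜ[R] m'

theorem extRight_map_app_mk {P P' : (Orb F₁)ᵒᵖ ⥤ ModuleCat.{u} R}
    {Q : (Orb F₂)ᵒᵖ ⥤ ModuleCat.{u} R} (f : P ⟶ P') {Z : Orb (F₁.prod F₂)}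
    (a : P.obj (Opposite.op ((Orb.fst F₁ F₂).obj Z)))
    (b : Q.obj (Opposite.op ((Orb.snd F₁ F₂).obj Z))) :
    ((((extRight F₁ F₂).map f).app Q).app (Opposite.op Z)).hom (extRightMk a b) =
      extRightMk ((f.app _).hom a) b := rfl

theorem extRight_obj_map_mk {P : (Orb F₁)ᵒᵖ ⥤ ModuleCat.{u} R}
    {Q Q' : (Orb F₂)ᵒᵖ ⥤ ModuleCat.{u} R} (f : Q ⟶ Q') {Z : Orb (F₁.prod F₂)}
    (a : P.obj (Opposite.op ((Orb.fst F₁ F₂).obj Z)))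
    (b : Q.obj (Opposite.op ((Orb.snd F₁ F₂).obj Z))) :
    ((((extRight F₁ F₂).obj P).map f).app (Opposite.op Z)).hom (extRightMk a b) =
      extRightMk a ((f.app _).hom b) := rfl

section Cross
variable (P : (Orb F₁)ᵒᵖ ⥤ ModuleCat.{u} R) (Q : (Orb F₂)ᵒᵖ ⥤ ModuleCat.{u} R)
  (M : Orb F₁ ⥤ ModuleCat.{u} R) (M' : Orb F₂ ⥤ ModuleCat.{u} R)

/-- For orbits `X = G₁/H₁` and `Y = G₂/H₂`, the map
`(P(X) ⊗ M(X)) ⊗ (Q(Y) ⊗ M'(Y)) → (res P ⊗ res Q) ⊗_F (res M ⊗ res M')`,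
`(a ⊗ m) ⊗ (b ⊗ m') ↦ (a ⊗ b) ⊗ (m ⊗ m')`, into the component of `(G₁ × G₂)/(H₁ × H₂)`. -/
noncomputable def crossAt (X : Orb F₁) (Y : Orb F₂) :
    (P.obj (Opposite.op X) ⊗[R] M.obj X) ⊗[R] (Q.obj (Opposite.op Y) ⊗[R] M'.obj Y) →ₗ[R]
      CoTensor (((extRight F₁ F₂).obj P).obj Q) (extLeft F₁ F₂ M M') :=
  CoTensor.ι (((extRight F₁ F₂).obj P).obj Q) (extLeft F₁ F₂ M M') (Orb.pair X Y) ∘ₗ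
    TensorProduct.map
      (TensorProduct.map (P.map (Orb.fstIso X Y).hom.op).hom (Q.map (Orb.sndIso X Y).hom.op).hom)
      (TensorProduct.map (M.map (Orb.fstIso X Y).inv).hom (M'.map (Orb.sndIso X Y).inv).hom) ∘ₗ
    (TensorProduct.tensorTensorTensorComm R (P.obj (Opposite.op X)) (M.obj X)
      (Q.obj (Opposite.op Y)) (M'.obj Y)).toLinearMap

variable {P Q M M'}

theorem crossAt_tmul {X : Orb F₁} {Y : Orb F₂} (a : P.obj (Opposite.op X)) (m : M.obj X)
    (b : Q.obj (Opposite.op Y)) (m' : M'.obj Y) :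
    crossAt P Q M M' X Y ((a ⊗ₜ[R] m) ⊗ₜ[R] (b ⊗ₜ[R] m')) =
      CoTensor.ι (((extRight F₁ F₂).obj P).obj Q) (extLeft F₁ F₂ M M') (Orb.pair X Y)
        (extRightMk ((P.map (Orb.fstIso X Y).hom.op).hom a) ((Q.map (Orb.sndIso X Y).hom.op).hom b)
          ⊗ₜ[R] extLeftMk ((M.map (Orb.fstIso X Y).inv).hom m)
            ((M'.map (Orb.sndIso X Y).inv).hom m')) := rfl

theorem crossAt_rel {X X' : Orb F₁} {Y Y' : Orb F₂} (φ : X ⟶ X') (ψ : Y ⟶ Y')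
    (a : P.obj (Opposite.op X')) (m : M.obj X) (b : Q.obj (Opposite.op Y')) (m' : M'.obj Y) :
    crossAt P Q M M' X Y (((P.map φ.op).hom a ⊗ₜ[R] m) ⊗ₜ[R] ((Q.map ψ.op).hom b ⊗ₜ[R] m')) =
      crossAt P Q M M' X' Y' ((a ⊗ₜ[R] (M.map φ).hom m) ⊗ₜ[R] (b ⊗ₜ[R] (M'.map ψ).hom m')) := by
  have e1 := Orb.fst_map_pairMap φ ψ
  have e2 := Orb.snd_map_pairMap φ ψ
  have e1' : (Orb.fstIso X Y).inv ≫ (Orb.fst F₁ F₂).map (Orb.pairMap φ ψ) =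
      φ ≫ (Orb.fstIso X' Y').inv := by
    rw [Iso.inv_comp_eq, ← Category.assoc, ← e1, Category.assoc, Iso.hom_inv_id, Category.comp_id]
  have e2' : (Orb.sndIso X Y).inv ≫ (Orb.snd F₁ F₂).map (Orb.pairMap φ ψ) =
      ψ ≫ (Orb.sndIso X' Y').inv := by
    rw [Iso.inv_comp_eq, ← Category.assoc, ← e2, Category.assoc, Iso.hom_inv_id, Category.comp_id]
  have hP : (P.map (Orb.fstIso X Y).hom.op).hom ((P.map φ.op).hom a) =
      (P.map ((Orb.fst F₁ F₂).map (Orb.pairMap φ ψ)).op).hom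
        ((P.map (Orb.fstIso X' Y').hom.op).hom a) := by
    rw [← LinearMap.comp_apply, ← LinearMap.comp_apply, ← ModuleCat.hom_comp,
      ← ModuleCat.hom_comp, ← P.map_comp, ← P.map_comp, ← op_comp, ← op_comp, e1]
  have hQ : (Q.map (Orb.sndIso X Y).hom.op).hom ((Q.map ψ.op).hom b) =
      (Q.map ((Orb.snd F₁ F₂).map (Orb.pairMap φ ψ)).op).hom
        ((Q.map (Orb.sndIso X' Y').hom.op).hom b) := by
    rw [← LinearMap.comp_apply, ← LinearMap.comp_apply, ← ModuleCat.hom_comp,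
      ← ModuleCat.hom_comp, ← Q.map_comp, ← Q.map_comp, ← op_comp, ← op_comp, e2]
  have hM : (M.map (Orb.fstIso X' Y').inv).hom ((M.map φ).hom m) =
      (M.map ((Orb.fst F₁ F₂).map (Orb.pairMap φ ψ))).hom
        ((M.map (Orb.fstIso X Y).inv).hom m) := by
    rw [← LinearMap.comp_apply, ← LinearMap.comp_apply, ← ModuleCat.hom_comp,
      ← ModuleCat.hom_comp, ← M.map_comp, ← M.map_comp, e1']
  have hM' : (M'.map (Orb.sndIso X' Y').inv).hom ((M'.map ψ).hom m') =
      (M'.map ((Orb.snd F₁ F₂).map (Orb.pairMap φ ψ))).hom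
        ((M'.map (Orb.sndIso X Y).inv).hom m') := by
    rw [← LinearMap.comp_apply, ← LinearMap.comp_apply, ← ModuleCat.hom_comp,
      ← ModuleCat.hom_comp, ← M'.map_comp, ← M'.map_comp, e2']
  rw [crossAt_tmul, crossAt_tmul, hP, hQ, hM, hM']
  exact CoTensor.ι_rel (M := ((extRight F₁ F₂).obj P).obj Q) (N := extLeft F₁ F₂ M M')
    (Orb.pairMap φ ψ)
    (extRightMk ((P.map (Orb.fstIso X' Y').hom.op).hom a) ((Q.map (Orb.sndIso X' Y').hom.op).hom b))
    (extLeftMk ((M.map (Orb.fstIso X Y).inv).hom m) ((M'.map (Orb.sndIso X Y).inv).hom m'))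

variable (P Q M M')

/-- The inverse of the natural isomorphism
`(res P ⊗ res Q) ⊗_F (res M ⊗ res M') ≅ (P ⊗_{F₁} M) ⊗ (Q ⊗_{F₂} M')`: it sends
`(a ⊗ m) ⊗ (b ⊗ m')` to `(a ⊗ b) ⊗ (m ⊗ m')`. -/
noncomputable def cross :
    CoTensor P M ⊗[R] CoTensor Q M' →ₗ[R]
      CoTensor (((extRight F₁ F₂).obj P).obj Q) (extLeft F₁ F₂ M M') :=
  TensorProduct.lift (CoTensor.desc
    (fun X => (CoTensor.desc
      (fun Y => (TensorProduct.curry (crossAt P Q M M' X Y)).flip) (by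
        intro Y Y' ψ b m'
        refine TensorProduct.ext' fun a m => ?_
        have h := crossAt_rel (P := P) (Q := Q) (M := M) (M' := M') (𝟙 X) ψ a m b m'
        simpa using h)).flip) (by
    intro X X' φ a m
    refine CoTensor.hom_ext fun Y b m' => ?_
    have h := crossAt_rel (P := P) (Q := Q) (M := M) (M' := M') φ (𝟙 Y) a m b m'
    simpa using h))

variable {P Q M M'}

theorem cross_ι (X : Orb F₁) (Y : Orb F₂) (x : P.obj (Opposite.op X) ⊗[R] M.obj X)
    (y : Q.obj (Opposite.op Y) ⊗[R] M'.obj Y) :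
    cross P Q M M' (CoTensor.ι P M X x ⊗ₜ[R] CoTensor.ι Q M' Y y) =
      crossAt P Q M M' X Y (x ⊗ₜ[R] y) := by
  simp [cross]

theorem cross_ext {Z : Type*} [AddCommGroup Z] [Module R Z]
    {f g : CoTensor P M ⊗[R] CoTensor Q M' →ₗ[R] Z}
    (h : ∀ X Y a m b m', f (CoTensor.ι P M X (a ⊗ₜ[R] m) ⊗ₜ[R] CoTensor.ι Q M' Y (b ⊗ₜ[R] m')) =
      g (CoTensor.ι P M X (a ⊗ₜ[R] m) ⊗ₜ[R] CoTensor.ι Q M' Y (b ⊗ₜ[R] m'))) : f = g := by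
  apply TensorProduct.ext
  refine CoTensor.hom_ext fun X a m => ?_
  refine CoTensor.hom_ext fun Y b m' => ?_
  exact h X Y a m b m'

theorem cross_natural_left {P' : (Orb F₁)ᵒᵖ ⥤ ModuleCat.{u} R} (f : P ⟶ P')
    (x : CoTensor P M) (y : CoTensor Q M') :
    CoTensor.map (((extRight F₁ F₂).map f).app Q) (𝟙 (extLeft F₁ F₂ M M'))
      (cross P Q M M' (x ⊗ₜ[R] y)) =
    cross P' Q M M' (CoTensor.map f (𝟙 M) x ⊗ₜ[R] y) := by
  suffices h : CoTensor.map (((extRight F₁ F₂).map f).app Q) (𝟙 (extLeft F₁ F₂ M M')) ∘ₗ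
      cross P Q M M' = cross P' Q M M' ∘ₗ
        TensorProduct.map (CoTensor.map f (𝟙 M)) LinearMap.id from
    LinearMap.congr_fun h (x ⊗ₜ[R] y)
  refine cross_ext fun X Y a m b m' => ?_
  have hf : (f.app _).hom ((P.map (Orb.fstIso X Y).hom.op).hom a) =
      (P'.map (Orb.fstIso X Y).hom.op).hom ((f.app _).hom a) :=
    congrArg (fun k => k.hom a) (f.naturality (Orb.fstIso X Y).hom.op)
  rw [LinearMap.comp_apply, cross_ι, crossAt_tmul, LinearMap.comp_apply, TensorProduct.map_tmul,
    LinearMap.id_apply, CoTensor.map_ι, CoTensor.map_ι, extRight_map_app_mk, cross_ι, hf, crossAt_tmul]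
  simp only [NatTrans.id_app, ModuleCat.hom_id, LinearMap.id_apply]

theorem cross_natural_right {Q' : (Orb F₂)ᵒᵖ ⥤ ModuleCat.{u} R} (f : Q ⟶ Q')
    (x : CoTensor P M) (y : CoTensor Q M') :
    CoTensor.map (((extRight F₁ F₂).obj P).map f) (𝟙 (extLeft F₁ F₂ M M'))
      (cross P Q M M' (x ⊗ₜ[R] y)) =
    cross P Q' M M' (x ⊗ₜ[R] CoTensor.map f (𝟙 M') y) := by
  suffices h : CoTensor.map (((extRight F₁ F₂).obj P).map f) (𝟙 (extLeft F₁ F₂ M M')) ∘ₗ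
      cross P Q M M' = cross P Q' M M' ∘ₗ
        TensorProduct.map LinearMap.id (CoTensor.map f (𝟙 M')) from
    LinearMap.congr_fun h (x ⊗ₜ[R] y)
  refine cross_ext fun X Y a m b m' => ?_
  have hf : (f.app _).hom ((Q.map (Orb.sndIso X Y).hom.op).hom b) =
      (Q'.map (Orb.sndIso X Y).hom.op).hom ((f.app _).hom b) :=
    congrArg (fun k => k.hom b) (f.naturality (Orb.sndIso X Y).hom.op)
  rw [LinearMap.comp_apply, cross_ι, crossAt_tmul, LinearMap.comp_apply, TensorProduct.map_tmul,
    LinearMap.id_apply, CoTensor.map_ι, CoTensor.map_ι, extRight_obj_map_mk, cross_ι, hf, crossAt_tmul]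
  simp only [NatTrans.id_app, ModuleCat.hom_id, LinearMap.id_apply]

end Cross
end External

section Descent
variable {R : Type} [CommRing R] {X X' Y Y' W : Type u} [AddCommGroup X] [Module R X]
  [AddCommGroup X'] [Module R X'] [AddCommGroup Y] [Module R Y] [AddCommGroup Y'] [Module R Y']
  [AddCommGroup W] [Module R W]

/-- The linear map induced on the target of a surjection. -/
noncomputable def descSurj (f : X →ₗ[R] X') (hf : Function.Surjective f) (T : X →ₗ[R] W)
    (h : ∀ x, f x = 0 → T x = 0) : X' →ₗ[R] W :=
  (LinearMap.ker f).liftQ T (fun x hx => h x hx) ∘ₗ (f.quotKerEquivOfSurjective hf).symm.toLinearMap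

theorem descSurj_apply (f : X →ₗ[R] X') (hf : Function.Surjective f) (T : X →ₗ[R] W)
    (h : ∀ x, f x = 0 → T x = 0) (x : X) : descSurj f hf T h (f x) = T x := by
  have e : (f.quotKerEquivOfSurjective hf).symm (f x) = (LinearMap.ker f).mkQ x := by
    rw [LinearEquiv.symm_apply_eq]
    rfl
  rw [descSurj, LinearMap.comp_apply, LinearEquiv.coe_coe, e]
  exact Submodule.liftQ_apply _ _ _

/-- The linear map induced on the tensor product of the targets of two surjections. -/
noncomputable def descTensor (f : X →ₗ[R] X') (hf : Function.Surjective f) (g : Y →ₗ[R] Y')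
    (hg : Function.Surjective g) (T : X ⊗[R] Y →ₗ[R] W)
    (h₁ : ∀ x y, f x = 0 → T (x ⊗ₜ[R] y) = 0) (h₂ : ∀ x y, g y = 0 → T (x ⊗ₜ[R] y) = 0) :
    X' ⊗[R] Y' →ₗ[R] W :=
  TensorProduct.lift
    (descSurj f hf
      (descSurj g hg (TensorProduct.curry T).flip (fun y hy => by ext x; exact h₂ x y hy)).flip
      (fun x hx => by
        ext y'
        obtain ⟨y, rfl⟩ := hg y'
        rw [LinearMap.flip_apply, descSurj_apply]
        exact h₁ x y hx))

theorem descTensor_tmul (f : X →ₗ[R] X') (hf : Function.Surjective f) (g : Y →ₗ[R] Y')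
    (hg : Function.Surjective g) (T : X ⊗[R] Y →ₗ[R] W)
    (h₁ : ∀ x y, f x = 0 → T (x ⊗ₜ[R] y) = 0) (h₂ : ∀ x y, g y = 0 → T (x ⊗ₜ[R] y) = 0)
    (x : X) (y : Y) : descTensor f hf g hg T h₁ h₂ (f x ⊗ₜ[R] g y) = T (x ⊗ₜ[R] y) := by
  rw [descTensor, TensorProduct.lift.tmul, descSurj_apply, LinearMap.flip_apply, descSurj_apply]
  rfl

end Descent

section Total
variable {R : Type} [CommRing R] {G₁ G₂ : Type u} [Group G₁] [Group G₂]
  {F₁ : SubgroupFamily G₁} {F₂ : SubgroupFamily G₂}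
  (K : ChainComplex ((Orb F₁)ᵒᵖ ⥤ ModuleCat.{u} R) ℕ)
  (L : ChainComplex ((Orb F₂)ᵒᵖ ⥤ ModuleCat.{u} R) ℕ)
  (M : Orb F₁ ⥤ ModuleCat.{u} R) (M' : Orb F₂ ⥤ ModuleCat.{u} R)

/-- The total complex of the double complex `res_{p₁} K_p ⊗ res_{p₂} L_q`. -/
noncomputable def extTotal : ChainComplex ((Orb (F₁.prod F₂))ᵒᵖ ⥤ ModuleCat.{u} R) ℕ :=
  HomologicalComplex.mapBifunctor K L (extRight F₁ F₂) (ComplexShape.down ℕ)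

/-- The inclusion of the summand `res_{p₁} K_p ⊗ res_{p₂} L_q` of the total complex. -/
noncomputable def extTotalι (p q n : ℕ) (h : p + q = n) :
    ((extRight F₁ F₂).obj (K.X p)).obj (L.X q) ⟶ (extTotal K L).X n :=
  HomologicalComplex.ιMapBifunctor K L (extRight F₁ F₂) (ComplexShape.down ℕ) p q n h

/-- The complex `K ⊗_F M`. -/
noncomputable abbrev tensorComplex {C : Type u} [SmallCategory C]
    (K : ChainComplex (Cᵒᵖ ⥤ ModuleCat.{u} R) ℕ) (M : C ⥤ ModuleCat.{u} R) :
    ChainComplex (ModuleCat.{u} R) ℕ :=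
  ((tensorOver M).mapHomologicalComplex (ComplexShape.down ℕ)).obj K

/-- The chain level cross product
`(K_p ⊗_{F₁} M) ⊗ (L_q ⊗_{F₂} M') → (Tot (res K ⊗ res L))_n ⊗_F (res M ⊗ res M')`. -/
noncomputable def chainCross (p q n : ℕ) (h : p + q = n) :
    CoTensor (K.X p) M ⊗[R] CoTensor (L.X q) M' →ₗ[R]
      CoTensor ((extTotal K L).X n) (extLeft F₁ F₂ M M') :=
  CoTensor.map (extTotalι K L p q n h) (𝟙 _) ∘ₗ cross (K.X p) (L.X q) M M'

variable {K L M M'}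

theorem CoTensor.map_comp_apply {C : Type u} [SmallCategory C] {A B D : Cᵒᵖ ⥤ ModuleCat.{u} R}
    {N : C ⥤ ModuleCat.{u} R} (f : A ⟶ B) (g : B ⟶ D) (x : CoTensor A N) :
    CoTensor.map (f ≫ g) (𝟙 N) x = CoTensor.map g (𝟙 N) (CoTensor.map f (𝟙 N) x) :=
  congrArg (fun k => k.hom x) ((tensorOver N).map_comp f g)

theorem CoTensor.map_add_apply {C : Type u} [SmallCategory C] {A B : Cᵒᵖ ⥤ ModuleCat.{u} R}
    {N : C ⥤ ModuleCat.{u} R} (f g : A ⟶ B) (x : CoTensor A N) :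
    CoTensor.map (f + g) (𝟙 N) x = CoTensor.map f (𝟙 N) x + CoTensor.map g (𝟙 N) x :=
  congrArg (fun k => k.hom x) ((tensorOver N).map_add (f := f) (g := g))

theorem CoTensor.map_zero_apply {C : Type u} [SmallCategory C] {A B : Cᵒᵖ ⥤ ModuleCat.{u} R}
    {N : C ⥤ ModuleCat.{u} R} (x : CoTensor A N) :
    CoTensor.map (0 : A ⟶ B) (𝟙 N) x = 0 :=
  congrArg (fun k => k.hom x) ((tensorOver N).map_zero A B)

theorem CoTensor.map_neg_apply {C : Type u} [SmallCategory C] {A B : Cᵒᵖ ⥤ ModuleCat.{u} R}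
    {N : C ⥤ ModuleCat.{u} R} (f : A ⟶ B) (x : CoTensor A N) :
    CoTensor.map (-f) (𝟙 N) x = -CoTensor.map f (𝟙 N) x :=
  congrArg (fun k => k.hom x) ((tensorOver N).map_neg (f := f))

theorem CoTensor.map_units_smul_apply {C : Type u} [SmallCategory C]
    {A B : Cᵒᵖ ⥤ ModuleCat.{u} R} {N : C ⥤ ModuleCat.{u} R} (ε : ℤˣ) (f : A ⟶ B)
    (x : CoTensor A N) :
    CoTensor.map (ε • f) (𝟙 N) x = ε • CoTensor.map f (𝟙 N) x := by
  rcases Int.units_eq_one_or ε with rfl | rfl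
  · rw [one_smul, one_smul]
  · rw [Units.neg_smul, one_smul, Units.neg_smul, one_smul, CoTensor.map_neg_apply]

variable (K L) in
/-- The part of the differential of the total complex coming from the first complex. -/
noncomputable def extD₁ (n n' : ℕ) : (extTotal K L).X n ⟶ (extTotal K L).X n' :=
  HomologicalComplex.mapBifunctor.D₁ K L (extRight F₁ F₂) (ComplexShape.down ℕ) n n'

variable (K L) in
/-- The part of the differential of the total complex coming from the second complex. -/
noncomputable def extD₂ (n n' : ℕ) : (extTotal K L).X n ⟶ (extTotal K L).X n' :=
  HomologicalComplex.mapBifunctor.D₂ K L (extRight F₁ F₂) (ComplexShape.down ℕ) n n'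

theorem extTotal_d (n n' : ℕ) : (extTotal K L).d n n' = extD₁ K L n n' + extD₂ K L n n' := rfl

theorem extTotalι_extD₁ (p q n n' : ℕ) (h : (p + 1) + q = n) (h' : p + q = n') :
    extTotalι K L (p + 1) q n h ≫ extD₁ K L n n' =
      ComplexShape.ε₁ (ComplexShape.down ℕ) (ComplexShape.down ℕ) (ComplexShape.down ℕ)
        (p + 1, q) • (((extRight F₁ F₂).map (K.d (p + 1) p)).app (L.X q) ≫
          extTotalι K L p q n' h') :=
  (HomologicalComplex.mapBifunctor.ι_D₁ K L (extRight F₁ F₂) (ComplexShape.down ℕ) n n' (p + 1) q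
    h).trans (HomologicalComplex.mapBifunctor.d₁_eq K L (extRight F₁ F₂) (ComplexShape.down ℕ)
      (show (ComplexShape.down ℕ).Rel (p + 1) p from rfl) q n' h')

theorem extTotalι_extD₁_of_ne (p q n n' : ℕ) (h : (p + 1) + q = n) (h' : p + q ≠ n') :
    extTotalι K L (p + 1) q n h ≫ extD₁ K L n n' = 0 :=
  (HomologicalComplex.mapBifunctor.ι_D₁ K L (extRight F₁ F₂) (ComplexShape.down ℕ) n n' (p + 1) q
    h).trans (HomologicalComplex.mapBifunctor.d₁_eq_zero' K L (extRight F₁ F₂) (ComplexShape.down ℕ)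
      (show (ComplexShape.down ℕ).Rel (p + 1) p from rfl) q n' h')

theorem extTotalι_zero_extD₁ (q n n' : ℕ) (h : 0 + q = n) :
    extTotalι K L 0 q n h ≫ extD₁ K L n n' = 0 :=
  (HomologicalComplex.mapBifunctor.ι_D₁ K L (extRight F₁ F₂) (ComplexShape.down ℕ) n n' 0 q
    h).trans (HomologicalComplex.mapBifunctor.d₁_eq_zero K L (extRight F₁ F₂) (ComplexShape.down ℕ)
      0 q n' (by simp))

theorem extTotalι_extD₂ (p q n n' : ℕ) (h : p + (q + 1) = n) (h' : p + q = n') :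
    extTotalι K L p (q + 1) n h ≫ extD₂ K L n n' =
      ComplexShape.ε₂ (ComplexShape.down ℕ) (ComplexShape.down ℕ) (ComplexShape.down ℕ)
        (p, q + 1) • (((extRight F₁ F₂).obj (K.X p)).map (L.d (q + 1) q) ≫
          extTotalι K L p q n' h') :=
  (HomologicalComplex.mapBifunctor.ι_D₂ K L (extRight F₁ F₂) (ComplexShape.down ℕ) n n' p (q + 1)
    h).trans (HomologicalComplex.mapBifunctor.d₂_eq K L (extRight F₁ F₂) (ComplexShape.down ℕ)
      p (show (ComplexShape.down ℕ).Rel (q + 1) q from rfl) n' h')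

theorem extTotalι_extD₂_of_ne (p q n n' : ℕ) (h : p + (q + 1) = n) (h' : p + q ≠ n') :
    extTotalι K L p (q + 1) n h ≫ extD₂ K L n n' = 0 :=
  (HomologicalComplex.mapBifunctor.ι_D₂ K L (extRight F₁ F₂) (ComplexShape.down ℕ) n n' p (q + 1)
    h).trans (HomologicalComplex.mapBifunctor.d₂_eq_zero' K L (extRight F₁ F₂) (ComplexShape.down ℕ)
      p (show (ComplexShape.down ℕ).Rel (q + 1) q from rfl) n' h')

theorem extTotalι_zero_extD₂ (p n n' : ℕ) (h : p + 0 = n) :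
    extTotalι K L p 0 n h ≫ extD₂ K L n n' = 0 :=
  (HomologicalComplex.mapBifunctor.ι_D₂ K L (extRight F₁ F₂) (ComplexShape.down ℕ) n n' p 0
    h).trans (HomologicalComplex.mapBifunctor.d₂_eq_zero K L (extRight F₁ F₂) (ComplexShape.down ℕ)
      p 0 n' (by simp))

theorem chainCross_comp (p q n : ℕ) (h : p + q = n) {B : (Orb (F₁.prod F₂))ᵒᵖ ⥤ ModuleCat.{u} R}
    (g : (extTotal K L).X n ⟶ B) (t : CoTensor (K.X p) M ⊗[R] CoTensor (L.X q) M') :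
    CoTensor.map g (𝟙 _) (chainCross K L M M' p q n h t) =
      CoTensor.map (extTotalι K L p q n h ≫ g) (𝟙 _) (cross (K.X p) (L.X q) M M' t) :=
  (CoTensor.map_comp_apply _ _ _).symm

/-- The first part of the differential of the total complex on cross products. -/
theorem chainCross_D₁ (p q n n' : ℕ) (h : (p + 1) + q = n) (h' : p + q = n')
    (x : CoTensor (K.X (p + 1)) M) (y : CoTensor (L.X q) M') :
    CoTensor.map (extD₁ K L n n') (𝟙 _) (chainCross K L M M' (p + 1) q n h (x ⊗ₜ[R] y)) =
    ComplexShape.ε₁ (ComplexShape.down ℕ) (ComplexShape.down ℕ) (ComplexShape.down ℕ) (p + 1, q) •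
      chainCross K L M M' p q n' h' (CoTensor.map (K.d (p + 1) p) (𝟙 M) x ⊗ₜ[R] y) := by
  rw [chainCross_comp, extTotalι_extD₁ p q n n' h h', CoTensor.map_units_smul_apply,
    CoTensor.map_comp_apply, cross_natural_left]
  rfl

theorem chainCross_D₁_eq_zero (p q n n' : ℕ) (h : p + q = n)
    (x : CoTensor (K.X p) M) (y : CoTensor (L.X q) M')
    (hx : ∀ p', p' + 1 = p → CoTensor.map (K.d p p') (𝟙 M) x = 0) :
    CoTensor.map (extD₁ K L n n') (𝟙 _) (chainCross K L M M' p q n h (x ⊗ₜ[R] y)) = 0 := by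
  rcases p with _ | p
  · rw [chainCross_comp, extTotalι_zero_extD₁, CoTensor.map_zero_apply]
  · by_cases h' : p + q = n'
    · rw [chainCross_D₁ p q n n' h h', hx p rfl, TensorProduct.zero_tmul, map_zero, smul_zero]
    · rw [chainCross_comp, extTotalι_extD₁_of_ne _ _ _ _ _ h', CoTensor.map_zero_apply]

/-- The second part of the differential of the total complex on cross products. -/
theorem chainCross_D₂ (p q n n' : ℕ) (h : p + (q + 1) = n) (h' : p + q = n')
    (x : CoTensor (K.X p) M) (y : CoTensor (L.X (q + 1)) M') :
    CoTensor.map (extD₂ K L n n') (𝟙 _) (chainCross K L M M' p (q + 1) n h (x ⊗ₜ[R] y)) =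
    ComplexShape.ε₂ (ComplexShape.down ℕ) (ComplexShape.down ℕ) (ComplexShape.down ℕ) (p, q + 1) •
      chainCross K L M M' p q n' h' (x ⊗ₜ[R] CoTensor.map (L.d (q + 1) q) (𝟙 M') y) := by
  rw [chainCross_comp, extTotalι_extD₂ p q n n' h h', CoTensor.map_units_smul_apply,
    CoTensor.map_comp_apply, cross_natural_right]
  rfl

theorem chainCross_D₂_eq_zero (p q n n' : ℕ) (h : p + q = n)
    (x : CoTensor (K.X p) M) (y : CoTensor (L.X q) M')
    (hy : ∀ q', q' + 1 = q → CoTensor.map (L.d q q') (𝟙 M') y = 0) :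
    CoTensor.map (extD₂ K L n n') (𝟙 _) (chainCross K L M M' p q n h (x ⊗ₜ[R] y)) = 0 := by
  rcases q with _ | q
  · rw [chainCross_comp, extTotalι_zero_extD₂, CoTensor.map_zero_apply]
  · by_cases h' : p + q = n'
    · rw [chainCross_D₂ p q n n' h h', hy q rfl, TensorProduct.tmul_zero, map_zero, smul_zero]
    · rw [chainCross_comp, extTotalι_extD₂_of_ne _ _ _ _ _ h', CoTensor.map_zero_apply]

theorem extTotal_d_apply (n n' : ℕ) (z : CoTensor ((extTotal K L).X n) (extLeft F₁ F₂ M M')) :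
    CoTensor.map ((extTotal K L).d n n') (𝟙 _) z =
      CoTensor.map (extD₁ K L n n') (𝟙 _) z + CoTensor.map (extD₂ K L n n') (𝟙 _) z :=
  CoTensor.map_add_apply _ _ _

/-- The cross product of two cycles is a cycle. -/
theorem chainCross_cycle (p q n n' : ℕ) (h : p + q = n)
    (x : CoTensor (K.X p) M) (y : CoTensor (L.X q) M')
    (hx : ∀ p', CoTensor.map (K.d p p') (𝟙 M) x = 0)
    (hy : ∀ q', CoTensor.map (L.d q q') (𝟙 M') y = 0) :
    CoTensor.map ((extTotal K L).d n n') (𝟙 _) (chainCross K L M M' p q n h (x ⊗ₜ y)) = 0 := by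
  rw [extTotal_d_apply, chainCross_D₁_eq_zero p q n n' h x y (fun p' _ => hx p'),
    chainCross_D₂_eq_zero p q n n' h x y (fun q' _ => hy q')]
  exact add_zero _

theorem chainCross_boundary_left (p q n : ℕ) (h : p + q = n)
    (x : CoTensor (K.X (p + 1)) M) (y : CoTensor (L.X q) M')
    (hy : ∀ q', CoTensor.map (L.d q q') (𝟙 M') y = 0) :
    ∃ z, CoTensor.map ((extTotal K L).d (n + 1) n) (𝟙 _) z =
      chainCross K L M M' p q n h (CoTensor.map (K.d (p + 1) p) (𝟙 M) x ⊗ₜ y) := by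
  refine ⟨ComplexShape.ε₁ (ComplexShape.down ℕ) (ComplexShape.down ℕ) (ComplexShape.down ℕ)
    (p + 1, q) • chainCross K L M M' (p + 1) q (n + 1) (by omega) (x ⊗ₜ y), ?_⟩
  rw [extTotal_d_apply, Units.smul_def, map_zsmul, map_zsmul,
    chainCross_D₁ p q (n + 1) n (by omega) h,
    chainCross_D₂_eq_zero (p + 1) q (n + 1) n (by omega) x y (fun q' _ => hy q'), smul_zero,
    add_zero, ← Units.smul_def, smul_smul, Int.units_mul_self, one_smul]

theorem chainCross_boundary_right (p q n : ℕ) (h : p + q = n)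
    (x : CoTensor (K.X p) M) (y : CoTensor (L.X (q + 1)) M')
    (hx : ∀ p', CoTensor.map (K.d p p') (𝟙 M) x = 0) :
    ∃ z, CoTensor.map ((extTotal K L).d (n + 1) n) (𝟙 _) z =
      chainCross K L M M' p q n h (x ⊗ₜ CoTensor.map (L.d (q + 1) q) (𝟙 M') y) := by
  refine ⟨ComplexShape.ε₂ (ComplexShape.down ℕ) (ComplexShape.down ℕ) (ComplexShape.down ℕ)
    (p, q + 1) • chainCross K L M M' p (q + 1) (n + 1) (by omega) (x ⊗ₜ y), ?_⟩
  rw [extTotal_d_apply, Units.smul_def, map_zsmul, map_zsmul,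
    chainCross_D₂ p q (n + 1) n (by omega) h,
    chainCross_D₁_eq_zero p (q + 1) (n + 1) n (by omega) x y (fun p' _ => hx p'), smul_zero,
    zero_add, ← Units.smul_def, smul_smul, Int.units_mul_self, one_smul]

theorem tensorComplex_cycle_d {C : Type u} [SmallCategory C]
    (K : ChainComplex (Cᵒᵖ ⥤ ModuleCat.{u} R) ℕ) (M : C ⥤ ModuleCat.{u} R) (p p' : ℕ)
    (x : (tensorComplex K M).cycles p) :
    CoTensor.map (K.d p p') (𝟙 M) (((tensorComplex K M).iCycles p).hom x) = 0 :=
  congrArg (fun k => k.hom x) ((tensorComplex K M).iCycles_d p p')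

theorem homologyπ_surjective (A : ChainComplex (ModuleCat.{u} R) ℕ) (n : ℕ) :
    Function.Surjective (A.homologyπ n).hom :=
  (ModuleCat.epi_iff_surjective _).mp inferInstance

theorem exists_of_homologyπ_eq_zero (A : ChainComplex (ModuleCat.{u} R) ℕ) (n : ℕ)
    (x : A.cycles n) (hx : (A.homologyπ n).hom x = 0) :
    ∃ z : A.X (n + 1), (A.d (n + 1) n).hom z = (A.iCycles n).hom x := by
  have h := (ShortComplex.mk _ _ (A.toCycles_comp_homologyπ (n + 1) n)).exact_of_g_is_cokernel
    (A.homologyIsCokernel (n + 1) n (by simp))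
  obtain ⟨z, hz⟩ := (ShortComplex.moduleCat_exact_iff _).mp h x hx
  refine ⟨z, ?_⟩
  have e := congrArg (fun k => k.hom z) (A.toCycles_i (n + 1) n)
  exact e.symm.trans (congrArg (A.iCycles n).hom hz)

theorem homologyπ_eq_zero_of_exists (A : ChainComplex (ModuleCat.{u} R) ℕ) (n : ℕ)
    (x : A.cycles n) (z : A.X (n + 1)) (hz : (A.d (n + 1) n).hom z = (A.iCycles n).hom x) :
    (A.homologyπ n).hom x = 0 := by
  have e := congrArg (fun k => k.hom z) (A.toCycles_i (n + 1) n)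
  have h1 : (A.toCycles (n + 1) n).hom z = x :=
    (ModuleCat.mono_iff_injective (A.iCycles n)).mp inferInstance (e.trans hz)
  rw [← h1]
  exact congrArg (fun k => k.hom z) (A.toCycles_comp_homologyπ (n + 1) n)

variable (K L M M')

/-- The cross product of cycles, as a chain. -/
noncomputable def chainCrossOfCycles (p q n : ℕ) (h : p + q = n) :
    ModuleCat.of R ((tensorComplex K M).cycles p ⊗[R] (tensorComplex L M').cycles q) ⟶
      (tensorComplex (extTotal K L) (extLeft F₁ F₂ M M')).X n :=
  ModuleCat.ofHom (chainCross K L M M' p q n h ∘ₗ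
    TensorProduct.map ((tensorComplex K M).iCycles p).hom ((tensorComplex L M').iCycles q).hom)

theorem chainCrossOfCycles_tmul (p q n : ℕ) (h : p + q = n) (x : (tensorComplex K M).cycles p)
    (y : (tensorComplex L M').cycles q) :
    (chainCrossOfCycles K L M M' p q n h).hom (x ⊗ₜ[R] y) = chainCross K L M M' p q n h
      (((tensorComplex K M).iCycles p).hom x ⊗ₜ[R] ((tensorComplex L M').iCycles q).hom y) := rfl

theorem chainCrossOfCycles_d (p q n n' : ℕ) (h : p + q = n) :
    chainCrossOfCycles K L M M' p q n h ≫
      (tensorComplex (extTotal K L) (extLeft F₁ F₂ M M')).d n n' = 0 := by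
  ext : 1
  refine TensorProduct.ext' fun x y => ?_
  exact chainCross_cycle p q n _ h _ _ (fun p' => tensorComplex_cycle_d K M p p' x)
    (fun q' => tensorComplex_cycle_d L M' q q' y)

/-- The cross product of cycles, as a cycle. -/
noncomputable def cyclesCross (p q n : ℕ) (h : p + q = n) :
    ModuleCat.of R ((tensorComplex K M).cycles p ⊗[R] (tensorComplex L M').cycles q) ⟶
      (tensorComplex (extTotal K L) (extLeft F₁ F₂ M M')).cycles n :=
  HomologicalComplex.liftCycles _ (chainCrossOfCycles K L M M' p q n h) _ rfl
    (chainCrossOfCycles_d K L M M' p q n _ h)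

theorem cyclesCross_i (p q n : ℕ) (h : p + q = n) :
    cyclesCross K L M M' p q n h ≫
      (tensorComplex (extTotal K L) (extLeft F₁ F₂ M M')).iCycles n =
    chainCrossOfCycles K L M M' p q n h :=
  HomologicalComplex.liftCycles_i _ _ _ _ _

/-- The homology class of the cross product of cycles. -/
noncomputable def classCross (p q n : ℕ) (h : p + q = n) :
    ((tensorComplex K M).cycles p ⊗[R] (tensorComplex L M').cycles q) →ₗ[R]
      (tensorComplex (extTotal K L) (extLeft F₁ F₂ M M')).homology n :=
  (cyclesCross K L M M' p q n h ≫
    (tensorComplex (extTotal K L) (extLeft F₁ F₂ M M')).homologyπ n).hom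

theorem classCross_eq_zero (p q n : ℕ) (h : p + q = n) (x : (tensorComplex K M).cycles p)
    (y : (tensorComplex L M').cycles q)
    (hz : ∃ z, CoTensor.map ((extTotal K L).d (n + 1) n) (𝟙 (extLeft F₁ F₂ M M')) z =
      chainCross K L M M' p q n h
        (((tensorComplex K M).iCycles p).hom x ⊗ₜ[R] ((tensorComplex L M').iCycles q).hom y)) :
    classCross K L M M' p q n h (x ⊗ₜ[R] y) = 0 := by
  obtain ⟨z, hz⟩ := hz
  exact homologyπ_eq_zero_of_exists _ _ ((cyclesCross K L M M' p q n h).hom (x ⊗ₜ[R] y)) z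
    (hz.trans (LinearMap.congr_fun (congrArg ModuleCat.Hom.hom
      (cyclesCross_i K L M M' p q n h)) (x ⊗ₜ[R] y)).symm)

/-- The linear map underlying the cross product in homology. -/
noncomputable def homologyCrossLin (p q n : ℕ) (h : p + q = n) :
    ((tensorComplex K M).homology p ⊗[R] (tensorComplex L M').homology q) →ₗ[R]
      (tensorComplex (extTotal K L) (extLeft F₁ F₂ M M')).homology n :=
  descTensor ((tensorComplex K M).homologyπ p).hom (homologyπ_surjective _ _)
    ((tensorComplex L M').homologyπ q).hom (homologyπ_surjective _ _)
    (classCross K L M M' p q n h)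
    (by
      intro x y hx
      obtain ⟨z, hz⟩ := exists_of_homologyπ_eq_zero _ _ x hx
      obtain ⟨w, hw⟩ := chainCross_boundary_left p q n h z
        (((tensorComplex L M').iCycles q).hom y) (tensorComplex_cycle_d L M' q · y)
      refine classCross_eq_zero K L M M' p q n h x y ⟨w, hw.trans ?_⟩
      exact congrArg (fun t => chainCross K L M M' p q n h (t ⊗ₜ[R] _)) hz)
    (by
      intro x y hy
      obtain ⟨z, hz⟩ := exists_of_homologyπ_eq_zero _ _ y hy
      obtain ⟨w, hw⟩ := chainCross_boundary_right p q n h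
        (((tensorComplex K M).iCycles p).hom x) z (tensorComplex_cycle_d K M p · x)
      refine classCross_eq_zero K L M M' p q n h x y ⟨w, hw.trans ?_⟩
      exact congrArg (fun t => chainCross K L M M' p q n h (_ ⊗ₜ[R] t)) hz)

/-- The cross product of the classes of two cycles is the class of their cross product. -/
theorem homologyCrossLin_tmul (p q n : ℕ) (h : p + q = n) (x : (tensorComplex K M).cycles p)
    (y : (tensorComplex L M').cycles q) :
    homologyCrossLin K L M M' p q n h
      (((tensorComplex K M).homologyπ p).hom x ⊗ₜ[R] ((tensorComplex L M').homologyπ q).hom y) =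
    classCross K L M M' p q n h (x ⊗ₜ[R] y) :=
  descTensor_tmul ((tensorComplex K M).homologyπ p).hom (homologyπ_surjective _ _)
    ((tensorComplex L M').homologyπ q).hom (homologyπ_surjective _ _)
    (classCross K L M M' p q n h) _ _ x y

/-- The cross product in homology
`H_p(K ⊗ M) ⊗ H_q(L ⊗ M') → H_n(Tot(res K ⊗ res L) ⊗ (res M ⊗ res M'))`, `n = p + q`,
`[z] ⊗ [z'] ↦ [z × z']`. -/
noncomputable def homologyCross (p q n : ℕ) (h : p + q = n) :
    ((modTensor R).obj ((tensorComplex K M).homology p)).obj ((tensorComplex L M').homology q) ⟶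
      (tensorComplex (extTotal K L) (extLeft F₁ F₂ M M')).homology n :=
  ModuleCat.ofHom (homologyCrossLin K L M M' p q n h)

end Total

section Bredon
variable {R : Type} [CommRing R] {G : Type u} [Group G]

/-- The trivial right module over the orbit category: the constant functor `R`. -/
def trivialModule (R : Type) [CommRing R] (F : SubgroupFamily G) :
    (Orb F)ᵒᵖ ⥤ ModuleCat.{u} R :=
  (Functor.const _).obj (ModuleCat.of R (ULift.{u} R))

/-- The Bredon homology `H_n^F(G; M) = Tor_n(R, M)`: the `n`-th left derived functor of `? ⊗_F M`
evaluated at the trivial module. -/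
noncomputable def bredonHomology (F : SubgroupFamily G) (n : ℕ) (M : Orb F ⥤ ModuleCat.{u} R) :
    ModuleCat.{u} R :=
  ((tensorOver M).leftDerived n).obj (trivialModule R F)

/-- The map on Bredon homology induced by a homomorphism of coefficient modules. -/
noncomputable def bredonHomologyMap (F : SubgroupFamily G) (n : ℕ) {M N : Orb F ⥤ ModuleCat.{u} R}
    (f : M ⟶ N) : bredonHomology F n M ⟶ bredonHomology F n N :=
  (NatTrans.leftDerived (tensorOverMap f) n).app (trivialModule R F)

/-- A projective resolution is free if all its modules are free. -/
def IsFreeResolution {C : Type u} [SmallCategory C] {Z : Cᵒᵖ ⥤ ModuleCat.{u} R}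
    (P : ProjectiveResolution Z) : Prop :=
  ∀ n, IsFreeFunctor (P.complex.X n)

/-- A chain complex of `R`-modules is free if each of its modules is free. -/
def IsFreeComplex (A : ChainComplex (ModuleCat.{u} R) ℕ) : Prop :=
  ∀ n, Module.Free R (A.X n)

end Bredon

section Product
variable {R : Type} [CommRing R] {G₁ G₂ : Type u} [Group G₁] [Group G₂]
  {F₁ : SubgroupFamily G₁} {F₂ : SubgroupFamily G₂}

/-- The multiplication map from the product of the trivial modules to the trivial module. -/
noncomputable def trivialMul (R : Type) [CommRing R] (F₁ : SubgroupFamily G₁)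
    (F₂ : SubgroupFamily G₂) :
    ((extRight F₁ F₂).obj (trivialModule R F₁)).obj (trivialModule R F₂) ⟶
      trivialModule R (F₁.prod F₂) where
  app _ := ModuleCat.ofHom (ULift.moduleEquiv.symm.toLinearMap ∘ₗ LinearMap.mul' R R ∘ₗ
    TensorProduct.map (ULift.moduleEquiv (R := R) (M := R)).toLinearMap
      (ULift.moduleEquiv (R := R) (M := R)).toLinearMap)
  naturality Z Z' φ := by
    ext : 1
    exact TensorProduct.ext' fun x y => rfl

theorem trivialMul_app_tmul (Z : (Orb (F₁.prod F₂))ᵒᵖ) (r s : R) :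
    ((trivialMul R F₁ F₂).app Z).hom
      (extRightMk (P := trivialModule R F₁) (Q := trivialModule R F₂) (Z := Z.unop)
        (ULift.up r) (ULift.up s)) = ULift.up (r * s) := rfl

/-- The augmentation `P_0 → Z` of a projective resolution. -/
noncomputable def augmentation {C : Type u} [SmallCategory C] {Z : Cᵒᵖ ⥤ ModuleCat.{u} R}
    (P : ProjectiveResolution Z) : P.complex.X 0 ⟶ Z :=
  (ChainComplex.toSingle₀Equiv P.complex Z P.π).1

theorem d_augmentation {C : Type u} [SmallCategory C] {Z : Cᵒᵖ ⥤ ModuleCat.{u} R}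
    (P : ProjectiveResolution Z) : P.complex.d 1 0 ≫ augmentation P = 0 :=
  (ChainComplex.toSingle₀Equiv P.complex Z P.π).2

variable (P : ProjectiveResolution (trivialModule R F₁))
  (Q : ProjectiveResolution (trivialModule R F₂))

/-- The product of two augmentations. -/
noncomputable def augProd :
    ((extRight F₁ F₂).obj (P.complex.X 0)).obj (Q.complex.X 0) ⟶ trivialModule R (F₁.prod F₂) :=
  ((extRight F₁ F₂).map (augmentation P)).app (Q.complex.X 0) ≫
    ((extRight F₁ F₂).obj (trivialModule R F₁)).map (augmentation Q) ≫ trivialMul R F₁ F₂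

theorem augProd_left : ((extRight F₁ F₂).map (P.complex.d 1 0)).app (Q.complex.X 0) ≫
    augProd P Q = 0 := by
  rw [augProd, ← Category.assoc, ← NatTrans.comp_app, ← Functor.map_comp, d_augmentation,
    Functor.map_zero]
  simp

theorem augProd_right : ((extRight F₁ F₂).obj (P.complex.X 0)).map (Q.complex.d 1 0) ≫
    augProd P Q = 0 := by
  rw [augProd, ← Category.assoc, NatTrans.naturality, Category.assoc,
    ← Functor.map_comp_assoc, d_augmentation, Functor.map_zero]
  simp

/-- The augmentation of the total complex in degree zero. -/
noncomputable def totalAug₀ : (extTotal P.complex Q.complex).X 0 ⟶ trivialModule R (F₁.prod F₂) :=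
  HomologicalComplex.mapBifunctorDesc (K₁ := P.complex) (K₂ := Q.complex) (F := extRight F₁ F₂)
    (c := ComplexShape.down ℕ) fun p q h =>
      eqToHom (by
        have h' : p + q = 0 := h
        rw [show p = 0 by omega, show q = 0 by omega]) ≫ augProd P Q

theorem extTotalι_totalAug₀ : extTotalι P.complex Q.complex 0 0 0 rfl ≫ totalAug₀ P Q =
    augProd P Q := by
  refine (HomologicalComplex.ι_mapBifunctorDesc (K₁ := P.complex) (K₂ := Q.complex)
    (F := extRight F₁ F₂) (c := ComplexShape.down ℕ) _ 0 0 rfl).trans ?_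
  exact Category.id_comp _

theorem extTotal_hom_ext {K : ChainComplex ((Orb F₁)ᵒᵖ ⥤ ModuleCat.{u} R) ℕ}
    {L : ChainComplex ((Orb F₂)ᵒᵖ ⥤ ModuleCat.{u} R) ℕ} {n : ℕ}
    {B : (Orb (F₁.prod F₂))ᵒᵖ ⥤ ModuleCat.{u} R} {f g : (extTotal K L).X n ⟶ B}
    (h : ∀ p q (hpq : p + q = n), extTotalι K L p q n hpq ≫ f = extTotalι K L p q n hpq ≫ g) :
    f = g :=
  HomologicalComplex.mapBifunctor.hom_ext h

theorem d_totalAug₀ : (extTotal P.complex Q.complex).d 1 0 ≫ totalAug₀ P Q = 0 := by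
  refine extTotal_hom_ext fun p q hpq => ?_
  rw [extTotal_d, Preadditive.add_comp, Preadditive.comp_add, ← Category.assoc, ← Category.assoc,
    comp_zero]
  obtain ⟨rfl, rfl⟩ | ⟨rfl, rfl⟩ : (p = 1 ∧ q = 0) ∨ (p = 0 ∧ q = 1) := by omega
  · rw [extTotalι_extD₁ 0 0 1 0 rfl rfl, extTotalι_zero_extD₂, zero_comp, add_zero,
      Linear.units_smul_comp, Category.assoc, extTotalι_totalAug₀, augProd_left, smul_zero]
  · rw [extTotalι_extD₂ 0 0 1 0 rfl rfl, extTotalι_zero_extD₁, zero_comp, zero_add,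
      Linear.units_smul_comp, Category.assoc, extTotalι_totalAug₀, augProd_right, smul_zero]

/-- The augmentation of the total complex, as a chain map to the trivial module. -/
noncomputable def totalAug : extTotal P.complex Q.complex ⟶
    (ChainComplex.single₀ _).obj (trivialModule R (F₁.prod F₂)) :=
  (ChainComplex.toSingle₀Equiv _ _).symm ⟨totalAug₀ P Q, d_totalAug₀ P Q⟩

/-- The total complex `Tot(res_{p₁} P ⊗ res_{p₂} Q)` of two resolutions of the trivial modules,
with the product augmentation, is a projective resolution of the trivial module. -/
structure IsTotalResolution : Prop where
  projective : ∀ n, Projective ((extTotal P.complex Q.complex).X n)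
  quasiIso : QuasiIso (totalAug P Q)

variable {P Q}

/-- The total complex as a projective resolution of the trivial module. -/
noncomputable def totalResolution (h : IsTotalResolution P Q) :
    ProjectiveResolution (trivialModule R (F₁.prod F₂)) where
  complex := extTotal P.complex Q.complex
  projective := h.projective
  π := totalAug P Q
  quasiIso := h.quasiIso

variable (M : Orb F₁ ⥤ ModuleCat.{u} R) (M' : Orb F₂ ⥤ ModuleCat.{u} R)

/-- The homology cross product
`H_p^{F₁}(G₁; M) ⊗ H_q^{F₂}(G₂; M') → H_n^{F₁ × F₂}(G₁ × G₂; res_{p₁} M ⊗ res_{p₂} M')`,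
`n = p + q`, computed by the resolutions `P` and `Q` and their total complex. -/
noncomputable def bredonCross (hT : IsTotalResolution P Q) (p q n : ℕ) (h : p + q = n) :
    ((modTensor R).obj (bredonHomology F₁ p M)).obj (bredonHomology F₂ q M') ⟶
      bredonHomology (F₁.prod F₂) n (extLeft F₁ F₂ M M') :=
  ((modTensor R).map (P.isoLeftDerivedObj (tensorOver M) p).hom).app _ ≫
    ((modTensor R).obj _).map (Q.isoLeftDerivedObj (tensorOver M') q).hom ≫
    homologyCross P.complex Q.complex M M' p q n h ≫
    ((totalResolution hT).isoLeftDerivedObj (tensorOver (extLeft F₁ F₂ M M')) n).inv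

variable (F₁ F₂) in
/-- The sum `∐_{k=0}^n H_k^{F₁}(G₁; M) ⊗ H_{n-k}^{F₂}(G₂; M')`. -/
noncomputable def kunnethTensor (n : ℕ) : ModuleCat.{u} R :=
  ∐ fun k : Fin (n + 1) =>
    ((modTensor R).obj (bredonHomology F₁ k M)).obj (bredonHomology F₂ (n - k) M')

variable (F₁ F₂) in
/-- The sum `∐_{k=0}^{n-1} Tor_1(H_k^{F₁}(G₁; M), H_{n-k-1}^{F₂}(G₂; M'))`. -/
noncomputable def kunnethTor (n : ℕ) : ModuleCat.{u} R :=
  ∐ fun k : Fin n => modTorOne R (bredonHomology F₁ k M) (bredonHomology F₂ (n - k - 1) M')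

/-- The map from the sum of the tensor products to the homology of the product, given by the
homology cross product on each summand. -/
noncomputable def kunnethCross (hT : IsTotalResolution P Q) (n : ℕ) :
    kunnethTensor F₁ F₂ M M' n ⟶ bredonHomology (F₁.prod F₂) n (extLeft F₁ F₂ M M') :=
  Sigma.desc fun k : Fin (n + 1) => bredonCross M M' hT k (n - k) n (by omega)

variable {M M'}

/-- The functoriality of `∐_{k=0}^n H_k^{F₁}(G₁; M) ⊗ H_{n-k}^{F₂}(G₂; M')` in `M` and `M'`. -/
noncomputable def kunnethTensorMap {N : Orb F₁ ⥤ ModuleCat.{u} R} {N' : Orb F₂ ⥤ ModuleCat.{u} R}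
    (f : M ⟶ N) (f' : M' ⟶ N') (n : ℕ) :
    kunnethTensor F₁ F₂ M M' n ⟶ kunnethTensor F₁ F₂ N N' n :=
  Limits.Sigma.map fun k : Fin (n + 1) =>
    ((modTensor R).map (bredonHomologyMap F₁ k f)).app _ ≫
      ((modTensor R).obj _).map (bredonHomologyMap F₂ (n - k) f')

end Product

/-! Write A = F_* ⊗ M and B = F'_* ⊗ M'. A morphism from an orbit into (G₁ × G₂)/(H₁ × H₂) is the
same as a pair of morphisms from its two projections into G₁/H₁ and G₂/H₂. Hence (res P ⊗ res Q) ⊗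
(res M ⊗ res M') is naturally isomorphic to (P ⊗ M) ⊗ (Q ⊗ M') (`crossEquiv`), so T_* ⊗ (res M ⊗ res
M') is the total complex of A ⊗ B (`crossTensorTotal`), and the exact sequence becomes the algebraic
Künneth theorem for A and B.

For that theorem let A be free. Over a principal ideal domain its cycles Z_p(A) and boundaries
Bd_p(A) are free, so A_{p+1} → Bd_p(A) splits. Applying the differential of A to the component
x_{p+1,q} of a total cycle x gives an element of Bd_p(A) ⊗ Z_q(B). Its image in Bd_p(A) ⊗ H_q(B)
depends only on the class of x and lies in the kernel of the map to Z_p(A) ⊗ H_q(B), which is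
Tor₁(H_p(A), H_q(B)). All families in these kernels occur (`exists_lTensor_cls_bdryPart_eq`), a
cycle with trivial invariants is homologous to a sum of products of cycles
(`exists_eq_fam_add_diff`), and such a sum bounds only if the products of the classes vanish
(`map_cls_eq_zero`). If B is free instead, the factors are exchanged and Tor₁ is computed from its
second variable. If both are free, retractions of chains onto cycles followed by the projections to
homology kill the boundaries of the total complex and give the left inverse
(`TensorTotal.exists_retraction`).

The same algebra, applied at each orbit to the values of F_* and F'_*, shows that T_* resolves the
trivial module: the homology there is ℤ in degree zero, so there is no Tor. Projectivity holds
because bases of P and Q multiply to a basis of res P ⊗ res Q (`FunctorBasis.ext`).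

For the failure of naturality both groups are infinite cyclic with the trivial family, n = 1, and a
resolution of length one turns coefficients N into the complex t - 1 : N → N. The sign module has no
first homology, so for the pair (sign, sign) the sum of tensor products vanishes in degree one. With
generators a_i, b_i in degree i and differential -2, the cycle a₁ × b₀ - a₀ × b₁ accounts for
Tor₁(ℤ/2, ℤ/2). The antidiagonal map from the sign module to ℤ² with swapped coordinates makes a₀ a
boundary and carries this class to the product of [(1, 1)] with [b₀], which is nonzero in H₁ ⊗ H₀ =
ℤ ⊗ ℤ/2. A natural left inverse would send that product both to itself and to zero. -/

section SubmoduleOfFree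
-- Submodules of free modules over a principal ideal domain
variable {R : Type*} [CommRing R] [IsDomain R] [IsPrincipalIdealRing R]

/-- The leading coefficients in position `i` of the elements of the image of `f` supported in
`Iic i`. -/
noncomputable def leadingIdeal {ι N : Type*} [LinearOrder ι] [AddCommGroup N] [Module R N]
    (f : N →ₗ[R] ι →₀ R) (i : ι) : Ideal R :=
  ((Finsupp.supported R R (Set.Iic i)).comap f).map (Finsupp.lapply i ∘ₗ f)

/-- Elimination along a well-ordering of `ι`. For each i choose `n i` whose leading coefficient
generates the ideal of leading coefficients in position i. The `n i` with nonzero generator form a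
basis: distinct leading positions give independence, and subtracting a multiple of `n i` lowers the
leading position, so well-foundedness gives spanning. -/
theorem Module.Free.of_injective_finsupp {ι N : Type*} [AddCommGroup N] [Module R N]
    (f : N →ₗ[R] ι →₀ R) (hf : Function.Injective f) : Module.Free R N := by
  classical
  let _ : LinearOrder ι := linearOrderOfSTO WellOrderingRel
  have wf : WellFounded ((· < ·) : ι → ι → Prop) :=
    (inferInstance : IsWellFounded ι WellOrderingRel).wf
  have hgen : ∀ i, ∃ x : N, (∀ j, f x j ≠ 0 → j ≤ i) ∧
      f x i = Submodule.IsPrincipal.generator (leadingIdeal f i) := by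
    intro i
    obtain ⟨x, h2, h3⟩ := Submodule.IsPrincipal.generator_mem (leadingIdeal f i)
    exact ⟨x, fun j hj => h2 (Finsupp.mem_support_iff.mpr hj), h3⟩
  choose n hns hni using hgen
  have hn0 : ∀ i j, i < j → f (n i) j = 0 := fun i j hij => by
    by_contra h
    exact absurd (hns i j h) (not_le.mpr hij)
  let J := {i // Submodule.IsPrincipal.generator (leadingIdeal f i) ≠ 0}
  let b : J → N := fun i => n i
  have hli : LinearIndependent R b := by
    rw [linearIndependent_iff]
    intro l hl
    by_contra hne
    have hsupp : l.support.Nonempty := Finsupp.support_nonempty_iff.mpr hne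
    -- In coordinate i, the largest index of the relation, all other terms vanish.
    let i := l.support.max' hsupp
    have hi : l i ≠ 0 := Finsupp.mem_support_iff.mp (l.support.max'_mem hsupp)
    have h := congrArg (fun x : N => f x i) hl
    rw [Finsupp.linearCombination_apply, Finsupp.sum] at h
    simp only [map_sum, map_smul, Finsupp.coe_finsetSum, Finset.sum_apply,
      Finsupp.smul_apply, smul_eq_mul, map_zero, Finsupp.coe_zero, Pi.zero_apply] at h
    rw [Finset.sum_eq_single i] at h
    · exact mul_ne_zero hi (by rw [hni]; exact i.2) h
    · intro j hj hji
      have : j < i := lt_of_le_of_ne (l.support.le_max' j hj) hji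
      rw [hn0 j i this, mul_zero]
    · intro h'
      exact absurd (l.support.max'_mem hsupp) h'
  have hspan : ∀ i : ι, ∀ x : N, (∀ j, f x j ≠ 0 → j ≤ i) →
      x ∈ Submodule.span R (Set.range b) := by
    intro i
    induction i using wf.induction with
    | _ i ih =>
      -- The support of x is finite, so support strictly below i means a largest index below i, to
      -- which the induction hypothesis applies.
      have key : ∀ x : N, (∀ j, f x j ≠ 0 → j < i) → x ∈ Submodule.span R (Set.range b) := by
        intro x hx
        by_cases h0 : f x = 0
        · rw [hf (h0.trans (map_zero f).symm)]
          exact Submodule.zero_mem _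
        · have hs : (f x).support.Nonempty := Finsupp.support_nonempty_iff.mpr h0
          exact ih ((f x).support.max' hs)
            (hx _ (Finsupp.mem_support_iff.mp (Finset.max'_mem _ hs))) x
            fun j hj => Finset.le_max' _ j (Finsupp.mem_support_iff.mpr hj)
      intro x hx
      have hmem : f x i ∈ leadingIdeal f i :=
        ⟨x, fun j hj => hx j (Finsupp.mem_support_iff.mp hj), rfl⟩
      obtain ⟨c, hc⟩ := (Submodule.IsPrincipal.mem_iff_eq_smul_generator _).mp hmem
      have hred : x - c • n i ∈ Submodule.span R (Set.range b) := by
        refine key _ fun j hj => ?_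
        rw [map_sub, map_smul, Finsupp.sub_apply, Finsupp.smul_apply] at hj
        rcases lt_trichotomy j i with h | rfl | h
        · exact h
        · exact absurd (by rw [hni, hc, sub_self]) hj
        · refine absurd ?_ hj
          rw [hn0 i j h, smul_zero, sub_zero]
          by_contra h'
          exact absurd (hx j h') (not_le.mpr h)
      -- When the generator is zero, `n i` is not in the basis, but its coefficient at i vanishes
      -- and `key` covers it.
      have hci : c • n i ∈ Submodule.span R (Set.range b) := by
        by_cases hg : Submodule.IsPrincipal.generator (leadingIdeal f i) = 0
        · refine Submodule.smul_mem _ c (key _ fun j hj => ?_)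
          refine lt_of_le_of_ne (hns i j hj) ?_
          rintro rfl
          exact hj ((hni j).trans hg)
        · exact Submodule.smul_mem _ c (Submodule.subset_span ⟨⟨i, hg⟩, rfl⟩)
      have := Submodule.add_mem _ hred hci
      rwa [sub_add_cancel] at this
  refine Module.Free.of_basis (Module.Basis.mk hli ?_)
  rintro x -
  by_cases h0 : f x = 0
  · rw [hf (h0.trans (map_zero f).symm)]
    exact Submodule.zero_mem _
  · have hs : (f x).support.Nonempty := Finsupp.support_nonempty_iff.mpr h0
    exact hspan ((f x).support.max' hs) x fun j hj =>
      Finset.le_max' _ j (Finsupp.mem_support_iff.mpr hj)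

/-- A module over a principal ideal domain that embeds into a projective module is free. -/
theorem Module.Free.of_injective_of_projective {M N : Type*} [AddCommGroup M] [Module R M]
    [AddCommGroup N] [Module R N] [Module.Projective R M] (f : N →ₗ[R] M)
    (hf : Function.Injective f) : Module.Free R N := by
  obtain ⟨s, hs⟩ := Module.projective_def.mp (inferInstance : Module.Projective R M)
  exact Module.Free.of_injective_finsupp (s ∘ₗ f) (hs.injective.comp hf)

end SubmoduleOfFree

section Algebra
variable {R : Type*} [CommRing R]

/-- A linear map with values in the range of an injective linear map lifts along it. -/
theorem LinearMap.exists_lift_of_range_le {X Y W : Type*} [AddCommGroup X] [Module R X]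
    [AddCommGroup Y] [Module R Y] [AddCommGroup W] [Module R W] (f : X →ₗ[R] Y) (g : W →ₗ[R] Y)
    (hg : Function.Injective g) (h : ∀ x, ∃ w, g w = f x) : ∃ k : X →ₗ[R] W, ∀ x, g (k x) = f x := by
  refine ⟨(LinearEquiv.ofInjective g hg).symm.toLinearMap ∘ₗ
    f.codRestrict (LinearMap.range g) h, fun x => ?_⟩
  have := LinearEquiv.apply_symm_apply (LinearEquiv.ofInjective g hg)
    (f.codRestrict (LinearMap.range g) h x)
  exact congrArg Subtype.val this

end Algebra

/-! ### Maps of tensor products acting on one factor -/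

section TensorLemmas
variable {R : Type*} [CommRing R] {M M' M'' N N' N'' : Type*}
  [AddCommGroup M] [Module R M] [AddCommGroup M'] [Module R M'] [AddCommGroup M''] [Module R M'']
  [AddCommGroup N] [Module R N] [AddCommGroup N'] [Module R N'] [AddCommGroup N''] [Module R N'']

theorem rTensor_lTensor_comm (f : M →ₗ[R] M') (g : N →ₗ[R] N') (t : M ⊗[R] N) :
    f.rTensor N' (g.lTensor M t) = g.lTensor M' (f.rTensor N t) := by
  rw [← LinearMap.comp_apply, ← LinearMap.comp_apply, LinearMap.rTensor_comp_lTensor,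
    LinearMap.lTensor_comp_rTensor]

theorem map_eq_rTensor_lTensor (f : M →ₗ[R] M') (g : N →ₗ[R] N') (t : M ⊗[R] N) :
    TensorProduct.map f g t = f.rTensor N' (g.lTensor M t) := by
  rw [← LinearMap.comp_apply, LinearMap.rTensor_comp_lTensor]

theorem rTensor_rTensor {f : M →ₗ[R] M'} {g : M' →ₗ[R] M''} {h : M →ₗ[R] M''}
    (e : ∀ x, g (f x) = h x) (t : M ⊗[R] N) : g.rTensor N (f.rTensor N t) = h.rTensor N t := by
  rw [← LinearMap.rTensor_comp_apply, show g ∘ₗ f = h from LinearMap.ext e]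

theorem lTensor_lTensor {f : N →ₗ[R] N'} {g : N' →ₗ[R] N''} {h : N →ₗ[R] N''}
    (e : ∀ x, g (f x) = h x) (t : M ⊗[R] N) : g.lTensor M (f.lTensor M t) = h.lTensor M t := by
  rw [← LinearMap.lTensor_comp_apply, show g ∘ₗ f = h from LinearMap.ext e]

theorem rTensor_rTensor_eq_zero {f : M →ₗ[R] M'} {g : M' →ₗ[R] M''}
    (e : ∀ x, g (f x) = 0) (t : M ⊗[R] N) : g.rTensor N (f.rTensor N t) = 0 := by
  rw [rTensor_rTensor (h := 0) e, LinearMap.rTensor_zero, LinearMap.zero_apply]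

theorem lTensor_lTensor_eq_zero {f : N →ₗ[R] N'} {g : N' →ₗ[R] N''}
    (e : ∀ x, g (f x) = 0) (t : M ⊗[R] N) : g.lTensor M (f.lTensor M t) = 0 := by
  rw [lTensor_lTensor (h := 0) e, LinearMap.lTensor_zero, LinearMap.zero_apply]

theorem rTensor_rTensor_eq_self {f : M →ₗ[R] M'} {g : M' →ₗ[R] M}
    (e : ∀ x, g (f x) = x) (t : M ⊗[R] N) : g.rTensor N (f.rTensor N t) = t := by
  rw [rTensor_rTensor (h := LinearMap.id) e, LinearMap.rTensor_id, LinearMap.id_apply]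

theorem comm_rTensor (f : M →ₗ[R] M') (t : M ⊗[R] N) :
    TensorProduct.comm R M' N (f.rTensor N t) = f.lTensor N (TensorProduct.comm R M N t) := by
  change ((TensorProduct.comm R M' N).toLinearMap ∘ₗ f.rTensor N) t =
    (f.lTensor N ∘ₗ (TensorProduct.comm R M N).toLinearMap) t
  congr 1
  exact TensorProduct.ext' fun x y => rfl

theorem comm_lTensor (f : N →ₗ[R] N') (t : M ⊗[R] N) :
    TensorProduct.comm R M N' (f.lTensor M t) = f.rTensor M (TensorProduct.comm R M N t) := by
  change ((TensorProduct.comm R M N').toLinearMap ∘ₗ f.lTensor M) t =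
    (f.rTensor M ∘ₗ (TensorProduct.comm R M N).toLinearMap) t
  congr 1
  exact TensorProduct.ext' fun x y => rfl

end TensorLemmas

/-! ### Cycles, boundaries and homology as linear maps -/

namespace ChainComplex
variable {R : Type} [CommRing R] (A : ChainComplex (ModuleCat.{u} R) ℕ)

/-- The inclusion of the cycles, as a linear map. -/
noncomputable def cycIncl (p : ℕ) : A.cycles p →ₗ[R] A.X p := (A.iCycles p).hom

/-- The differential with values in the cycles, as a linear map. -/
noncomputable def bdryMap (p : ℕ) : A.X (p + 1) →ₗ[R] A.cycles p := (A.toCycles (p + 1) p).hom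

/-- The projection from cycles to homology, as a linear map. -/
noncomputable def cls (p : ℕ) : A.cycles p →ₗ[R] A.homology p := (A.homologyπ p).hom

/-- The differential, as a linear map. -/
noncomputable def diff (p : ℕ) : A.X (p + 1) →ₗ[R] A.X p := (A.d (p + 1) p).hom

/-- The boundaries, as a submodule of the cycles. -/
noncomputable abbrev bdry (p : ℕ) : Submodule R (A.cycles p) := LinearMap.range (A.bdryMap p)

/-- The differential with values in the boundaries. -/
noncomputable def bdryProj (p : ℕ) : A.X (p + 1) →ₗ[R] A.bdry p := (A.bdryMap p).rangeRestrict

variable {A}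

theorem cycIncl_injective (p : ℕ) : Function.Injective (A.cycIncl p) :=
  (ModuleCat.mono_iff_injective (A.iCycles p)).mp inferInstance

theorem cls_surjective (p : ℕ) : Function.Surjective (A.cls p) := homologyπ_surjective A p

theorem cycIncl_bdryMap (p : ℕ) (x : A.X (p + 1)) : A.cycIncl p (A.bdryMap p x) = A.diff p x :=
  congrArg (fun k => k.hom x) (A.toCycles_i (p + 1) p)

theorem diff_cycIncl (p : ℕ) (x : A.cycles (p + 1)) : A.diff p (A.cycIncl (p + 1) x) = 0 :=
  congrArg (fun k => k.hom x) (A.iCycles_d (p + 1) p)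

theorem diff_diff (p : ℕ) (x : A.X (p + 2)) : A.diff p (A.diff (p + 1) x) = 0 :=
  congrArg (fun k => k.hom x) (A.d_comp_d (p + 2) (p + 1) p)

/-- The hypothesis ranges over the p' with p = p' + 1, so it is empty in degree zero, where every
chain is a cycle. This lets later arguments treat all degrees at once. -/
theorem exists_cycIncl_eq {p : ℕ} (x : A.X p) (hx : ∀ p', (h : p = p' + 1) → A.diff p' (h ▸ x) = 0) :
    ∃ z, A.cycIncl p z = x := by
  rcases p with _ | p
  · have : IsIso (A.iCycles 0) := A.isIso_iCycles 0 0 (by simp) (A.shape _ _ (by simp))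
    exact ((ModuleCat.epi_iff_surjective (A.iCycles 0)).mp inferInstance) x
  · have h := (ShortComplex.mk _ _ (A.iCycles_d (p + 1) p)).exact_of_f_is_kernel
      (A.cyclesIsKernel (p + 1) p (by simp))
    exact (ShortComplex.moduleCat_exact_iff _).mp h x (hx p rfl)

theorem exact_cycIncl_diff (p : ℕ) : Function.Exact (A.cycIncl (p + 1)) (A.diff p) := by
  intro x
  refine ⟨fun h => exists_cycIncl_eq x fun p' e => ?_, ?_⟩
  · obtain rfl : p = p' := by omega
    exact h
  · rintro ⟨z, rfl⟩
    exact diff_cycIncl p z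

theorem cycIncl_zero_surjective : Function.Surjective (A.cycIncl 0) := fun x =>
  exists_cycIncl_eq x fun p' e => by omega

theorem exact_bdryMap_cls (p : ℕ) : Function.Exact (A.bdryMap p) (A.cls p) := by
  intro x
  constructor
  · intro h
    obtain ⟨z, hz⟩ := exists_of_homologyπ_eq_zero A p x h
    exact ⟨z, cycIncl_injective p ((cycIncl_bdryMap p z).trans hz)⟩
  · rintro ⟨z, rfl⟩
    exact congrArg (fun k => k.hom z) (A.toCycles_comp_homologyπ (p + 1) p)

theorem cls_bdryMap (p : ℕ) (x : A.X (p + 1)) : A.cls p (A.bdryMap p x) = 0 :=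
  (exact_bdryMap_cls p).apply_apply_eq_zero x

theorem exact_bdry_cls (p : ℕ) : Function.Exact (A.bdry p).subtype (A.cls p) := by
  intro x
  rw [exact_bdryMap_cls p x]
  simp

theorem bdryProj_surjective (p : ℕ) : Function.Surjective (A.bdryProj p) :=
  LinearMap.surjective_rangeRestrict _

theorem coe_bdryProj (p : ℕ) (x : A.X (p + 1)) :
    (A.bdry p).subtype (A.bdryProj p x) = A.bdryMap p x := rfl

theorem cls_bdry (p : ℕ) (x : A.bdry p) : A.cls p ((A.bdry p).subtype x) = 0 :=
  (exact_bdry_cls p).apply_apply_eq_zero x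

theorem cycIncl_coe_bdryProj (p : ℕ) (x : A.X (p + 1)) :
    (A.cycIncl p ∘ₗ (A.bdry p).subtype) (A.bdryProj p x) = A.diff p x := cycIncl_bdryMap p x

theorem bdryProj_eq_zero_iff (p : ℕ) (x : A.X (p + 1)) : A.bdryProj p x = 0 ↔ A.diff p x = 0 := by
  rw [← cycIncl_bdryMap, ← coe_bdryProj, map_eq_zero_iff _ (cycIncl_injective p),
    map_eq_zero_iff _ (Submodule.subtype_injective _)]

theorem bdryProj_cycIncl (p : ℕ) (x : A.cycles (p + 1)) :
    A.bdryProj p (A.cycIncl (p + 1) x) = 0 :=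
  (bdryProj_eq_zero_iff p _).mpr (diff_cycIncl p x)

theorem bdryProj_diff (p : ℕ) (x : A.X (p + 2)) : A.bdryProj p (A.diff (p + 1) x) = 0 :=
  (bdryProj_eq_zero_iff p _).mpr (diff_diff p x)

theorem exact_cycIncl_bdryProj (p : ℕ) :
    Function.Exact (A.cycIncl (p + 1)) (A.bdryProj p) := fun x =>
  (bdryProj_eq_zero_iff p x).trans (exact_cycIncl_diff p x)

variable (A) in
/-- A complex whose cycles and boundaries are projective. -/
structure IsSplit : Prop where
  projective_cycles : ∀ p, Module.Projective R (A.cycles p)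
  projective_bdry : ∀ p, Module.Projective R (A.bdry p)

theorem IsSplit.flat_cycles (h : A.IsSplit) (p : ℕ) : Module.Flat R (A.cycles p) :=
  have := h.projective_cycles p
  inferInstance

theorem IsSplit.exists_section (h : A.IsSplit) (p : ℕ) :
    ∃ s : A.bdry p →ₗ[R] A.X (p + 1), ∀ x, A.bdryProj p (s x) = x := by
  have := h.projective_bdry p
  obtain ⟨s, hs⟩ := Module.projective_lifting_property (A.bdryProj p) LinearMap.id
    (bdryProj_surjective p)
  exact ⟨s, LinearMap.congr_fun hs⟩

/-- A section s of the map onto boundaries makes x - s(∂x) a cycle, equal to x when x is one. In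
degree zero the inclusion of the cycles is an isomorphism. -/
theorem IsSplit.exists_retraction (h : A.IsSplit) (p : ℕ) :
    ∃ r : A.X p →ₗ[R] A.cycles p, ∀ x, r (A.cycIncl p x) = x := by
  rcases p with _ | p
  · let e := LinearEquiv.ofBijective (A.cycIncl 0) ⟨cycIncl_injective 0, cycIncl_zero_surjective⟩
    exact ⟨e.symm.toLinearMap, fun x => e.symm_apply_apply x⟩
  · obtain ⟨s, hs⟩ := h.exists_section p
    obtain ⟨r, hr⟩ := LinearMap.exists_lift_of_range_le (LinearMap.id - s ∘ₗ A.bdryProj p)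
      (A.cycIncl (p + 1)) (cycIncl_injective _) fun x => by
        refine (exact_cycIncl_bdryProj p _).mp ?_
        simp [hs]
    refine ⟨r, fun x => cycIncl_injective _ ?_⟩
    rw [hr]
    simp [bdryProj_cycIncl]

/-- Cycles and boundaries embed into a projective module, hence are free over a principal ideal
domain. This is the only way freeness of the complexes enters. -/
theorem isSplit_of_projective [IsDomain R] [IsPrincipalIdealRing R]
    (h : ∀ p, Module.Projective R (A.X p)) : A.IsSplit where
  projective_cycles p := by
    have := h p
    have := Module.Free.of_injective_of_projective _ (cycIncl_injective (A := A) p)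
    infer_instance
  projective_bdry p := by
    have := h p
    have := Module.Free.of_injective_of_projective
      (A.cycIncl p ∘ₗ (A.bdry p).subtype)
      ((cycIncl_injective (A := A) p).comp (Submodule.subtype_injective _))
    infer_instance

theorem exists_lTensor_cycIncl_eq_zero {F : Type*} [AddCommGroup F] [Module R F]
    (B : ChainComplex (ModuleCat.{u} R) ℕ) (t : F ⊗[R] B.X 0) :
    ∃ z, (B.cycIncl 0).lTensor F z = t :=
  LinearMap.lTensor_surjective F cycIncl_zero_surjective t

section Flat
variable {F : Type*} [AddCommGroup F] [Module R F] [Module.Flat R F] (B : ChainComplex (ModuleCat.{u} R) ℕ)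

theorem lTensor_cycIncl_injective (q : ℕ) : Function.Injective ((B.cycIncl q).lTensor F) :=
  Module.Flat.lTensor_preserves_injective_linearMap _ (cycIncl_injective q)

/-- A flat factor commutes with kernels, so chains killed by the differential of B come from cycles
of B. The factor will be the cycles or the boundaries of A. -/
theorem exists_lTensor_cycIncl_eq_succ (q : ℕ) (t : F ⊗[R] B.X (q + 1))
    (ht : (B.diff q).lTensor F t = 0) : ∃ z, (B.cycIncl (q + 1)).lTensor F z = t :=
  (Module.Flat.lTensor_exact F (exact_cycIncl_diff q) t).mp ht

end Flat

end ChainComplex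

/-! ### Total complexes of tensor products -/

section

open ChainComplex

variable {R : Type} [CommRing R] {A B T : ChainComplex (ModuleCat.{u} R) ℕ}

variable (A B T) in
/-- An identification of `T` with the total complex of `A_p ⊗ B_q`, up to signs in the
differential. -/
structure TensorTotal where
  inj (n p q : ℕ) : A.X p ⊗[R] B.X q →ₗ[R] T.X n
  proj (n p q : ℕ) : T.X n →ₗ[R] A.X p ⊗[R] B.X q
  proj_inj : ∀ n p q, p + q = n → ∀ t, proj n p q (inj n p q t) = t
  proj_inj_of_ne : ∀ n p q p' q', (p', q') ≠ (p, q) → ∀ t, proj n p q (inj n p' q' t) = 0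
  ext : ∀ n (x : T.X n), (∀ p q, p + q = n → proj n p q x = 0) → x = 0
  ε₁ : ℕ → ℕ → Rˣ
  ε₂ : ℕ → ℕ → Rˣ
  proj_diff : ∀ n p q, p + q = n → ∀ x : T.X (n + 1), proj n p q (T.diff n x) =
    ε₁ p q • (A.diff p).rTensor (B.X q) (proj (n + 1) (p + 1) q x) +
    ε₂ p q • (B.diff q).lTensor (A.X p) (proj (n + 1) p (q + 1) x)

namespace TensorTotal

variable (D : TensorTotal A B T)

/-- The symmetry of the notion of a total complex. -/
def swap : TensorTotal B A T where
  inj n p q := D.inj n q p ∘ₗ (TensorProduct.comm R (B.X p) (A.X q)).toLinearMap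
  proj n p q := (TensorProduct.comm R (A.X q) (B.X p)).toLinearMap ∘ₗ D.proj n q p
  proj_inj n p q h t := by
    simp [D.proj_inj n q p (by omega)]
  proj_inj_of_ne n p q p' q' h t := by
    simp [D.proj_inj_of_ne n q p q' p' (by simp at h ⊢; tauto)]
  ext n x h := D.ext n x fun p q hpq => by
    simpa using h q p (by omega)
  ε₁ p q := D.ε₂ q p
  ε₂ p q := D.ε₁ q p
  proj_diff n p q h x := by
    simp only [LinearMap.comp_apply, LinearEquiv.coe_coe, D.proj_diff n q p (by omega), map_add,
      Units.smul_def, map_smul, comm_rTensor, comm_lTensor]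
    exact add_comm _ _

/-- The element of the total complex with given components. -/
noncomputable def fam (n : ℕ) (t : ∀ p q, A.X p ⊗[R] B.X q) : T.X n :=
  ∑ x ∈ Finset.HasAntidiagonal.antidiagonal n, D.inj n x.1 x.2 (t x.1 x.2)

theorem proj_fam (n p q : ℕ) (h : p + q = n) (t : ∀ p q, A.X p ⊗[R] B.X q) :
    D.proj n p q (D.fam n t) = t p q := by
  rw [fam, map_sum, Finset.sum_eq_single (p, q)]
  · exact D.proj_inj n p q h _
  · intro x _ hx
    exact D.proj_inj_of_ne n p q x.1 x.2 hx _
  · intro h'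
    exact absurd (Finset.HasAntidiagonal.mem_antidiagonal.mpr h) h'

theorem ext' {n : ℕ} {x y : T.X n} (h : ∀ p q, p + q = n → D.proj n p q x = D.proj n p q y) :
    x = y :=
  sub_eq_zero.mp (D.ext n _ fun p q hpq => by rw [map_sub, h p q hpq, sub_self])

theorem proj_cycle {n : ℕ} (x : T.cycles n) (p q : ℕ) (h : p + q + 1 = n) :
    D.ε₁ p q • (A.diff p).rTensor (B.X q) (D.proj n (p + 1) q (T.cycIncl n x)) +
    D.ε₂ p q • (B.diff q).lTensor (A.X p) (D.proj n p (q + 1) (T.cycIncl n x)) = 0 := by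
  subst h
  rw [← D.proj_diff (p + q) p q rfl, diff_cycIncl, map_zero]

/-- Multiplying a component in a tensor product by a unit. -/
theorem eq_zero_of_units_smul {V : Type*} [AddCommGroup V] [Module R V] {r : Rˣ} {x : V}
    (h : r • x = 0) : x = 0 := by
  rw [← inv_smul_smul r x, h, smul_zero]

/-- A sum of products of cycles whose homology classes have zero product is a boundary. -/
theorem exists_diff_eq_fam (n : ℕ) (z : ∀ p q, A.cycles p ⊗[R] B.cycles q)
    (hz : ∀ p q, p + q = n → TensorProduct.map (A.cls p) (B.cls q) (z p q) = 0) :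
    ∃ t, T.diff n t =
      D.fam n fun p q => TensorProduct.map (A.cycIncl p) (B.cycIncl q) (z p q) := by
  have key : ∀ p q, ∃ (x : A.X (p + 1) ⊗[R] B.cycles q) (y : A.cycles p ⊗[R] B.X (q + 1)),
      p + q = n → z p q = (A.bdryMap p).rTensor _ x + (B.bdryMap q).lTensor _ y := by
    intro p q
    by_cases h : p + q = n
    -- The kernel of a tensor product of two surjections is generated by the kernels of the factors,
    -- so `z p q` is a boundary part in the first factor plus a boundary part in the second.
    · have h' : z p q ∈ LinearMap.ker (TensorProduct.map (A.cls p) (B.cls q)) := hz p q h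
      rw [TensorProduct.map_ker (exact_bdryMap_cls p) (cls_surjective p) (exact_bdryMap_cls q)
        (cls_surjective q)] at h'
      obtain ⟨_, ⟨y, rfl⟩, _, ⟨x, rfl⟩, e⟩ := Submodule.mem_sup.mp h'
      exact ⟨x, y, fun _ => by rw [← e, add_comm]⟩
    · exact ⟨0, 0, fun h' => absurd h' h⟩
  choose x y hxy using key
  -- The lifts `x p q` and `y p q` are placed in bidegrees (p + 1, q) and (p, q + 1), with the sign
  -- of the differential divided out. The cycle factor ensures that the other differential
  -- contributes nothing.
  let X : ∀ p q, A.X p ⊗[R] B.cycles q := fun p q =>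
    match p with
    | 0 => 0
    | p + 1 => (D.ε₁ p q)⁻¹ • x p q
  let Y : ∀ p q, A.cycles p ⊗[R] B.X q := fun p q =>
    match q with
    | 0 => 0
    | q + 1 => (D.ε₂ p q)⁻¹ • y p q
  refine ⟨D.fam (n + 1) fun p q =>
    (B.cycIncl q).lTensor _ (X p q) + (A.cycIncl p).rTensor _ (Y p q), D.ext' fun p q h => ?_⟩
  rw [D.proj_diff n p q h, D.proj_fam _ _ _ h, D.proj_fam _ _ _ (by omega),
    D.proj_fam _ _ _ (by omega), hxy p q h, map_add, map_add, map_add, rTensor_lTensor_comm,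
    rTensor_rTensor_eq_zero (diff_cycIncl p), lTensor_lTensor_eq_zero (diff_cycIncl q), add_zero, zero_add,
    map_eq_rTensor_lTensor, map_eq_rTensor_lTensor,
    lTensor_lTensor (cycIncl_bdryMap q), rTensor_lTensor_comm (A.cycIncl p) (B.cycIncl q),
    rTensor_rTensor (cycIncl_bdryMap p), rTensor_lTensor_comm (A.cycIncl p) (B.diff q)]
  simp only [X, Y, Units.smul_def, map_smul]
  simp only [← Units.smul_def, smul_inv_smul]

/-- If a sum of products of cycles is a boundary, then the products of the homology classes are
zero. -/
theorem map_cls_eq_zero (hA : A.IsSplit) (n : ℕ) (z : ∀ p q, A.cycles p ⊗[R] B.cycles q) (t : T.X (n + 1))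
    (ht : T.diff n t =
      D.fam n fun p q => TensorProduct.map (A.cycIncl p) (B.cycIncl q) (z p q))
    (p q : ℕ) (h : p + q = n) : TensorProduct.map (A.cls p) (B.cls q) (z p q) = 0 := by
  have hF := hA.flat_cycles p
  have := hA.projective_bdry p
  obtain ⟨r, hr⟩ := hA.exists_retraction p
  have e : ∀ p q, p + q = n → TensorProduct.map (A.cycIncl p) (B.cycIncl q) (z p q) =
      D.ε₁ p q • (A.diff p).rTensor (B.X q) (D.proj (n + 1) (p + 1) q t) +
      D.ε₂ p q • (B.diff q).lTensor (A.X p) (D.proj (n + 1) p (q + 1) t) := fun p q h => by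
    rw [← D.proj_diff n p q h, ht, D.proj_fam n p q h]
  -- The differential of A carries the component of t into boundaries of A tensor cycles of B. For
  -- positive q this follows from the equation one bidegree over, where projecting to the boundaries
  -- of A kills both the product of cycles and the first differential; flatness then replaces the
  -- kernel of the second differential by cycles.
  obtain ⟨v, hv⟩ : ∃ v : A.bdry p ⊗[R] B.cycles q, (B.cycIncl q).lTensor _ v =
      (A.bdryProj p).rTensor _ (D.proj (n + 1) (p + 1) q t) := by
    rcases q with _ | q
    · exact exists_lTensor_cycIncl_eq_zero B _
    · refine exists_lTensor_cycIncl_eq_succ B q _ ?_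
      have e' := congrArg ((A.bdryProj p).rTensor (B.X q)) (e (p + 1) q (by omega))
      rw [map_eq_rTensor_lTensor, rTensor_rTensor_eq_zero (bdryProj_cycIncl p), map_add,
        Units.smul_def, Units.smul_def, map_smul, map_smul,
        rTensor_rTensor_eq_zero (bdryProj_diff p), smul_zero, zero_add, ← Units.smul_def] at e'
      rw [← rTensor_lTensor_comm]
      exact eq_zero_of_units_smul e'.symm
  -- After retracting the first factor onto the cycles of A, both sides come from cycles tensor
  -- cycles, which embeds by flatness. So `z p q` is a sum of one term with a boundary of A and one
  -- with a boundary of B.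
  have e2 := congrArg (r.rTensor (B.X q)) (e p q h)
  rw [map_eq_rTensor_lTensor, rTensor_rTensor_eq_self hr, map_add,
    Units.smul_def, Units.smul_def, map_smul, map_smul, rTensor_lTensor_comm r,
    ← rTensor_rTensor (cycIncl_coe_bdryProj p), ← hv, LinearMap.rTensor_comp_apply,
    rTensor_rTensor_eq_self hr, rTensor_lTensor_comm, ← lTensor_lTensor (cycIncl_bdryMap q)] at e2
  simp only [← map_smul, ← map_add] at e2
  rw [lTensor_cycIncl_injective B q e2, map_add, map_eq_rTensor_lTensor,
    ← rTensor_lTensor_comm (A.bdry p).subtype, rTensor_rTensor_eq_zero (cls_bdry p),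
    map_eq_rTensor_lTensor, lTensor_lTensor_eq_zero (cls_bdryMap q), map_zero, add_zero]

end TensorTotal

end

/-! ### The invariant detecting the cokernel of the cross product -/

section

open ChainComplex

variable {R : Type} [CommRing R] {A B T : ChainComplex (ModuleCat.{u} R) ℕ}

namespace TensorTotal

variable (D : TensorTotal A B T)

/-- Project the cycle equation in bidegree (p + 1, q) to the boundaries of A: the first differential
dies because d² = 0. So the image of the component under the differential of A has second factor in
the cycles of B. -/
theorem lTensor_diff_bdryProj_eq_zero {n : ℕ} (x : T.cycles n) (p q : ℕ) (h : p + 1 + (q + 1) = n) :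
    (B.diff q).lTensor _ ((A.bdryProj p).rTensor _
      (D.proj n (p + 1) (q + 1) (T.cycIncl n x))) = 0 := by
  have e := congrArg ((A.bdryProj p).rTensor (B.X q)) (D.proj_cycle x (p + 1) q (by omega))
  rw [map_add, Units.smul_def, Units.smul_def, map_smul, map_smul,
    rTensor_rTensor_eq_zero (bdryProj_diff p), smul_zero, zero_add, map_zero,
    ← Units.smul_def] at e
  rw [← rTensor_lTensor_comm]
  exact eq_zero_of_units_smul e

/-- The part in `bdry A p ⊗ cycles B q` of the image of a cycle under the differential of `A`. -/
theorem exists_bdryPart (hA : A.IsSplit) (n p q : ℕ) :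
    ∃ k : T.cycles n →ₗ[R] A.bdry p ⊗[R] B.cycles q, p + q + 1 = n → ∀ x,
      (B.cycIncl q).lTensor _ (k x) =
        (A.bdryProj p).rTensor _ (D.proj n (p + 1) q (T.cycIncl n x)) := by
  by_cases h : p + q + 1 = n
  · have := hA.projective_bdry p
    obtain ⟨k, hk⟩ := LinearMap.exists_lift_of_range_le
      ((A.bdryProj p).rTensor (B.X q) ∘ₗ D.proj n (p + 1) q ∘ₗ T.cycIncl n)
      ((B.cycIncl q).lTensor _) (lTensor_cycIncl_injective B q) fun x => by
        rcases q with _ | q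
        · exact exists_lTensor_cycIncl_eq_zero B _
        · exact exists_lTensor_cycIncl_eq_succ B q _
            (D.lTensor_diff_bdryProj_eq_zero x p q (by omega))
    exact ⟨k, fun _ => hk⟩
  · exact ⟨0, fun h' => absurd h' h⟩

/-- The part in `bdry A p ⊗ cycles B q` of the image of a cycle under the differential of `A`. -/
noncomputable def bdryPart (hA : A.IsSplit) (n p q : ℕ) :
    T.cycles n →ₗ[R] A.bdry p ⊗[R] B.cycles q := (D.exists_bdryPart hA n p q).choose

theorem lTensor_bdryPart (hA : A.IsSplit) (n p q : ℕ) (h : p + q + 1 = n) (x : T.cycles n) :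
    (B.cycIncl q).lTensor _ (D.bdryPart hA n p q x) =
      (A.bdryProj p).rTensor _ (D.proj n (p + 1) q (T.cycIncl n x)) :=
  (D.exists_bdryPart hA n p q).choose_spec h x

variable (hA : A.IsSplit)

/-- This lets the invariant descend to homology. For a total boundary, the differential of A sees
only the term coming from the differential of B, so the second factor consists of boundaries. -/
theorem lTensor_cls_bdryPart_bdryMap (n p q : ℕ) (h : p + q + 1 = n) (y : T.X (n + 1)) :
    (B.cls q).lTensor _ (D.bdryPart hA n p q (T.bdryMap n y)) = 0 := by
  have := hA.projective_bdry p
  have e := D.lTensor_bdryPart hA n p q h (T.bdryMap n y)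
  rw [cycIncl_bdryMap, D.proj_diff n (p + 1) q (by omega), map_add,
    Units.smul_def, Units.smul_def, map_smul, map_smul, rTensor_rTensor_eq_zero (bdryProj_diff p),
    smul_zero, zero_add, rTensor_lTensor_comm, ← lTensor_lTensor (cycIncl_bdryMap q),
    ← map_smul] at e
  rw [lTensor_cycIncl_injective B q e, map_smul, lTensor_lTensor_eq_zero (cls_bdryMap q),
    smul_zero]

/-- This puts the invariant into the kernel that computes Tor₁. Retracting the cycle equation onto
the cycles of A shows that, up to units, the image of `bdryPart` is minus the differential of B
applied to a retracted component, hence zero in the homology of B. -/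
theorem rTensor_subtype_cls_bdryPart (n p q : ℕ) (h : p + q + 1 = n) (x : T.cycles n) :
    (A.bdry p).subtype.rTensor _ ((B.cls q).lTensor _ (D.bdryPart hA n p q x)) = 0 := by
  have := hA.flat_cycles p
  obtain ⟨r, hr⟩ := hA.exists_retraction p
  have e := congrArg (r.rTensor (B.X q)) (D.proj_cycle x p q h)
  rw [map_add, map_zero, Units.smul_def, Units.smul_def, map_smul, map_smul,
    rTensor_lTensor_comm r, ← rTensor_rTensor (cycIncl_coe_bdryProj p),
    ← D.lTensor_bdryPart hA n p q h, LinearMap.rTensor_comp_apply,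
    rTensor_rTensor_eq_self hr, rTensor_lTensor_comm, ← lTensor_lTensor (cycIncl_bdryMap q),
    ← map_smul ((B.cycIncl q).lTensor (A.cycles p)),
    ← map_smul ((B.cycIncl q).lTensor (A.cycles p)), ← map_add] at e
  have e2 := congrArg ((B.cls q).lTensor _)
    ((map_eq_zero_iff _ (lTensor_cycIncl_injective B q)).mp e)
  rw [map_add, map_smul, map_smul, lTensor_lTensor_eq_zero (cls_bdryMap q), smul_zero, add_zero,
    map_zero, ← Units.smul_def, ← rTensor_lTensor_comm] at e2
  exact eq_zero_of_units_smul e2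

/-- A cycle all of whose components are annihilated by the differential of `A` is a sum of
products of cycles. -/
theorem exists_eq_fam_of_rTensor_eq_zero (hA : A.IsSplit) {n : ℕ} (x : T.cycles n)
    (hx : ∀ p q, p + q + 1 = n →
      (A.bdryProj p).rTensor _ (D.proj n (p + 1) q (T.cycIncl n x)) = 0) :
    ∃ z : ∀ p q, A.cycles p ⊗[R] B.cycles q, T.cycIncl n x =
      D.fam n fun p q => TensorProduct.map (A.cycIncl p) (B.cycIncl q) (z p q) := by
  suffices h : ∀ p q, ∃ z : A.cycles p ⊗[R] B.cycles q, p + q = n →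
      D.proj n p q (T.cycIncl n x) = TensorProduct.map (A.cycIncl p) (B.cycIncl q) z by
    choose z hz using h
    exact ⟨z, D.ext' fun p q h => by rw [hz p q h, D.proj_fam n p q h]⟩
  intro p q
  by_cases h : p + q = n
  swap
  · exact ⟨0, fun h' => absurd h' h⟩
  have := hA.flat_cycles p
  obtain ⟨r, hr⟩ := hA.exists_retraction p
  -- The first factor lies in the cycles of A by right exactness of the tensor product; no flatness
  -- of `B.X q` is needed.
  obtain ⟨v, hv⟩ : ∃ v, (A.cycIncl p).rTensor (B.X q) v = D.proj n p q (T.cycIncl n x) := by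
    rcases p with _ | p
    · exact LinearMap.rTensor_surjective _ cycIncl_zero_surjective _
    · exact (rTensor_exact _ (exact_cycIncl_bdryProj p) (bdryProj_surjective p) _).mp
        (hx p q (by omega))
  -- Since the first differential vanishes on the neighbouring component, the cycle equation says
  -- that the second differential kills this one, and flatness of the cycles of A applies.
  obtain ⟨z, hz⟩ : ∃ z, (B.cycIncl q).lTensor (A.cycles p) z = v := by
    rcases q with _ | q
    · exact exists_lTensor_cycIncl_eq_zero B _
    · refine exists_lTensor_cycIncl_eq_succ B q _ ?_
      have e := congrArg (r.rTensor (B.X q)) (D.proj_cycle x p q (by omega))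
      rw [← rTensor_rTensor (cycIncl_coe_bdryProj p), hx p q (by omega), map_zero, smul_zero,
        zero_add, ← hv, map_zero, Units.smul_def, map_smul, rTensor_lTensor_comm,
        rTensor_rTensor_eq_self hr, ← Units.smul_def] at e
      exact eq_zero_of_units_smul e
  exact ⟨z, fun _ => by rw [← hv, ← hz, map_eq_rTensor_lTensor]⟩

/-- A cycle with trivial image in `bdry A p ⊗ H_q(B)` for all `p` and `q` is homologous to a sum of
products of cycles. -/
theorem exists_eq_fam_add_diff {n : ℕ} (x : T.cycles n)
    (hx : ∀ p q, p + q + 1 = n → (B.cls q).lTensor _ (D.bdryPart hA n p q x) = 0) :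
    ∃ (z : ∀ p q, A.cycles p ⊗[R] B.cycles q) (t : T.X (n + 1)), T.cycIncl n x =
      D.fam n (fun p q => TensorProduct.map (A.cycIncl p) (B.cycIncl q) (z p q)) + T.diff n t := by
  -- A trivial class in the homology of B means that `bdryPart` lies in boundaries tensor
  -- boundaries, so it lifts to chains one degree up in both variables.
  have key : ∀ p q, ∃ y : A.X (p + 1) ⊗[R] B.X (q + 1), p + q + 1 = n →
      D.bdryPart hA n p q x = (B.bdryMap q).lTensor _ ((A.bdryProj p).rTensor _ y) := by
    intro p q
    by_cases h : p + q + 1 = n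
    · obtain ⟨y, hy⟩ := (lTensor_exact _ (exact_bdryMap_cls q) (cls_surjective q) _).mp (hx p q h)
      obtain ⟨y', rfl⟩ := LinearMap.rTensor_surjective _ (bdryProj_surjective p) y
      exact ⟨y', fun _ => hy.symm⟩
    · exact ⟨0, fun h' => absurd h' h⟩
  choose y hy using key
  -- The correcting chain has total degree n + 1. Only the second differential of its component in
  -- bidegree (p + 1, q + 1) survives the projection to the boundaries of A, which explains the
  -- unit.
  let Y : ∀ p q, A.X p ⊗[R] B.X q := fun p q =>
    match p, q with
    | 0, _ => 0
    | _ + 1, 0 => 0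
    | p + 1, q + 1 => (D.ε₂ (p + 1) q)⁻¹ • y p q
  obtain ⟨z, hz⟩ := D.exists_eq_fam_of_rTensor_eq_zero hA (x - T.bdryMap n (D.fam (n + 1) Y))
    fun p q h => by
      rw [map_sub, cycIncl_bdryMap, map_sub, map_sub, ← D.lTensor_bdryPart hA n p q h, hy p q h,
        D.proj_diff n (p + 1) q (by omega), D.proj_fam _ _ _ (by omega),
        D.proj_fam _ _ _ (by omega), map_add, Units.smul_def, Units.smul_def, map_smul, map_smul,
        rTensor_rTensor_eq_zero (bdryProj_diff p), smul_zero, zero_add,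
        lTensor_lTensor (cycIncl_bdryMap q), rTensor_lTensor_comm, ← map_smul, ← map_smul,
        ← Units.smul_def]
      simp only [Y, smul_inv_smul, sub_self]
  refine ⟨z, D.fam (n + 1) Y, ?_⟩
  rw [← hz, map_sub, cycIncl_bdryMap, sub_add_cancel]

/-- Every family of elements of the kernels of `bdry A p ⊗ H_q(B) → cycles A p ⊗ H_q(B)` comes from
a cycle. -/
theorem exists_lTensor_cls_bdryPart_eq (n : ℕ) (v : ∀ p q, A.bdry p ⊗[R] B.homology q)
    (hv : ∀ p q, p + q + 1 = n → (A.bdry p).subtype.rTensor _ (v p q) = 0) :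
    ∃ x, ∀ p q, p + q + 1 = n → (B.cls q).lTensor _ (D.bdryPart hA n p q x) = v p q := by
  -- Lift `v p q` to boundaries of A tensor cycles of B. Its image in cycles of A tensor homology of
  -- B vanishes, so after including boundaries into cycles it becomes a boundary in the second
  -- factor.
  have key : ∀ p q, ∃ (w : A.bdry p ⊗[R] B.cycles q) (y : A.cycles p ⊗[R] B.X (q + 1)),
      p + q + 1 = n → (B.cls q).lTensor _ w = v p q ∧
        (A.bdry p).subtype.rTensor _ w = (B.bdryMap q).lTensor _ y := by
    intro p q
    by_cases h : p + q + 1 = n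
    · obtain ⟨w, hw⟩ := LinearMap.lTensor_surjective _ (cls_surjective q) (v p q)
      obtain ⟨y, hy⟩ := (lTensor_exact (A.cycles p) (exact_bdryMap_cls q) (cls_surjective q)
        ((A.bdry p).subtype.rTensor _ w)).mp (by
          rw [← rTensor_lTensor_comm, hw, hv p q h])
      exact ⟨w, y, fun _ => ⟨hw, hy.symm⟩⟩
    · exact ⟨0, 0, fun h' => absurd h' h⟩
  choose w y hwy using key
  choose s hs using fun p => hA.exists_section p
  -- The section turns w into a chain whose differential in A is w again. The chain made from y
  -- cancels that differential through the differential of B, with units chosen so that the sum in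
  -- each bidegree vanishes.
  let X : ∀ p q, A.X p ⊗[R] B.cycles q := fun p q =>
    match p with
    | 0 => 0
    | p + 1 => (s p).rTensor _ (w p q)
  let Y : ∀ p q, A.cycles p ⊗[R] B.X q := fun p q =>
    match q with
    | 0 => 0
    | q + 1 => ((D.ε₂ p q)⁻¹ * D.ε₁ p q) • y p q
  let t : ∀ p q, A.X p ⊗[R] B.X q := fun p q =>
    (B.cycIncl q).lTensor _ (X p q) - (A.cycIncl p).rTensor _ (Y p q)
  have hs' : ∀ p x, A.diff p (s p x) = (A.cycIncl p ∘ₗ (A.bdry p).subtype) x := fun p x => by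
    rw [← cycIncl_coe_bdryProj, hs]
  obtain ⟨x, hx⟩ := exists_cycIncl_eq (A := T) (D.fam n t) (by
    rintro n' rfl
    refine D.ext n' _ fun p q h => ?_
    rw [D.proj_diff n' p q h, D.proj_fam _ _ _ (by omega), D.proj_fam _ _ _ (by omega)]
    simp only [t]
    rw [map_sub, map_sub, rTensor_lTensor_comm, rTensor_rTensor_eq_zero (diff_cycIncl p),
      lTensor_lTensor_eq_zero (diff_cycIncl q), sub_zero, zero_sub]
    simp only [X, Y]
    rw [rTensor_rTensor (hs' p), LinearMap.rTensor_comp_apply, (hwy p q (by omega)).2,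
      rTensor_lTensor_comm, lTensor_lTensor (cycIncl_bdryMap q)]
    rw [Units.smul_def (_ * _), map_smul, map_smul, ← Units.smul_def, smul_neg, smul_smul,
      mul_inv_cancel_left, add_neg_cancel])
  refine ⟨x, fun p q h => ?_⟩
  have := hA.projective_bdry p
  have e : D.bdryPart hA n p q x = w p q := by
    apply lTensor_cycIncl_injective B q
    rw [D.lTensor_bdryPart hA n p q h, hx, D.proj_fam _ _ _ (by omega)]
    simp only [t]
    rw [map_sub, rTensor_rTensor_eq_zero (bdryProj_cycIncl p), sub_zero, rTensor_lTensor_comm]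
    simp only [X]
    rw [rTensor_rTensor_eq_self (hs p)]
  rw [e, (hwy p q h).1]

/-- The retraction of the homology of the total complex onto products of homology classes, when
both complexes are split. -/
theorem exists_retraction (hA : A.IsSplit) (hB : B.IsSplit) (n : ℕ) :
    ∃ k : ∀ p q, T.homology n →ₗ[R] A.homology p ⊗[R] B.homology q,
      ∀ (x : T.cycles n) (z : ∀ p q, A.cycles p ⊗[R] B.cycles q),
        T.cycIncl n x =
          D.fam n (fun p q => TensorProduct.map (A.cycIncl p) (B.cycIncl q) (z p q)) →
        ∀ p q, p + q = n →
          k p q (T.cls n x) = TensorProduct.map (A.cls p) (B.cls q) (z p q) := by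
  choose r hr using fun p => hA.exists_retraction p
  choose r' hr' using fun p => hB.exists_retraction p
  -- Retraction followed by projection is a chain map from A to its homology with zero differential;
  -- likewise for B. Their tensor product therefore kills the boundaries of the total complex.
  have hd : ∀ p x, (A.cls p ∘ₗ r p) (A.diff p x) = 0 := fun p x => by
    rw [← cycIncl_bdryMap, LinearMap.comp_apply, hr, cls_bdryMap]
  have hd' : ∀ p x, (B.cls p ∘ₗ r' p) (B.diff p x) = 0 := fun p x => by
    rw [← cycIncl_bdryMap, LinearMap.comp_apply, hr', cls_bdryMap]
  have key : ∀ p q, ∃ k : T.homology n →ₗ[R] A.homology p ⊗[R] B.homology q,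
      p + q = n → ∀ x, k (T.cls n x) =
        TensorProduct.map (A.cls p ∘ₗ r p) (B.cls q ∘ₗ r' q) (D.proj n p q (T.cycIncl n x)) := by
    intro p q
    by_cases h : p + q = n
    · refine ⟨descSurj (T.cls n) (cls_surjective n)
        (TensorProduct.map (A.cls p ∘ₗ r p) (B.cls q ∘ₗ r' q) ∘ₗ D.proj n p q ∘ₗ T.cycIncl n) ?_,
        fun _ x => descSurj_apply _ _ _ _ x⟩
      intro x hx
      obtain ⟨y, rfl⟩ := (exact_bdryMap_cls n x).mp hx
      rw [LinearMap.comp_apply, LinearMap.comp_apply, cycIncl_bdryMap, D.proj_diff n p q h,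
        map_add, Units.smul_def, Units.smul_def, map_smul, map_smul, map_eq_rTensor_lTensor,
        map_eq_rTensor_lTensor, rTensor_lTensor_comm, rTensor_rTensor_eq_zero (hd p),
        lTensor_lTensor_eq_zero (hd' q)]
      simp only [map_zero, smul_zero, add_zero]
    · exact ⟨0, fun h' => absurd h' h⟩
  choose k hk using key
  refine ⟨k, fun x z e p q h => ?_⟩
  rw [hk p q h, e, D.proj_fam n p q h, ← LinearMap.comp_apply, ← TensorProduct.map_comp]
  congr 2
  · exact LinearMap.ext fun x => congrArg (A.cls p) (hr p x)
  · exact LinearMap.ext fun x => congrArg (B.cls q) (hr' q x)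

end TensorTotal

end

/-! ### Augmented complexes and resolutions of length one -/

section TwoTerm
open ZeroObject

/-- Turns exactness of the augmented complex into the quasi-isomorphism required of a projective
resolution. It serves both the resolutions of length one and the total complex. -/
theorem ChainComplex.quasiIso_toSingle₀ {C : Type*} [Category* C] [Abelian C]
    (K : ChainComplex C ℕ) {X : C} (f : K.X 0 ⟶ X) (w : K.d 1 0 ≫ f = 0)
    (h₀ : (ShortComplex.mk _ _ w).Exact) [Epi f] (h : ∀ n, K.ExactAt (n + 1)) :
    QuasiIso ((ChainComplex.toSingle₀Equiv K X).symm ⟨f, w⟩) where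
  quasiIsoAt n := by
    rcases n with _ | n
    · rw [ChainComplex.quasiIsoAt₀_iff, ShortComplex.quasiIso_iff_of_zeros']
      · refine (ShortComplex.exact_and_epi_g_iff_of_iso ?_).2 ⟨h₀, ‹Epi f›⟩
        exact ShortComplex.isoMk (Iso.refl _) (Iso.refl _) (Iso.refl _)
          (by simp; exact (Category.id_comp _).trans (Category.comp_id _).symm)
          (by simp; exact (Category.id_comp f).trans (Category.comp_id f).symm)
      · exact K.shape _ _ (by simp)
      all_goals rfl
    · rw [quasiIsoAt_iff_exactAt']
      · exact h n
      · exact ChainComplex.exactAt_succ_single_obj _ _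

variable {C : Type*} [Category* C] [Abelian C] {D Z H : C} (j : D ⟶ Z)

/-- The objects of the complex `0 → D → Z`. -/
noncomputable def twoTermX (D Z : C) : ℕ → C
  | 0 => Z
  | 1 => D
  | _ + 2 => 0

/-- The differentials of the complex `0 → D → Z`. -/
noncomputable def twoTermD : ∀ n, twoTermX D Z (n + 1) ⟶ twoTermX D Z n
  | 0 => j
  | _ + 1 => 0

/-- The complex `0 → D → Z`. -/
noncomputable def twoTerm : ChainComplex C ℕ :=
  ChainComplex.of (twoTermX D Z) (twoTermD j) fun n => by
    simp [twoTermD]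

theorem twoTerm_d_one_zero : (twoTerm j).d 1 0 = j :=
  ChainComplex.of_d (twoTermX D Z) (twoTermD j) 0

theorem twoTerm_d_succ (n : ℕ) : (twoTerm j).d (n + 2) (n + 1) = 0 :=
  ChainComplex.of_d (twoTermX D Z) (twoTermD j) (n + 1)

/-- A short exact sequence with projective first terms as a projective resolution. -/
noncomputable def twoTermResolution (π : Z ⟶ H) (w : j ≫ π = 0)
    (hS : (ShortComplex.mk j π w).ShortExact) [Projective D] [Projective Z] :
    ProjectiveResolution H where
  complex := twoTerm j
  projective n := by
    rcases n with _ | _ | n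
    · exact ‹Projective Z›
    · exact ‹Projective D›
    · exact (inferInstance : Projective (0 : C))
  π := (ChainComplex.toSingle₀Equiv _ _).symm ⟨π, by rw [twoTerm_d_one_zero]; exact w⟩
  quasiIso := by
    have : Epi (show (twoTerm j).X 0 ⟶ H from π) := hS.epi_g
    refine ChainComplex.quasiIso_toSingle₀ (twoTerm j) _ _ ?_ fun n => ?_
    -- The differential from degree one equals j only propositionally, so the claim is generalised
    -- over it before substituting.
    · have key : ∀ (d : D ⟶ Z) (_ : d = j) (w' : d ≫ π = 0), (ShortComplex.mk d π w').Exact := by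
        rintro _ rfl _
        exact hS.exact
      exact key _ (twoTerm_d_one_zero j) _
    · rw [HomologicalComplex.exactAt_iff' _ (n + 2) (n + 1) n (by simp) (by simp)]
      refine (ShortComplex.exact_iff_mono _ (twoTerm_d_succ j n)).mpr ?_
      rcases n with _ | n
      · change Mono ((twoTerm j).d 1 0)
        rw [twoTerm_d_one_zero]
        exact hS.mono_f
      · exact ⟨fun _ _ _ => (isZero_zero C).eq_of_tgt _ _⟩

end TwoTerm

/-! ### `Tor₁` from short presentations of either variable -/

section Tor
variable {R : Type} [CommRing R]

open ChainComplex in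
/-- The homology of a complex in a degree with trivial incoming differential. -/
theorem ChainComplex.nonempty_homology_equiv_ker (E : ChainComplex (ModuleCat.{u} R) ℕ) (p : ℕ)
    (h : ∀ x, E.diff (p + 1) x = 0) :
    Nonempty (E.homology (p + 1) ≃ₗ[R] LinearMap.ker (E.diff p)) := by
  have hc : Function.Injective (E.cls (p + 1)) := by
    rw [injective_iff_map_eq_zero]
    intro x hx
    obtain ⟨y, rfl⟩ := (exact_bdryMap_cls _ x).mp hx
    exact cycIncl_injective _ (by rw [cycIncl_bdryMap, h, map_zero])
  refine ⟨(LinearEquiv.ofBijective _ ⟨hc, cls_surjective _⟩).symm.trans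
    ((LinearEquiv.ofInjective _ (cycIncl_injective (p + 1))).trans (LinearEquiv.ofEq _ _ ?_))⟩
  exact (exact_cycIncl_diff p).linearMap_ker_eq.symm

/-- `Tor₁` computed from a short projective resolution of the first variable. -/
theorem nonempty_modTorOne_equiv_ker_rTensor {D Z : Type u} [AddCommGroup D] [Module R D]
    [AddCommGroup Z] [Module R Z] [Module.Projective R D] [Module.Projective R Z]
    {H : Type u} [AddCommGroup H] [Module R H] (N : Type u) [AddCommGroup N] [Module R N]
    (j : D →ₗ[R] Z) (π : Z →ₗ[R] H)
    (hj : Function.Injective j) (hjπ : Function.Exact j π) (hπ : Function.Surjective π) :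
    Nonempty (modTorOne R (ModuleCat.of R H) (ModuleCat.of R N) ≃ₗ[R]
      LinearMap.ker (j.rTensor N)) := by
  let J : ModuleCat.of R D ⟶ ModuleCat.of R Z := ModuleCat.ofHom j
  let Q : ModuleCat.of R Z ⟶ ModuleCat.of R H := ModuleCat.ofHom π
  have w : J ≫ Q = 0 := by
    ext x
    exact hjπ.apply_apply_eq_zero x
  have hS : (ShortComplex.mk J Q w).ShortExact :=
    { exact := (ShortComplex.moduleCat_exact_iff _).mpr fun x hx => (hjπ x).mp hx
      mono_f := (ModuleCat.mono_iff_injective _).mpr hj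
      epi_g := (ModuleCat.epi_iff_surjective _).mpr hπ }
  have : Small.{u} R := inferInstance
  have : Projective (ModuleCat.of R D) := ModuleCat.projective_of_categoryTheory_projective _
  have : Projective (ModuleCat.of R Z) := ModuleCat.projective_of_categoryTheory_projective _
  let P := twoTermResolution J Q w hS
  let F := (modTensor R).flip.obj (ModuleCat.of R N)
  let E := (F.mapHomologicalComplex (ComplexShape.down ℕ)).obj P.complex
  have h2 : ∀ x, ChainComplex.diff E 1 x = 0 := fun x => by
    have : E.d 2 1 = 0 := (congrArg F.map (twoTerm_d_succ J 0)).trans (F.map_zero _ _)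
    exact congrArg (fun k => k.hom x) this
  have h1 : ChainComplex.diff E 0 = j.rTensor N :=
    congrArg (fun k => (F.map k).hom) (twoTerm_d_one_zero J)
  obtain ⟨e⟩ := ChainComplex.nonempty_homology_equiv_ker E 0 h2
  exact ⟨((P.isoLeftDerivedObj F 1).toLinearEquiv.trans e).trans
    (LinearEquiv.ofEq _ _ (congrArg LinearMap.ker h1))⟩

/-- The two ways to compute `Tor₁` from flat presentations of the two variables agree. -/
theorem nonempty_ker_rTensor_equiv_ker_lTensor {D Z H D' Z' H' : Type*}
    [AddCommGroup D] [Module R D] [AddCommGroup Z] [Module R Z] [AddCommGroup H] [Module R H]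
    [AddCommGroup D'] [Module R D'] [AddCommGroup Z'] [Module R Z'] [AddCommGroup H'] [Module R H']
    [Module.Flat R Z] [Module.Flat R Z']
    (j : D →ₗ[R] Z) (π : Z →ₗ[R] H)
    (hj : Function.Injective j) (hjπ : Function.Exact j π) (hπ : Function.Surjective π)
    (j' : D' →ₗ[R] Z') (π' : Z' →ₗ[R] H')
    (hj' : Function.Injective j') (hjπ' : Function.Exact j' π') (hπ' : Function.Surjective π') :
    Nonempty (LinearMap.ker (j.rTensor H') ≃ₗ[R] LinearMap.ker (j'.lTensor H)) := by
  -- S is the fibre product of D ⊗ Z' and Z ⊗ D' over Z ⊗ Z'. Both kernels are quotients of S, and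
  -- by the same submodule.
  let S : Submodule R ((D ⊗[R] Z') × (Z ⊗[R] D')) :=
    LinearMap.eqLocus (j.rTensor Z' ∘ₗ LinearMap.fst R _ _) (j'.lTensor Z ∘ₗ LinearMap.snd R _ _)
  have hS : ∀ x : S, j.rTensor Z' x.1.1 = j'.lTensor Z x.1.2 := fun x => x.2
  have hi : Function.Injective (j.rTensor Z') :=
    Module.Flat.rTensor_preserves_injective_linearMap _ hj
  have hi' : Function.Injective (j'.lTensor Z) :=
    Module.Flat.lTensor_preserves_injective_linearMap _ hj'
  let f : S →ₗ[R] LinearMap.ker (j.rTensor H') :=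
    (π'.lTensor D ∘ₗ LinearMap.fst R _ _ ∘ₗ S.subtype).codRestrict _ fun x => by
      change j.rTensor H' (π'.lTensor D x.1.1) = 0
      rw [rTensor_lTensor_comm, hS, lTensor_lTensor_eq_zero hjπ'.apply_apply_eq_zero]
  let g : S →ₗ[R] LinearMap.ker (j'.lTensor H) :=
    (π.rTensor D' ∘ₗ LinearMap.snd R _ _ ∘ₗ S.subtype).codRestrict _ fun x => by
      change j'.lTensor H (π.rTensor D' x.1.2) = 0
      rw [← rTensor_lTensor_comm, ← hS, rTensor_rTensor_eq_zero hjπ.apply_apply_eq_zero]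
  have hf : Function.Surjective f := by
    rintro ⟨x, hx⟩
    obtain ⟨y, rfl⟩ := LinearMap.lTensor_surjective D hπ' x
    obtain ⟨z, hz⟩ := (lTensor_exact Z hjπ' hπ' (j.rTensor Z' y)).mp (by
      rw [← rTensor_lTensor_comm]; exact hx)
    exact ⟨⟨(y, z), hz.symm⟩, rfl⟩
  have hg : Function.Surjective g := by
    rintro ⟨x, hx⟩
    obtain ⟨y, rfl⟩ := LinearMap.rTensor_surjective D' hπ x
    obtain ⟨z, hz⟩ := (rTensor_exact Z' hjπ hπ (j'.lTensor Z y)).mp (by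
      rw [rTensor_lTensor_comm]; exact hx)
    exact ⟨⟨(z, y), hz⟩, rfl⟩
  -- Either condition says that the pair comes from D ⊗ D'; flatness of Z and Z' makes the maps into
  -- Z ⊗ Z' injective, so one coordinate determines the other.
  have hker : LinearMap.ker f = LinearMap.ker g := by
    ext x
    have hf0 : x ∈ LinearMap.ker f ↔ π'.lTensor D x.1.1 = 0 := by
      rw [LinearMap.mem_ker]
      exact Subtype.ext_iff
    have hg0 : x ∈ LinearMap.ker g ↔ π.rTensor D' x.1.2 = 0 := by
      rw [LinearMap.mem_ker]
      exact Subtype.ext_iff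
    rw [hf0, hg0]
    constructor
    · intro h
      obtain ⟨w, hw⟩ := (lTensor_exact D hjπ' hπ' _).mp h
      have : j.rTensor D' w = x.1.2 := hi' (by rw [← rTensor_lTensor_comm, hw, hS])
      rw [← this, rTensor_rTensor_eq_zero hjπ.apply_apply_eq_zero]
    · intro h
      obtain ⟨w, hw⟩ := (rTensor_exact D' hjπ hπ _).mp h
      have : j'.lTensor D w = x.1.1 := hi (by rw [rTensor_lTensor_comm, hw, hS])
      rw [← this, lTensor_lTensor_eq_zero hjπ'.apply_apply_eq_zero]
  exact ⟨(f.quotKerEquivOfSurjective hf).symm.trans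
    ((Submodule.quotEquivOfEq _ _ hker).trans (g.quotKerEquivOfSurjective hg))⟩

/-- `Tor₁` computed from a short projective resolution of the second variable. -/
theorem nonempty_modTorOne_equiv_ker_lTensor [IsDomain R] [IsPrincipalIdealRing R]
    {D Z : Type u} [AddCommGroup D] [Module R D]
    [AddCommGroup Z] [Module R Z] [Module.Flat R Z]
    {H : Type u} [AddCommGroup H] [Module R H] (N : Type u) [AddCommGroup N] [Module R N]
    (j : D →ₗ[R] Z) (π : Z →ₗ[R] H)
    (hj : Function.Injective j) (hjπ : Function.Exact j π) (hπ : Function.Surjective π) :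
    Nonempty (modTorOne R (ModuleCat.of R N) (ModuleCat.of R H) ≃ₗ[R]
      LinearMap.ker (j.lTensor N)) := by
  -- The first variable is presented by the free module on its elements. The kernel is free over a
  -- principal ideal domain, so this presentation computes `Tor₁`.
  let q : (N →₀ R) →ₗ[R] N := Finsupp.linearCombination R id
  have hq : Function.Surjective q := Finsupp.linearCombination_id_surjective R N
  have hi : Function.Injective (LinearMap.ker q).subtype := Subtype.val_injective
  have := Module.Free.of_injective_of_projective (N := LinearMap.ker q) (LinearMap.ker q).subtype hi
  obtain ⟨e⟩ := nonempty_modTorOne_equiv_ker_rTensor (D := LinearMap.ker q) H (LinearMap.ker q).subtype q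
    hi (LinearMap.exact_subtype_ker_map q) hq
  obtain ⟨e'⟩ := nonempty_ker_rTensor_equiv_ker_lTensor (D := LinearMap.ker q) (LinearMap.ker q).subtype q
    hi (LinearMap.exact_subtype_ker_map q) hq j π hj hjπ hπ
  exact ⟨e.trans e'⟩

end Tor

/-! ### The cokernel of the cross product as a family of `Tor₁` modules -/

section

open ChainComplex

variable {R : Type} [CommRing R] {A B T : ChainComplex (ModuleCat.{u} R) ℕ}

/-- The commutativity of the tensor product on kernels. -/
noncomputable def kerLTensorEquivKerRTensor {M M' : Type*} [AddCommGroup M] [Module R M]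
    [AddCommGroup M'] [Module R M'] (f : M →ₗ[R] M') (N : Type*) [AddCommGroup N] [Module R N] :
    LinearMap.ker (f.lTensor N) ≃ₗ[R] LinearMap.ker (f.rTensor N) :=
  (TensorProduct.comm R N M).ofSubmodules _ _ (by
    ext x
    have h : f.lTensor N (TensorProduct.comm R M N x) = 0 ↔ f.rTensor N x = 0 := by
      rw [← comm_rTensor, LinearEquiv.map_eq_zero_iff]
    exact (Submodule.mem_map_equiv _).trans h)

namespace TensorTotal

variable (D : TensorTotal A B T)

/-- The sum of products of cycles. -/
noncomputable def cycFam (n : ℕ) (z : ∀ p q, A.cycles p ⊗[R] B.cycles q) : T.X n :=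
  D.fam n fun p q => TensorProduct.map (A.cycIncl p) (B.cycIncl q) (z p q)

theorem swap_cycFam (n : ℕ) (z : ∀ p q, B.cycles p ⊗[R] A.cycles q) :
    D.swap.cycFam n z =
      D.cycFam n fun p q => TensorProduct.comm R (B.cycles q) (A.cycles p) (z q p) := by
  refine D.ext' fun p q h => ?_
  rw [cycFam, cycFam, D.proj_fam n p q h]
  have := D.swap.proj_fam n q p (by omega)
    (fun p q => TensorProduct.map (B.cycIncl p) (A.cycIncl q) (z p q))
  have h2 := congrArg (TensorProduct.comm R (B.X q) (A.X p)) this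
  have h3 : ∀ t, TensorProduct.comm R (B.X q) (A.X p) (TensorProduct.comm R (A.X p) (B.X q) t) = t :=
    fun t => (TensorProduct.comm R (A.X p) (B.X q)).symm_apply_apply t
  refine (h3 _).symm.trans (h2.trans ?_)
  rw [map_eq_rTensor_lTensor, comm_rTensor, comm_lTensor, map_eq_rTensor_lTensor,
    rTensor_lTensor_comm]

/-- The maps `ψ p q` identify the direct sum of the `W p q` for `p + q + 1 = n` with the cokernel
of the homology cross product. -/
structure IsCokernelFamily (n : ℕ) {W : ℕ → ℕ → ModuleCat.{u} R}
    (ψ : ∀ p q, T.homology n →ₗ[R] W p q) : Prop where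
  surjective : ∀ v : ∀ p q, W p q, ∃ y, ∀ p q, p + q + 1 = n → ψ p q y = v p q
  exists_eq_add : ∀ x : T.cycles n, (∀ p q, p + q + 1 = n → ψ p q (T.cls n x) = 0) →
    ∃ z t, T.cycIncl n x = D.cycFam n z + T.diff n t
  eq_zero : ∀ (x : T.cycles n) z, T.cycIncl n x = D.cycFam n z →
    ∀ p q, p + q + 1 = n → ψ p q (T.cls n x) = 0

variable {D}

theorem IsCokernelFamily.equiv {n : ℕ} {W W' : ℕ → ℕ → ModuleCat.{u} R}
    {ψ : ∀ p q, T.homology n →ₗ[R] W p q}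
    (h : D.IsCokernelFamily n ψ) (e : ∀ p q, W p q ≃ₗ[R] W' p q) :
    D.IsCokernelFamily n fun p q => (e p q).toLinearMap ∘ₗ ψ p q where
  surjective v := by
    obtain ⟨y, hy⟩ := h.surjective fun p q => (e p q).symm (v p q)
    exact ⟨y, fun p q hpq => by simp [hy p q hpq]⟩
  exists_eq_add x hx := h.exists_eq_add x fun p q hpq => by simpa using hx p q hpq
  eq_zero x z hx p q hpq := by simp [h.eq_zero x z hx p q hpq]

/-- Allows the splitting hypothesis to be placed on B: sums of products of cycles correspond under
exchange of the factors by `swap_cycFam`. -/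
theorem IsCokernelFamily.of_swap {n : ℕ} {W : ℕ → ℕ → ModuleCat.{u} R}
    {ψ : ∀ p q, T.homology n →ₗ[R] W p q}
    (h : D.swap.IsCokernelFamily n ψ) : D.IsCokernelFamily n fun p q => ψ q p where
  surjective v := by
    obtain ⟨y, hy⟩ := h.surjective fun p q => v q p
    exact ⟨y, fun p q hpq => hy q p (by omega)⟩
  exists_eq_add x hx := by
    obtain ⟨z, t, e⟩ := h.exists_eq_add x fun p q hpq => hx q p (by omega)
    exact ⟨_, t, by rw [e, swap_cycFam]⟩
  eq_zero x z hx p q hpq := by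
    refine h.eq_zero x (fun p q => TensorProduct.comm R (A.cycles q) (B.cycles p) (z q p)) ?_ q p
      (by omega)
    rw [hx, swap_cycFam]
    congr 1
    funext p q
    exact ((TensorProduct.comm R (A.cycles p) (B.cycles q)).symm_apply_apply (z p q)).symm

variable (D)

/-- The maps are induced by the class of `bdryPart` in the homology of B. It is well defined on
homology, takes values in the kernel, attains every family there, and vanishes exactly modulo
boundaries on sums of products of cycles. -/
theorem exists_isCokernelFamily_ker (hA : A.IsSplit) (n : ℕ) :
    ∃ ψ : ∀ p q, T.homology n →ₗ[R]
        ModuleCat.of R (LinearMap.ker ((A.bdry p).subtype.rTensor (B.homology q))),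
      D.IsCokernelFamily n ψ := by
  have key : ∀ p q, ∃ ψ : T.homology n →ₗ[R]
      LinearMap.ker ((A.bdry p).subtype.rTensor (B.homology q)), p + q + 1 = n → ∀ x,
        (ψ (T.cls n x) : A.bdry p ⊗[R] B.homology q) =
          (B.cls q).lTensor _ (D.bdryPart hA n p q x) := by
    intro p q
    by_cases h : p + q + 1 = n
    · refine ⟨descSurj (W := LinearMap.ker ((A.bdry p).subtype.rTensor (B.homology q))) (T.cls n)
        (cls_surjective n)
        (((B.cls q).lTensor _ ∘ₗ D.bdryPart hA n p q).codRestrict _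
          (D.rTensor_subtype_cls_bdryPart hA n p q h)) ?_, fun _ x => ?_⟩
      · intro x hx
        obtain ⟨y, rfl⟩ := (exact_bdryMap_cls n x).mp hx
        exact Subtype.ext (D.lTensor_cls_bdryPart_bdryMap hA n p q h y)
      · rw [descSurj_apply]
        rfl
    · exact ⟨0, fun h' => absurd h' h⟩
  choose ψ hψ using key
  refine ⟨ψ, ⟨fun v => ?_, fun x hx => ?_, fun x z hx p q h => Subtype.ext ?_⟩⟩
  · obtain ⟨x, hx⟩ := D.exists_lTensor_cls_bdryPart_eq hA n (fun p q => (v p q).1)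
      fun p q _ => (v p q).2
    exact ⟨T.cls n x, fun p q h => Subtype.ext ((hψ p q h x).trans (hx p q h))⟩
  · exact D.exists_eq_fam_add_diff hA x fun p q h => by
      rw [← hψ p q h x, hx p q h]
      rfl
  · rw [hψ p q h x]
    have := hA.projective_bdry p
    have e := D.lTensor_bdryPart hA n p q h x
    rw [hx, cycFam, D.proj_fam _ _ _ (by omega), map_eq_rTensor_lTensor,
      rTensor_rTensor_eq_zero (bdryProj_cycIncl p)] at e
    rw [(map_eq_zero_iff _ (lTensor_cycIncl_injective B q)).mp e, map_zero]
    rfl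

/-- The cokernel of the homology cross product is a sum of `Tor₁` modules. -/
theorem exists_isCokernelFamily [IsDomain R] [IsPrincipalIdealRing R]
    (h : A.IsSplit ∨ B.IsSplit) (n : ℕ) :
    ∃ ψ : ∀ p q, T.homology n →ₗ[R] modTorOne R (A.homology p) (B.homology q),
      D.IsCokernelFamily n ψ := by
  rcases h with hA | hB
  · obtain ⟨ψ, hψ⟩ := D.exists_isCokernelFamily_ker hA n
    have e : ∀ p q, Nonempty (modTorOne R (A.homology p) (B.homology q) ≃ₗ[R]
        LinearMap.ker ((A.bdry p).subtype.rTensor (B.homology q))) := fun p q => by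
      have := hA.projective_bdry p
      have := hA.projective_cycles p
      exact nonempty_modTorOne_equiv_ker_rTensor (D := A.bdry p) (B.homology q) (A.bdry p).subtype
        (A.cls p) Subtype.val_injective (exact_bdry_cls p) (cls_surjective p)
    exact ⟨_, hψ.equiv fun p q => (e p q).some.symm⟩
  · obtain ⟨ψ, hψ⟩ := D.swap.exists_isCokernelFamily_ker hB n
    have e : ∀ p q, Nonempty (modTorOne R (A.homology q) (B.homology p) ≃ₗ[R]
        LinearMap.ker ((B.bdry p).subtype.rTensor (A.homology q))) := fun p q => by
      have := hB.flat_cycles p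
      obtain ⟨e⟩ := nonempty_modTorOne_equiv_ker_lTensor (D := B.bdry p) (A.homology q)
        (B.bdry p).subtype (B.cls p) Subtype.val_injective (exact_bdry_cls p) (cls_surjective p)
      exact ⟨e.trans (kerLTensorEquivKerRTensor _ _)⟩
    exact ⟨_, (hψ.equiv fun p q => (e p q).some.symm).of_swap⟩

/-- If a sum of products of cycles is a boundary, then the products of the homology classes are
zero. -/
theorem map_cls_eq_zero_of_isSplit (h : A.IsSplit ∨ B.IsSplit) (n : ℕ)
    (z : ∀ p q, A.cycles p ⊗[R] B.cycles q) (t : T.X (n + 1)) (ht : T.diff n t = D.cycFam n z)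
    (p q : ℕ) (hpq : p + q = n) : TensorProduct.map (A.cls p) (B.cls q) (z p q) = 0 := by
  rcases h with hA | hB
  · exact D.map_cls_eq_zero hA n z t ht p q hpq
  · let z' : ∀ p q, B.cycles p ⊗[R] A.cycles q := fun p q =>
      TensorProduct.comm R (A.cycles q) (B.cycles p) (z q p)
    have hz : z p q = TensorProduct.comm R (B.cycles q) (A.cycles p) (z' q p) :=
      ((TensorProduct.comm R (A.cycles p) (B.cycles q)).symm_apply_apply (z p q)).symm
    have h' := D.swap.map_cls_eq_zero hB n z' t (by
      refine ht.trans ((D.swap_cycFam n z').trans ?_).symm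
      congr 1
      funext p q
      exact (TensorProduct.comm R (A.cycles p) (B.cycles q)).symm_apply_apply (z p q)) q p (by omega)
    rw [hz, map_eq_rTensor_lTensor, ← comm_rTensor, ← comm_lTensor, ← rTensor_lTensor_comm,
      ← map_eq_rTensor_lTensor, h', map_zero]

end TensorTotal

end

/-! ### Morphisms into a product orbit -/

namespace Orb
variable {G₁ G₂ : Type u} [Group G₁] [Group G₂]
  {F₁ : SubgroupFamily G₁} {F₂ : SubgroupFamily G₂}

theorem fst_map_fstIso {Z : Orb (F₁.prod F₂)} {X : Orb F₁} {Y : Orb F₂} (φ : Z ⟶ pair X Y)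
    (a : G₁) (b : G₂) (h : toMap φ ((1 : G₁ × G₂) : (G₁ × G₂) ⧸ Z.sub) =
      (((a, b) : G₁ × G₂) : (G₁ × G₂) ⧸ (pair X Y).sub)) :
    toMap ((fst F₁ F₂).map φ ≫ (fstIso X Y).hom)
      (cosetMap (MonoidHom.fst G₁ G₂) Z.sub ((1 : G₁ × G₂) : (G₁ × G₂) ⧸ Z.sub)) =
      ((a : G₁) : G₁ ⧸ X.sub) := by
  have h2 : toMap ((fst F₁ F₂).map φ)
      (cosetMap (MonoidHom.fst G₁ G₂) Z.sub ((1 : G₁ × G₂) : (G₁ × G₂) ⧸ Z.sub)) =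
      cosetMap (MonoidHom.fst G₁ G₂) (pair X Y).sub
        (((a, b) : G₁ × G₂) : (G₁ × G₂) ⧸ (pair X Y).sub) :=
    (mapHom_cosetMap _ _ _ _).trans (congrArg _ h)
  exact (congrArg (toMap (fstIso X Y).hom) h2).trans (fstIso_hom_mk X Y a b)

theorem snd_map_sndIso {Z : Orb (F₁.prod F₂)} {X : Orb F₁} {Y : Orb F₂} (φ : Z ⟶ pair X Y)
    (a : G₁) (b : G₂) (h : toMap φ ((1 : G₁ × G₂) : (G₁ × G₂) ⧸ Z.sub) =
      (((a, b) : G₁ × G₂) : (G₁ × G₂) ⧸ (pair X Y).sub)) :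
    toMap ((snd F₁ F₂).map φ ≫ (sndIso X Y).hom)
      (cosetMap (MonoidHom.snd G₁ G₂) Z.sub ((1 : G₁ × G₂) : (G₁ × G₂) ⧸ Z.sub)) =
      ((b : G₂) : G₂ ⧸ Y.sub) := by
  have h2 : toMap ((snd F₁ F₂).map φ)
      (cosetMap (MonoidHom.snd G₁ G₂) Z.sub ((1 : G₁ × G₂) : (G₁ × G₂) ⧸ Z.sub)) =
      cosetMap (MonoidHom.snd G₁ G₂) (pair X Y).sub
        (((a, b) : G₁ × G₂) : (G₁ × G₂) ⧸ (pair X Y).sub) :=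
    (mapHom_cosetMap _ _ _ _).trans (congrArg _ h)
  exact (congrArg (toMap (sndIso X Y).hom) h2).trans (sndIso_hom_mk X Y a b)

/-- The morphism to `(G₁ × G₂)/(H₁ × H₂)` with given components. -/
def lift {Z : Orb (F₁.prod F₂)} {X : Orb F₁} {Y : Orb F₂} (f : (fst F₁ F₂).obj Z ⟶ X)
    (g : (snd F₁ F₂).obj Z ⟶ Y) : Z ⟶ pair X Y :=
  ofFixed Z (pair X Y) (cosetPair X.sub Y.sub
    (toMap f (cosetMap (MonoidHom.fst G₁ G₂) Z.sub ((1 : G₁ × G₂) : (G₁ × G₂) ⧸ Z.sub)))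
    (toMap g (cosetMap (MonoidHom.snd G₁ G₂) Z.sub ((1 : G₁ × G₂) : (G₁ × G₂) ⧸ Z.sub)))) (by
      intro h hh
      refine (cosetPair_smul _ _ _ _ _).trans ?_
      have h1 := fixed_of_hom f h.1 ⟨h, hh, rfl⟩
      have h2 := fixed_of_hom g h.2 ⟨h, hh, rfl⟩
      exact congrArg₂ _ h1 h2)

theorem exists_lift_one {Z : Orb (F₁.prod F₂)} {X : Orb F₁} {Y : Orb F₂}
    (f : (fst F₁ F₂).obj Z ⟶ X) (g : (snd F₁ F₂).obj Z ⟶ Y) :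
    ∃ (a : G₁) (b : G₂),
      toMap f (cosetMap (MonoidHom.fst G₁ G₂) Z.sub ((1 : G₁ × G₂) : (G₁ × G₂) ⧸ Z.sub)) =
        ((a : G₁) : G₁ ⧸ X.sub) ∧
      toMap g (cosetMap (MonoidHom.snd G₁ G₂) Z.sub ((1 : G₁ × G₂) : (G₁ × G₂) ⧸ Z.sub)) =
        ((b : G₂) : G₂ ⧸ Y.sub) ∧
      toMap (lift f g) ((1 : G₁ × G₂) : (G₁ × G₂) ⧸ Z.sub) =
        (((a, b) : G₁ × G₂) : (G₁ × G₂) ⧸ (pair X Y).sub) := by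
  obtain ⟨a, ha⟩ := QuotientGroup.mk_surjective
    (toMap f (cosetMap (MonoidHom.fst G₁ G₂) Z.sub ((1 : G₁ × G₂) : (G₁ × G₂) ⧸ Z.sub)))
  obtain ⟨b, hb⟩ := QuotientGroup.mk_surjective
    (toMap g (cosetMap (MonoidHom.snd G₁ G₂) Z.sub ((1 : G₁ × G₂) : (G₁ × G₂) ⧸ Z.sub)))
  refine ⟨a, b, ha.symm, hb.symm, ?_⟩
  rw [lift, ofFixed_mk, ← ha, ← hb, one_smul]
  rfl

theorem lift_fst {Z : Orb (F₁.prod F₂)} {X : Orb F₁} {Y : Orb F₂} (f : (fst F₁ F₂).obj Z ⟶ X)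
    (g : (snd F₁ F₂).obj Z ⟶ Y) : (fst F₁ F₂).map (lift f g) ≫ (fstIso X Y).hom = f := by
  obtain ⟨a, b, ha, hb, h⟩ := exists_lift_one f g
  exact map_hom_ext (MonoidHom.fst G₁ G₂) (F₁.map_fst_mem F₂)
    ((fst_map_fstIso (lift f g) a b h).trans ha.symm)

theorem lift_snd {Z : Orb (F₁.prod F₂)} {X : Orb F₁} {Y : Orb F₂} (f : (fst F₁ F₂).obj Z ⟶ X)
    (g : (snd F₁ F₂).obj Z ⟶ Y) : (snd F₁ F₂).map (lift f g) ≫ (sndIso X Y).hom = g := by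
  obtain ⟨a, b, ha, hb, h⟩ := exists_lift_one f g
  exact map_hom_ext (MonoidHom.snd G₁ G₂) (F₁.map_snd_mem F₂)
    ((snd_map_sndIso (lift f g) a b h).trans hb.symm)

/-- A coset of H₁ × H₂ is determined by its two components. Together with `lift_fst` and `lift_snd`,
this says that `pair X Y` represents pairs of morphisms out of the two projections. -/
theorem pair_hom_ext {Z : Orb (F₁.prod F₂)} {X : Orb F₁} {Y : Orb F₂} {φ ψ : Z ⟶ pair X Y}
    (h₁ : (fst F₁ F₂).map φ ≫ (fstIso X Y).hom = (fst F₁ F₂).map ψ ≫ (fstIso X Y).hom)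
    (h₂ : (snd F₁ F₂).map φ ≫ (sndIso X Y).hom = (snd F₁ F₂).map ψ ≫ (sndIso X Y).hom) :
    φ = ψ := by
  obtain ⟨⟨a, b⟩, h⟩ := QuotientGroup.mk_surjective
    (toMap φ ((1 : G₁ × G₂) : (G₁ × G₂) ⧸ Z.sub))
  obtain ⟨⟨a', b'⟩, h'⟩ := QuotientGroup.mk_surjective
    (toMap ψ ((1 : G₁ × G₂) : (G₁ × G₂) ⧸ Z.sub))
  have e₁ := (fst_map_fstIso φ a b h.symm).symm.trans
    ((congrArg (fun k => toMap k _) h₁).trans (fst_map_fstIso ψ a' b' h'.symm))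
  have e₂ := (snd_map_sndIso φ a b h.symm).symm.trans
    ((congrArg (fun k => toMap k _) h₂).trans (snd_map_sndIso ψ a' b' h'.symm))
  refine hom_ext (h.symm.trans (Eq.trans ?_ h'))
  exact congrArg₂ (cosetPair X.sub Y.sub) e₁ e₂

end Orb

/-! ### The external tensor product over the product orbit category -/

section Cross
variable {R : Type} [CommRing R] {G₁ G₂ : Type u} [Group G₁] [Group G₂]
  {F₁ : SubgroupFamily G₁} {F₂ : SubgroupFamily G₂}
  (P : (Orb F₁)ᵒᵖ ⥤ ModuleCat.{u} R) (Q : (Orb F₂)ᵒᵖ ⥤ ModuleCat.{u} R)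
  (M : Orb F₁ ⥤ ModuleCat.{u} R) (M' : Orb F₂ ⥤ ModuleCat.{u} R)

/-- For an orbit `Z`, the map
`(P(p₁ Z) ⊗ Q(p₂ Z)) ⊗ (M(p₁ Z) ⊗ M'(p₂ Z)) → (P ⊗ M) ⊗ (Q ⊗ M')`. -/
noncomputable def uncrossAt (Z : Orb (F₁.prod F₂)) :
    (((extRight F₁ F₂).obj P).obj Q).obj (Opposite.op Z) ⊗[R] (extLeft F₁ F₂ M M').obj Z →ₗ[R]
      CoTensor P M ⊗[R] CoTensor Q M' :=
  TensorProduct.map (CoTensor.ι P M ((Orb.fst F₁ F₂).obj Z))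
    (CoTensor.ι Q M' ((Orb.snd F₁ F₂).obj Z)) ∘ₗ
  (TensorProduct.tensorTensorTensorComm R (P.obj (Opposite.op ((Orb.fst F₁ F₂).obj Z)))
    (Q.obj (Opposite.op ((Orb.snd F₁ F₂).obj Z))) (M.obj ((Orb.fst F₁ F₂).obj Z))
    (M'.obj ((Orb.snd F₁ F₂).obj Z))).toLinearMap

variable {P Q M M'}

theorem uncrossAt_mk {Z : Orb (F₁.prod F₂)} (a : P.obj (Opposite.op ((Orb.fst F₁ F₂).obj Z)))
    (b : Q.obj (Opposite.op ((Orb.snd F₁ F₂).obj Z))) (m : M.obj ((Orb.fst F₁ F₂).obj Z))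
    (m' : M'.obj ((Orb.snd F₁ F₂).obj Z)) :
    uncrossAt P Q M M' Z (extRightMk a b ⊗ₜ[R] extLeftMk m m') =
      CoTensor.ι P M _ (a ⊗ₜ[R] m) ⊗ₜ[R] CoTensor.ι Q M' _ (b ⊗ₜ[R] m') := rfl

/-- Tensor induction phrased with `extRightMk`, so that the values of the bifunctor need not be
unfolded. -/
theorem extRight_induction {Z : Orb (F₁.prod F₂)}
    {motive : (((extRight F₁ F₂).obj P).obj Q).obj (Opposite.op Z) → Prop}
    (x : (((extRight F₁ F₂).obj P).obj Q).obj (Opposite.op Z)) (zero : motive 0)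
    (mk : ∀ a b, motive (extRightMk a b)) (add : ∀ x y, motive x → motive y → motive (x + y)) :
    motive x :=
  TensorProduct.induction_on x zero mk add

theorem extLeft_induction {Z : Orb (F₁.prod F₂)}
    {motive : (extLeft F₁ F₂ M M').obj Z → Prop}
    (x : (extLeft F₁ F₂ M M').obj Z) (zero : motive 0)
    (mk : ∀ a b, motive (extLeftMk a b)) (add : ∀ x y, motive x → motive y → motive (x + y)) :
    motive x :=
  TensorProduct.induction_on x zero mk add

theorem uncrossAt_rel {Z Z' : Orb (F₁.prod F₂)} (φ : Z ⟶ Z')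
    (x : (((extRight F₁ F₂).obj P).obj Q).obj (Opposite.op Z'))
    (y : (extLeft F₁ F₂ M M').obj Z) :
    uncrossAt P Q M M' Z (((((extRight F₁ F₂).obj P).obj Q).map φ.op).hom x ⊗ₜ[R] y) =
      uncrossAt P Q M M' Z' (x ⊗ₜ[R] ((extLeft F₁ F₂ M M').map φ).hom y) := by
  induction x using extRight_induction with
  | zero => simp
  | add x x' h h' => rw [map_add, TensorProduct.add_tmul, TensorProduct.add_tmul, map_add,
      map_add, h, h']
  | mk a b =>
    induction y using extLeft_induction with
    | zero => simp
    | add y y' h h' => rw [map_add, TensorProduct.tmul_add, TensorProduct.tmul_add, map_add,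
        map_add, h, h']
    | mk m m' =>
      exact congrArg₂ (· ⊗ₜ[R] ·)
        (CoTensor.ι_rel (M := P) (N := M) ((Orb.fst F₁ F₂).map φ) a m)
        (CoTensor.ι_rel (M := Q) (N := M') ((Orb.snd F₁ F₂).map φ) b m')

variable (P Q M M')

/-- The inverse of the cross product map. -/
noncomputable def uncross : CoTensor (((extRight F₁ F₂).obj P).obj Q) (extLeft F₁ F₂ M M') →ₗ[R]
    CoTensor P M ⊗[R] CoTensor Q M' :=
  CoTensor.desc (uncrossAt P Q M M') fun _ _ φ x y => uncrossAt_rel φ x y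

theorem uncross_ι (Z : Orb (F₁.prod F₂))
    (x : (((extRight F₁ F₂).obj P).obj Q).obj (Opposite.op Z) ⊗[R] (extLeft F₁ F₂ M M').obj Z) :
    uncross P Q M M' (CoTensor.ι _ _ Z x) = uncrossAt P Q M M' Z x :=
  CoTensor.desc_ι _ _ _ _

/-- `cross` moves the contravariant factors along `fstIso` and `sndIso` and the covariant ones along
their inverses; the coend relation moves one onto the other, where they cancel. -/
theorem uncross_cross (t : CoTensor P M ⊗[R] CoTensor Q M') :
    uncross P Q M M' (cross P Q M M' t) = t := by
  suffices h : uncross P Q M M' ∘ₗ cross P Q M M' = LinearMap.id from LinearMap.congr_fun h t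
  refine cross_ext fun X Y a m b m' => ?_
  rw [LinearMap.comp_apply, cross_ι, crossAt_tmul, uncross_ι, uncrossAt_mk, LinearMap.id_apply,
    CoTensor.ι_rel, CoTensor.ι_rel]
  have h : ∀ (C : Type u) [SmallCategory C] (N : C ⥤ ModuleCat.{u} R) (c d : C) (e : c ≅ d)
      (n : N.obj d), (N.map e.hom).hom ((N.map e.inv).hom n) = n := fun C _ N c d e n =>
    congrArg (fun k => k.hom n) ((N.mapIso e).inv_hom_id)
  rw [h, h]

/-- The round trip moves an element from Z to the product orbit of the two projections of Z. The
canonical morphism φ between these orbits, whose components are identities, exhibits the result as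
the same element of the coend. -/
theorem cross_uncross (t : CoTensor (((extRight F₁ F₂).obj P).obj Q) (extLeft F₁ F₂ M M')) :
    cross P Q M M' (uncross P Q M M' t) = t := by
  suffices h : cross P Q M M' ∘ₗ uncross P Q M M' = LinearMap.id from LinearMap.congr_fun h t
  refine CoTensor.hom_ext fun Z x y => ?_
  induction x using extRight_induction with
  | zero => simp
  | add x x' h h' => rw [TensorProduct.add_tmul, map_add, map_add, map_add, h, h']
  | mk a b =>
    induction y using extLeft_induction with
    | zero => simp
    | add y y' h h' => rw [TensorProduct.tmul_add, map_add, map_add, map_add, h, h']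
    | mk m m' =>
      rw [LinearMap.comp_apply, LinearMap.id_apply, uncross_ι, uncrossAt_mk, cross_ι, crossAt_tmul]
      let X := (Orb.fst F₁ F₂).obj Z
      let Y := (Orb.snd F₁ F₂).obj Z
      let φ : Z ⟶ Orb.pair X Y := Orb.lift (𝟙 X) (𝟙 Y)
      have e₁ : (Orb.fst F₁ F₂).map φ ≫ (Orb.fstIso X Y).hom = 𝟙 X := Orb.lift_fst _ _
      have e₂ : (Orb.snd F₁ F₂).map φ ≫ (Orb.sndIso X Y).hom = 𝟙 Y := Orb.lift_snd _ _
      have i₁ : (Orb.fst F₁ F₂).map φ = (Orb.fstIso X Y).inv :=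
        (Iso.comp_hom_eq_id _).mp e₁
      have i₂ : (Orb.snd F₁ F₂).map φ = (Orb.sndIso X Y).inv :=
        (Iso.comp_hom_eq_id _).mp e₂
      have hP : (P.map ((Orb.fst F₁ F₂).map φ).op).hom ((P.map (Orb.fstIso X Y).hom.op).hom a) =
          a := by
        rw [← LinearMap.comp_apply, ← ModuleCat.hom_comp, ← P.map_comp, ← op_comp, e₁, op_id,
          P.map_id]
        rfl
      have hQ : (Q.map ((Orb.snd F₁ F₂).map φ).op).hom ((Q.map (Orb.sndIso X Y).hom.op).hom b) =
          b := by
        rw [← LinearMap.comp_apply, ← ModuleCat.hom_comp, ← Q.map_comp, ← op_comp, e₂, op_id,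
          Q.map_id]
        rfl
      have h := CoTensor.ι_rel (M := ((extRight F₁ F₂).obj P).obj Q) (N := extLeft F₁ F₂ M M') φ
        (extRightMk ((P.map (Orb.fstIso X Y).hom.op).hom a)
          ((Q.map (Orb.sndIso X Y).hom.op).hom b))
        (extLeftMk m m')
      have h₁ : ((((extRight F₁ F₂).obj P).obj Q).map φ.op).hom
          (extRightMk ((P.map (Orb.fstIso X Y).hom.op).hom a)
            ((Q.map (Orb.sndIso X Y).hom.op).hom b)) = extRightMk a b :=
        congrArg₂ (· ⊗ₜ[R] ·) hP hQ
      have h₂ : ((extLeft F₁ F₂ M M').map φ).hom (extLeftMk m m') =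
          extLeftMk ((M.map (Orb.fstIso X Y).inv).hom m) ((M'.map (Orb.sndIso X Y).inv).hom m') := by
        rw [← i₁, ← i₂]
        rfl
      rw [h₁, h₂] at h
      exact h.symm

/-- The natural isomorphism
`(P ⊗_{F₁} M) ⊗ (Q ⊗_{F₂} M') ≅ (res P ⊗ res Q) ⊗_{F₁ × F₂} (res M ⊗ res M')`. -/
noncomputable def crossEquiv : CoTensor P M ⊗[R] CoTensor Q M' ≃ₗ[R]
    CoTensor (((extRight F₁ F₂).obj P).obj Q) (extLeft F₁ F₂ M M') where
  __ := cross P Q M M'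
  invFun := uncross P Q M M'
  left_inv := uncross_cross P Q M M'
  right_inv := cross_uncross P Q M M'

end Cross

/-! ### Components of the total complex -/

section TotalProjection
variable {R : Type} [CommRing R] {G₁ G₂ : Type u} [Group G₁] [Group G₂]
  {F₁ : SubgroupFamily G₁} {F₂ : SubgroupFamily G₂}
  (K : ChainComplex ((Orb F₁)ᵒᵖ ⥤ ModuleCat.{u} R) ℕ)
  (L : ChainComplex ((Orb F₂)ᵒᵖ ⥤ ModuleCat.{u} R) ℕ)

/-- The projection of the total complex to the summand `res_{p₁} K_p ⊗ res_{p₂} L_q`. -/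
noncomputable def extProj (n p q : ℕ) :
    (extTotal K L).X n ⟶ ((extRight F₁ F₂).obj (K.X p)).obj (L.X q) :=
  HomologicalComplex.mapBifunctorDesc (K₁ := K) (K₂ := L) (F := extRight F₁ F₂)
    (c := ComplexShape.down ℕ) fun p' q' _ =>
      if e : p' = p ∧ q' = q then eqToHom (by rw [e.1, e.2]) else 0

variable {K L}

theorem extTotalι_extProj (n p q p' q' : ℕ) (h : p' + q' = n) :
    extTotalι K L p' q' n h ≫ extProj K L n p q =
      if e : p' = p ∧ q' = q then eqToHom (by rw [e.1, e.2]) else 0 :=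
  HomologicalComplex.ι_mapBifunctorDesc (K₁ := K) (K₂ := L) (F := extRight F₁ F₂)
    (c := ComplexShape.down ℕ) _ p' q' h

theorem extTotalι_extProj_self (n p q : ℕ) (h : p + q = n) :
    extTotalι K L p q n h ≫ extProj K L n p q = 𝟙 _ := by
  rw [extTotalι_extProj, dif_pos ⟨rfl, rfl⟩, eqToHom_refl]

theorem extTotalι_extProj_of_ne (n p q p' q' : ℕ) (h : p' + q' = n) (hne : ¬(p' = p ∧ q' = q)) :
    extTotalι K L p' q' n h ≫ extProj K L n p q = 0 := by
  rw [extTotalι_extProj, dif_neg hne]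

theorem sum_extProj_extTotalι (n : ℕ) :
    ∑ x ∈ (Finset.HasAntidiagonal.antidiagonal n).attach, extProj K L n x.1.1 x.1.2 ≫
      extTotalι K L x.1.1 x.1.2 n (Finset.HasAntidiagonal.mem_antidiagonal.mp x.2) = 𝟙 _ := by
  refine extTotal_hom_ext fun p q hpq => ?_
  rw [Preadditive.comp_sum, Finset.sum_eq_single
    ⟨(p, q), Finset.HasAntidiagonal.mem_antidiagonal.mpr hpq⟩]
  · rw [← Category.assoc, extTotalι_extProj_self, Category.id_comp, Category.comp_id]
  · rintro ⟨⟨p', q'⟩, h⟩ _ hne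
    rw [← Category.assoc, extTotalι_extProj_of_ne, zero_comp]
    rintro ⟨rfl, rfl⟩
    exact hne rfl
  · exact fun h => absurd (Finset.mem_attach _ _) h

/-- Checked on each summand: bidegree (p, q) is reached only from (p + 1, q) by the first
differential and from (p, q + 1) by the second. -/
theorem d_extProj (n p q : ℕ) (h : p + q = n) :
    (extTotal K L).d (n + 1) n ≫ extProj K L n p q =
      ComplexShape.ε₁ (ComplexShape.down ℕ) (ComplexShape.down ℕ) (ComplexShape.down ℕ)
        (p + 1, q) • (extProj K L (n + 1) (p + 1) q ≫
          ((extRight F₁ F₂).map (K.d (p + 1) p)).app (L.X q)) +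
      ComplexShape.ε₂ (ComplexShape.down ℕ) (ComplexShape.down ℕ) (ComplexShape.down ℕ)
        (p, q + 1) • (extProj K L (n + 1) p (q + 1) ≫
          ((extRight F₁ F₂).obj (K.X p)).map (L.d (q + 1) q)) := by
  refine extTotal_hom_ext fun p' q' hpq => ?_
  rw [extTotal_d, Preadditive.add_comp, Preadditive.comp_add, Preadditive.comp_add,
    Linear.comp_units_smul, Linear.comp_units_smul, ← Category.assoc, ← Category.assoc,
    ← Category.assoc, ← Category.assoc]
  congr 1
  · rcases p' with _ | p'
    · rw [extTotalι_zero_extD₁, extTotalι_extProj_of_ne _ _ _ _ _ _ (by omega), zero_comp,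
        zero_comp, smul_zero]
    · rw [extTotalι_extD₁ p' q' (n + 1) n hpq (by omega), Linear.units_smul_comp, Category.assoc]
      by_cases e : p' = p ∧ q' = q
      · obtain ⟨rfl, rfl⟩ := e
        rw [extTotalι_extProj_self, extTotalι_extProj_self, Category.comp_id, Category.id_comp]
      · rw [extTotalι_extProj_of_ne _ _ _ _ _ _ e,
          extTotalι_extProj_of_ne _ _ _ _ _ _ (by omega), comp_zero, zero_comp, smul_zero,
          smul_zero]
  · rcases q' with _ | q'
    · rw [extTotalι_zero_extD₂, extTotalι_extProj_of_ne _ _ _ _ _ _ (by omega), zero_comp,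
        zero_comp, smul_zero]
    · rw [extTotalι_extD₂ p' q' (n + 1) n hpq (by omega), Linear.units_smul_comp, Category.assoc]
      by_cases e : p' = p ∧ q' = q
      · obtain ⟨rfl, rfl⟩ := e
        rw [extTotalι_extProj_self, extTotalι_extProj_self, Category.comp_id, Category.id_comp]
      · rw [extTotalι_extProj_of_ne _ _ _ _ _ _ e,
          extTotalι_extProj_of_ne _ _ _ _ _ _ (by omega), comp_zero, zero_comp, smul_zero,
          smul_zero]

/-- The total complex carries signs in the units of ℤ, while `TensorTotal` records units of R. -/
theorem units_smul_eq_map_smul {V : Type*} [AddCommGroup V] [Module R V] (ε : ℤˣ) (x : V) :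
    ε • x = Units.map (Int.castRingHom R).toMonoidHom ε • x := by
  rcases Int.units_eq_one_or ε with rfl | rfl
  · simp
  · simp [Units.smul_def]

/-! ### Additive functors applied to the total complex, used for `tensorOver` and for evaluation -/

section
variable (Φ : ((Orb (F₁.prod F₂))ᵒᵖ ⥤ ModuleCat.{u} R) ⥤ ModuleCat.{u} R)

theorem map_extProj_map_extTotalι (n p q : ℕ) (h : p + q = n)
    (y : Φ.obj (((extRight F₁ F₂).obj (K.X p)).obj (L.X q))) :
    (Φ.map (extProj K L n p q)).hom ((Φ.map (extTotalι K L p q n h)).hom y) = y := by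
  rw [← LinearMap.comp_apply, ← ModuleCat.hom_comp, ← Φ.map_comp, extTotalι_extProj_self,
    Φ.map_id, ModuleCat.hom_id, LinearMap.id_apply]

theorem map_extProj_map_extTotalι_of_ne [Φ.Additive] (n p q p' q' : ℕ) (h : p' + q' = n)
    (hne : ¬(p' = p ∧ q' = q)) (y : Φ.obj (((extRight F₁ F₂).obj (K.X p')).obj (L.X q'))) :
    (Φ.map (extProj K L n p q)).hom ((Φ.map (extTotalι K L p' q' n h)).hom y) = 0 := by
  rw [← LinearMap.comp_apply, ← ModuleCat.hom_comp, ← Φ.map_comp,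
    extTotalι_extProj_of_ne _ _ _ _ _ _ hne, Φ.map_zero, ModuleCat.hom_zero, LinearMap.zero_apply]

theorem eq_zero_of_map_extProj [Φ.Additive] (n : ℕ) (x : Φ.obj ((extTotal K L).X n))
    (h : ∀ p q, p + q = n → (Φ.map (extProj K L n p q)).hom x = 0) : x = 0 := by
  have e := congrArg (fun k => (Φ.map k).hom x) (sum_extProj_extTotalι (K := K) (L := L) n)
  simp only [Φ.map_id, ModuleCat.hom_id, LinearMap.id_apply, Functor.map_sum,
    ModuleCat.hom_sum, LinearMap.sum_apply, Functor.map_comp, ModuleCat.hom_comp,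
    LinearMap.comp_apply] at e
  refine e.symm.trans (Finset.sum_eq_zero fun y _ => ?_)
  rw [h y.1.1 y.1.2 (Finset.HasAntidiagonal.mem_antidiagonal.mp y.2), map_zero]

theorem map_extProj_map_d [Φ.Additive] (n p q : ℕ) (h : p + q = n) (x : Φ.obj ((extTotal K L).X (n + 1))) :
    (Φ.map (extProj K L n p q)).hom ((Φ.map ((extTotal K L).d (n + 1) n)).hom x) =
      ComplexShape.ε₁ (ComplexShape.down ℕ) (ComplexShape.down ℕ) (ComplexShape.down ℕ)
        (p + 1, q) • (Φ.map (((extRight F₁ F₂).map (K.d (p + 1) p)).app (L.X q))).hom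
          ((Φ.map (extProj K L (n + 1) (p + 1) q)).hom x) +
      ComplexShape.ε₂ (ComplexShape.down ℕ) (ComplexShape.down ℕ) (ComplexShape.down ℕ)
        (p, q + 1) • (Φ.map (((extRight F₁ F₂).obj (K.X p)).map (L.d (q + 1) q))).hom
          ((Φ.map (extProj K L (n + 1) p (q + 1))).hom x) := by
  have e := congrArg (fun k => (Φ.map k).hom x) (d_extProj (K := K) (L := L) n p q h)
  simpa only [Φ.map_add, Units.smul_def, Φ.map_zsmul, ModuleCat.hom_add, ModuleCat.hom_zsmul,
    LinearMap.add_apply, LinearMap.smul_apply, Functor.map_comp, ModuleCat.hom_comp,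
    LinearMap.comp_apply] using e

variable {A B : ChainComplex (ModuleCat.{u} R) ℕ}
  (θ : ∀ p q, Φ.obj (((extRight F₁ F₂).obj (K.X p)).obj (L.X q)) ≃ₗ[R] A.X p ⊗[R] B.X q)

/-- The inclusion of `A_p ⊗ B_q` into the image of the total complex. -/
noncomputable def extInj (n p q : ℕ) : A.X p ⊗[R] B.X q →ₗ[R] Φ.obj ((extTotal K L).X n) :=
  if h : p + q = n then (Φ.map (extTotalι K L p q n h)).hom ∘ₗ (θ p q).symm.toLinearMap else 0

theorem extInj_apply (n p q : ℕ) (h : p + q = n) (t : A.X p ⊗[R] B.X q) :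
    extInj Φ θ n p q t = (Φ.map (extTotalι K L p q n h)).hom ((θ p q).symm t) := by
  rw [extInj, dif_pos h]
  rfl

theorem extInj_eq_zero (n p q : ℕ) (h : ¬p + q = n) (t : A.X p ⊗[R] B.X q) :
    extInj Φ θ n p q t = 0 := by
  rw [extInj, dif_neg h]
  rfl

/-- An additive functor that sends `res_{p₁} K_p ⊗ res_{p₂} L_q` to `A_p ⊗ B_q` sends the total
complex to the total complex. -/
noncomputable def extTotalTensorTotal [Φ.Additive]
    (hθ₁ : ∀ p q y, θ p q ((Φ.map (((extRight F₁ F₂).map (K.d (p + 1) p)).app (L.X q))).hom y) =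
      (A.diff p).rTensor (B.X q) (θ (p + 1) q y))
    (hθ₂ : ∀ p q y, θ p q ((Φ.map (((extRight F₁ F₂).obj (K.X p)).map (L.d (q + 1) q))).hom y) =
      (B.diff q).lTensor (A.X p) (θ p (q + 1) y)) :
    TensorTotal A B ((Φ.mapHomologicalComplex (ComplexShape.down ℕ)).obj (extTotal K L)) where
  inj n p q := extInj Φ θ n p q
  proj n p q := (θ p q).toLinearMap ∘ₗ (Φ.map (extProj K L n p q)).hom
  proj_inj n p q h t := by
    change θ p q ((Φ.map (extProj K L n p q)).hom (extInj Φ θ n p q t)) = t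
    rw [extInj_apply Φ θ n p q h, map_extProj_map_extTotalι, LinearEquiv.apply_symm_apply]
  proj_inj_of_ne n p q p' q' h t := by
    change θ p q ((Φ.map (extProj K L n p q)).hom (extInj Φ θ n p' q' t)) = 0
    by_cases h' : p' + q' = n
    · rw [extInj_apply Φ θ n p' q' h',
        map_extProj_map_extTotalι_of_ne Φ n p q p' q' h' (by simpa using h), map_zero]
    · rw [extInj_eq_zero Φ θ n p' q' h', map_zero, map_zero]
  ext n x h := eq_zero_of_map_extProj Φ n x fun p q hpq =>
    (θ p q).map_eq_zero_iff.mp (h p q hpq)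
  ε₁ p q := Units.map (Int.castRingHom R).toMonoidHom
    (ComplexShape.ε₁ (ComplexShape.down ℕ) (ComplexShape.down ℕ) (ComplexShape.down ℕ) (p + 1, q))
  ε₂ p q := Units.map (Int.castRingHom R).toMonoidHom
    (ComplexShape.ε₂ (ComplexShape.down ℕ) (ComplexShape.down ℕ) (ComplexShape.down ℕ) (p, q + 1))
  proj_diff n p q h x := by
    rw [← units_smul_eq_map_smul, ← units_smul_eq_map_smul]
    refine (congrArg (θ p q) (map_extProj_map_d Φ n p q h x)).trans ?_
    rw [map_add, Units.smul_def, Units.smul_def, map_zsmul, map_zsmul, hθ₁, hθ₂]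
    rfl

end

variable (K L) (M : Orb F₁ ⥤ ModuleCat.{u} R) (M' : Orb F₂ ⥤ ModuleCat.{u} R)

theorem crossEquiv_symm_natural_left {P P' : (Orb F₁)ᵒᵖ ⥤ ModuleCat.{u} R}
    {Q : (Orb F₂)ᵒᵖ ⥤ ModuleCat.{u} R} (f : P ⟶ P')
    (y : CoTensor (((extRight F₁ F₂).obj P).obj Q) (extLeft F₁ F₂ M M')) :
    (crossEquiv P' Q M M').symm (CoTensor.map (((extRight F₁ F₂).map f).app Q) (𝟙 _) y) =
      (CoTensor.map f (𝟙 M)).rTensor (CoTensor Q M') ((crossEquiv P Q M M').symm y) := by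
  obtain ⟨t, rfl⟩ := (crossEquiv P Q M M').surjective y
  rw [LinearEquiv.symm_apply_apply, LinearEquiv.symm_apply_eq]
  induction t using TensorProduct.induction_on with
  | zero => simp
  | tmul a b => exact cross_natural_left f a b
  | add a b ha hb => simp only [map_add, ha, hb]

theorem crossEquiv_symm_natural_right {P : (Orb F₁)ᵒᵖ ⥤ ModuleCat.{u} R}
    {Q Q' : (Orb F₂)ᵒᵖ ⥤ ModuleCat.{u} R} (f : Q ⟶ Q')
    (y : CoTensor (((extRight F₁ F₂).obj P).obj Q) (extLeft F₁ F₂ M M')) :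
    (crossEquiv P Q' M M').symm (CoTensor.map (((extRight F₁ F₂).obj P).map f) (𝟙 _) y) =
      (CoTensor.map f (𝟙 M')).lTensor (CoTensor P M) ((crossEquiv P Q M M').symm y) := by
  obtain ⟨t, rfl⟩ := (crossEquiv P Q M M').surjective y
  rw [LinearEquiv.symm_apply_apply, LinearEquiv.symm_apply_eq]
  induction t using TensorProduct.induction_on with
  | zero => simp
  | tmul a b => exact cross_natural_right f a b
  | add a b ha hb => simp only [map_add, ha, hb]

/-- The tensor product of the total complex with `res_{p₁} M ⊗ res_{p₂} M'` is the total complex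
of the tensor products. -/
noncomputable def crossTensorTotal : TensorTotal (tensorComplex K M) (tensorComplex L M')
    (tensorComplex (extTotal K L) (extLeft F₁ F₂ M M')) :=
  extTotalTensorTotal (K := K) (L := L) (A := tensorComplex K M) (B := tensorComplex L M')
    (tensorOver (extLeft F₁ F₂ M M')) (fun p q => (crossEquiv (K.X p) (L.X q) M M').symm)
    (fun p _ y => crossEquiv_symm_natural_left M M' (K.d (p + 1) p) y)
    (fun _ q y => crossEquiv_symm_natural_right M M' (L.d (q + 1) q) y)

/-- Identifies the inclusions of the algebraic total complex with the chain-level cross product, so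
that the algebraic statements concern the homology cross product itself. -/
theorem crossTensorTotal_inj (n p q : ℕ) (h : p + q = n)
    (t : CoTensor (K.X p) M ⊗[R] CoTensor (L.X q) M') :
    (crossTensorTotal K L M M').inj n p q t = chainCross K L M M' p q n h t :=
  extInj_apply (K := K) (L := L) (A := tensorComplex K M) (B := tensorComplex L M')
    (tensorOver (extLeft F₁ F₂ M M')) (fun p q => (crossEquiv (K.X p) (L.X q) M M').symm) n p q h t

/-- The value of a complex of functors at an object. -/
noncomputable abbrev evalComplex {C : Type u} [SmallCategory C]
    (K : ChainComplex (Cᵒᵖ ⥤ ModuleCat.{u} R) ℕ) (c : C) : ChainComplex (ModuleCat.{u} R) ℕ :=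
  (((evaluation Cᵒᵖ (ModuleCat.{u} R)).obj (Opposite.op c)).mapHomologicalComplex
    (ComplexShape.down ℕ)).obj K

/-- The value of the total complex at an orbit is the total complex of the values. -/
noncomputable def evalTensorTotal (Z : Orb (F₁.prod F₂)) :
    TensorTotal (evalComplex K ((Orb.fst F₁ F₂).obj Z)) (evalComplex L ((Orb.snd F₁ F₂).obj Z))
      (evalComplex (extTotal K L) Z) :=
  extTotalTensorTotal (K := K) (L := L) (A := evalComplex K ((Orb.fst F₁ F₂).obj Z))
    (B := evalComplex L ((Orb.snd F₁ F₂).obj Z))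
    ((evaluation _ (ModuleCat.{u} R)).obj (Opposite.op Z)) (fun _ _ => LinearEquiv.refl R _)
    (fun _ _ _ => rfl) (fun _ _ _ => rfl)

theorem evalTensorTotal_inj (Z : Orb (F₁.prod F₂)) (n p q : ℕ) (h : p + q = n)
    (t : (K.X p).obj (Opposite.op ((Orb.fst F₁ F₂).obj Z)) ⊗[R]
      (L.X q).obj (Opposite.op ((Orb.snd F₁ F₂).obj Z))) :
    (evalTensorTotal K L Z).inj n p q t =
      ((extTotalι K L p q n h).app (Opposite.op Z)).hom t :=
  extInj_apply (K := K) (L := L) (A := evalComplex K ((Orb.fst F₁ F₂).obj Z))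
    (B := evalComplex L ((Orb.snd F₁ F₂).obj Z))
    ((evaluation _ (ModuleCat.{u} R)).obj (Opposite.op Z)) (fun _ _ => LinearEquiv.refl R _)
    n p q h t

end TotalProjection

/-! ### Bases of contravariant functors -/

section FreeBasis
variable {R : Type} [CommRing R] {C : Type u} [SmallCategory C]

/-- A basis of a contravariant functor: elements `e_i ∈ N(c_i)` such that the elements `φ^* e_i`,
for `φ : d → c_i`, form a basis of `N(d)`. -/
structure FunctorBasis (N : Cᵒᵖ ⥤ ModuleCat.{u} R) where
  ι : Type u
  obj : ι → C
  basis (d : C) : Module.Basis (Σ i, d ⟶ obj i) R (N.obj (Opposite.op d))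
  map_basis {d d' : C} (φ : d' ⟶ d) (i : ι) (f : d ⟶ obj i) :
    (N.map φ.op).hom (basis d ⟨i, f⟩) = basis d' ⟨i, φ ≫ f⟩

namespace FunctorBasis

variable {N N' : Cᵒᵖ ⥤ ModuleCat.{u} R}

/-- Transport of a basis along an isomorphism. -/
noncomputable def ofIso (b : FunctorBasis N) (e : N ≅ N') : FunctorBasis N' where
  ι := b.ι
  obj := b.obj
  basis d := (b.basis d).map (e.app (Opposite.op d)).toLinearEquiv
  map_basis φ i f := by
    rw [Module.Basis.map_apply, Module.Basis.map_apply, ← b.map_basis]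
    exact (congrArg (fun k => k.hom (b.basis _ ⟨i, f⟩)) (e.hom.naturality φ.op)).symm

/-- The basis elements of a contravariant functor. -/
noncomputable def gen (b : FunctorBasis N) (i : b.ι) : N.obj (Opposite.op (b.obj i)) :=
  b.basis _ ⟨i, 𝟙 _⟩

theorem map_gen (b : FunctorBasis N) {d : C} (i : b.ι) (f : d ⟶ b.obj i) :
    (N.map f.op).hom (b.gen i) = b.basis d ⟨i, f⟩ := by
  rw [gen, b.map_basis, Category.comp_id]

theorem hom_ext (b : FunctorBasis N) {f g : N ⟶ N'}
    (h : ∀ i, (f.app _).hom (b.gen i) = (g.app _).hom (b.gen i)) : f = g := by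
  ext d : 2
  ext : 1
  refine (b.basis d.unop).ext fun ⟨i, k⟩ => ?_
  rw [← map_gen]
  have e₁ := congrArg (fun l => l.hom (b.gen i)) (f.naturality k.op)
  have e₂ := congrArg (fun l => l.hom (b.gen i)) (g.naturality k.op)
  refine e₁.trans (Eq.trans ?_ e₂.symm)
  exact congrArg (N'.map k.op).hom (h i)

/-- The morphism with given values on a basis. -/
noncomputable def desc (b : FunctorBasis N) (y : ∀ i, N'.obj (Opposite.op (b.obj i))) : N ⟶ N' where
  app d := ModuleCat.ofHom ((b.basis d.unop).constr R fun k => (N'.map k.2.op).hom (y k.1))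
  naturality d d' φ := by
    ext : 1
    refine (b.basis d.unop).ext fun ⟨i, k⟩ => ?_
    refine (congrArg ((b.basis d'.unop).constr R fun k => (N'.map k.2.op).hom (y k.1))
      (b.map_basis φ.unop i k)).trans ?_
    refine ((b.basis d'.unop).constr_basis R _ _).trans ?_
    refine Eq.trans ?_ (congrArg (N'.map φ).hom ((b.basis d.unop).constr_basis R _ _)).symm
    exact congrArg (fun l => l.hom (y i)) (N'.map_comp k.op φ)

theorem desc_gen (b : FunctorBasis N) (y : ∀ i, N'.obj (Opposite.op (b.obj i))) (i : b.ι) :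
    ((b.desc y).app _).hom (b.gen i) = y i :=
  ((b.basis (b.obj i)).constr_basis R (fun k => (N'.map k.2.op).hom (y k.1)) ⟨i, 𝟙 _⟩).trans
    (congrArg (fun l => l.hom (y i)) (N'.map_id _))

/-- By the Yoneda principle a morphism out of N is an arbitrary choice of values on the generators,
and epimorphisms are surjective at every object, so lifts are chosen generator by generator. -/
theorem projective (b : FunctorBasis N) : Projective N where
  factors {E X} f e he := by
    have h : ∀ i, ∃ y, (e.app (Opposite.op (b.obj i))).hom y = (f.app _).hom (b.gen i) :=
      fun i => ((ModuleCat.epi_iff_surjective (e.app (Opposite.op (b.obj i)))).mp inferInstance) _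
    choose y hy using h
    refine ⟨b.desc y, b.hom_ext fun i => ?_⟩
    exact (congrArg (e.app _).hom (b.desc_gen y i)).trans (hy i)

end FunctorBasis

section
variable {I : Type u} (c : I → C)

/-- The direct sum of the functors `R[?, c_i]`. -/
noncomputable def freeOnSum (R : Type) [CommRing R] : Cᵒᵖ ⥤ ModuleCat.{u} R where
  obj d := ModuleCat.of R ((Σ i, d.unop ⟶ c i) →₀ R)
  map φ := ModuleCat.ofHom (Finsupp.lmapDomain R R fun k => ⟨k.1, φ.unop ≫ k.2⟩)
  map_id d := by
    ext : 1
    refine Finsupp.lhom_ext' fun f => LinearMap.ext_ring ?_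
    simp
  map_comp φ ψ := by
    ext : 1
    refine Finsupp.lhom_ext' fun f => LinearMap.ext_ring ?_
    simp

/-- The canonical basis of a direct sum of functors `R[?, c_i]`. -/
noncomputable def freeOnSumBasis (R : Type) [CommRing R] : FunctorBasis (freeOnSum c R) where
  ι := I
  obj := c
  basis d := (Finsupp.basisSingleOne : Module.Basis _ R ((Σ i, d ⟶ c i) →₀ R))
  map_basis {d d'} φ i f := by
    have h : ∀ (e : C) (k : Σ i, e ⟶ c i),
        (Finsupp.basisSingleOne : Module.Basis _ R ((Σ i, e ⟶ c i) →₀ R)) k =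
          Finsupp.single k 1 := fun e k => by simp
    exact (congrArg (Finsupp.mapDomain fun k : Σ i, d ⟶ c i => (⟨k.1, φ ≫ k.2⟩ : Σ i, d' ⟶ c i))
      (h d ⟨i, f⟩)).trans (Finsupp.mapDomain_single.trans (h d' ⟨i, φ ≫ f⟩).symm)

/-- The inclusion of a summand `R[?, c_i]`. -/
noncomputable def freeOnSumι (R : Type) [CommRing R] (i : I) : freeOn R (c i) ⟶ freeOnSum c R :=
  freeOnDesc ((freeOnSumBasis c R).gen i)

theorem freeOnSumι_comp_app {N : Cᵒᵖ ⥤ ModuleCat.{u} R} (i : I) (f : freeOnSum c R ⟶ N) :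
    ((freeOnSumι c R i ≫ f).app (Opposite.op (c i))).hom (Finsupp.single (𝟙 (c i)) (1 : R)) =
      (f.app (Opposite.op (c i))).hom ((freeOnSumBasis c R).gen i) :=
  congrArg (f.app (Opposite.op (c i))).hom
    (freeOnDesc_id (c := c i) ((freeOnSumBasis c R).gen i))

/-- The direct sum of the functors `R[?, c_i]` is their coproduct. -/
noncomputable def freeOnSumIsColimit :
    IsColimit (Cofan.mk (freeOnSum c R) (freeOnSumι c R)) :=
  Cofan.IsColimit.mk _
    (fun s => (freeOnSumBasis c R).desc fun i =>
      ((s.inj i).app (Opposite.op (c i))).hom (Finsupp.single (𝟙 (c i)) (1 : R)))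
    (fun s i => freeOn_hom_ext ((freeOnSumι_comp_app c i _).trans
      ((freeOnSumBasis c R).desc_gen _ i)))
    (fun s m hm => (freeOnSumBasis c R).hom_ext fun i => by
      refine Eq.trans ?_ ((freeOnSumBasis c R).desc_gen _ i).symm
      refine (freeOnSumι_comp_app c i m).symm.trans ?_
      exact congrArg (fun k => (k.app (Opposite.op (c i))).hom (Finsupp.single (𝟙 (c i)) (1 : R)))
        (hm i))

end

theorem IsFreeFunctor.exists_basis {N : Cᵒᵖ ⥤ ModuleCat.{u} R} (h : IsFreeFunctor N) :
    Nonempty (FunctorBasis N) := by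
  obtain ⟨I, c, ⟨e⟩⟩ := h
  exact ⟨(freeOnSumBasis c R).ofIso
    (((freeOnSumIsColimit (R := R) c).coconePointUniqueUpToIso (colimit.isColimit _)) ≪≫ e.symm)⟩

/-- Over a principal ideal domain this makes the values of a free resolution at an object a split
complex. -/
theorem IsFreeFunctor.free {N : Cᵒᵖ ⥤ ModuleCat.{u} R} (h : IsFreeFunctor N) (d : C) :
    Module.Free R (N.obj (Opposite.op d)) := by
  obtain ⟨b⟩ := h.exists_basis
  exact Module.Free.of_basis (b.basis d)

end FreeBasis

/-! ### Bases of products and projectivity of the total complex -/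

section ExtBasis
variable {R : Type} [CommRing R] {G₁ G₂ : Type u} [Group G₁] [Group G₂]
  {F₁ : SubgroupFamily G₁} {F₂ : SubgroupFamily G₂}

/-- Morphisms to a product orbit are pairs of morphisms. -/
def Orb.pairHomEquiv {I J : Type u} (c : I → Orb F₁) (d : J → Orb F₂) (Z : Orb (F₁.prod F₂)) :
    (Σ i, (Orb.fst F₁ F₂).obj Z ⟶ c i) × (Σ j, (Orb.snd F₁ F₂).obj Z ⟶ d j) ≃
      Σ k : I × J, Z ⟶ Orb.pair (c k.1) (d k.2) where
  toFun x := ⟨(x.1.1, x.2.1), Orb.lift x.1.2 x.2.2⟩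
  invFun y := (⟨y.1.1, (Orb.fst F₁ F₂).map y.2 ≫ (Orb.fstIso _ _).hom⟩,
    ⟨y.1.2, (Orb.snd F₁ F₂).map y.2 ≫ (Orb.sndIso _ _).hom⟩)
  left_inv x := congrArg₂ Prod.mk (congrArg (Sigma.mk x.1.1) (Orb.lift_fst x.1.2 x.2.2))
    (congrArg (Sigma.mk x.2.1) (Orb.lift_snd x.1.2 x.2.2))
  right_inv y := congrArg (Sigma.mk y.1) (Orb.pair_hom_ext (Orb.lift_fst _ _) (Orb.lift_snd _ _))

theorem Orb.comp_lift {Z Z' : Orb (F₁.prod F₂)} {X : Orb F₁} {Y : Orb F₂} (φ : Z' ⟶ Z)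
    (f : (Orb.fst F₁ F₂).obj Z ⟶ X) (g : (Orb.snd F₁ F₂).obj Z ⟶ Y) :
    φ ≫ Orb.lift f g = Orb.lift ((Orb.fst F₁ F₂).map φ ≫ f) ((Orb.snd F₁ F₂).map φ ≫ g) := by
  refine Orb.pair_hom_ext ?_ ?_
  · rw [Functor.map_comp, Category.assoc, Orb.lift_fst, Orb.lift_fst]
  · rw [Functor.map_comp, Category.assoc, Orb.lift_snd, Orb.lift_snd]

/-- The product of two bases. -/
noncomputable def FunctorBasis.ext {P : (Orb F₁)ᵒᵖ ⥤ ModuleCat.{u} R}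
    {Q : (Orb F₂)ᵒᵖ ⥤ ModuleCat.{u} R} (b : FunctorBasis P) (b' : FunctorBasis Q) :
    FunctorBasis (((extRight F₁ F₂).obj P).obj Q) where
  ι := b.ι × b'.ι
  obj k := Orb.pair (b.obj k.1) (b'.obj k.2)
  basis Z := ((b.basis ((Orb.fst F₁ F₂).obj Z)).tensorProduct
    (b'.basis ((Orb.snd F₁ F₂).obj Z))).reindex (Orb.pairHomEquiv b.obj b'.obj Z)
  map_basis {Z Z'} φ k f := by
    have e : ∀ (W : Orb (F₁.prod F₂)) x y, (((b.basis ((Orb.fst F₁ F₂).obj W)).tensorProduct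
        (b'.basis ((Orb.snd F₁ F₂).obj W))).reindex (Orb.pairHomEquiv b.obj b'.obj W))
          (Orb.pairHomEquiv b.obj b'.obj W (x, y)) =
        b.basis ((Orb.fst F₁ F₂).obj W) x ⊗ₜ[R] b'.basis ((Orb.snd F₁ F₂).obj W) y :=
      fun W x y => by
        rw [Module.Basis.reindex_apply, Equiv.symm_apply_apply, Module.Basis.tensorProduct_apply]
    -- Quantified over w so that w can be replaced by the image of a pair under `Orb.pairHomEquiv`,
    -- where the reindexed basis element is a pure tensor.
    suffices h : ∀ w : Σ k : b.ι × b'.ι, Z ⟶ Orb.pair (b.obj k.1) (b'.obj k.2),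
        ((((extRight F₁ F₂).obj P).obj Q).map φ.op).hom
          ((((b.basis ((Orb.fst F₁ F₂).obj Z)).tensorProduct
            (b'.basis ((Orb.snd F₁ F₂).obj Z))).reindex (Orb.pairHomEquiv b.obj b'.obj Z)) w) =
        (((b.basis ((Orb.fst F₁ F₂).obj Z')).tensorProduct
          (b'.basis ((Orb.snd F₁ F₂).obj Z'))).reindex (Orb.pairHomEquiv b.obj b'.obj Z'))
            ⟨w.1, φ ≫ w.2⟩ from h ⟨k, f⟩
    intro w
    obtain ⟨⟨x, y⟩, rfl⟩ := (Orb.pairHomEquiv b.obj b'.obj Z).surjective w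
    have h : (⟨(x.1, y.1), φ ≫ Orb.lift x.2 y.2⟩ :
        Σ k : b.ι × b'.ι, Z' ⟶ Orb.pair (b.obj k.1) (b'.obj k.2)) =
        Orb.pairHomEquiv b.obj b'.obj Z' (⟨x.1, (Orb.fst F₁ F₂).map φ ≫ x.2⟩,
          ⟨y.1, (Orb.snd F₁ F₂).map φ ≫ y.2⟩) :=
      congrArg (Sigma.mk _) (Orb.comp_lift φ x.2 y.2)
    refine Eq.trans ?_ (congrArg _ h).symm
    refine (congrArg ((((extRight F₁ F₂).obj P).obj Q).map φ.op).hom (e Z x y)).trans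
      (Eq.trans ?_ (e Z' _ _).symm)
    exact congrArg₂ (· ⊗ₜ[R] ·) (b.map_basis ((Orb.fst F₁ F₂).map φ) x.1 x.2)
      (b'.map_basis ((Orb.snd F₁ F₂).map φ) y.1 y.2)

/-- Each bidegree has a product basis and is projective. Lifts on the finitely many summands are
added up through the decomposition of the identity. -/
theorem projective_extTotal {K : ChainComplex ((Orb F₁)ᵒᵖ ⥤ ModuleCat.{u} R) ℕ}
    {L : ChainComplex ((Orb F₂)ᵒᵖ ⥤ ModuleCat.{u} R) ℕ} (hK : ∀ n, IsFreeFunctor (K.X n))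
    (hL : ∀ n, IsFreeFunctor (L.X n)) (n : ℕ) : Projective ((extTotal K L).X n) where
  factors {E X} f e he := by
    have h : ∀ p q, Projective (((extRight F₁ F₂).obj (K.X p)).obj (L.X q)) := fun p q => by
      obtain ⟨b⟩ := (hK p).exists_basis
      obtain ⟨b'⟩ := (hL q).exists_basis
      exact (b.ext b').projective
    refine ⟨∑ x ∈ (Finset.HasAntidiagonal.antidiagonal n).attach, extProj K L n x.1.1 x.1.2 ≫
      Projective.factorThru (extTotalι K L x.1.1 x.1.2 n
        (Finset.HasAntidiagonal.mem_antidiagonal.mp x.2) ≫ f) e, ?_⟩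
    rw [Preadditive.sum_comp]
    simp only [Category.assoc, Projective.factorThru_comp]
    simp only [← Category.assoc]
    rw [← Preadditive.sum_comp, sum_extProj_extTotalι, Category.id_comp]

end ExtBasis

/-! ### Exactness of total complexes of augmented complexes -/

section Exact
open ChainComplex

/-- Evaluation commutes with homology, and a functor vanishes when all its values do. -/
theorem Function.Exact.of_functor_evaluation {C : Type u} [SmallCategory C] {R : Type} [CommRing R]
    (S : ShortComplex (C ⥤ ModuleCat.{u} R))
    (h : ∀ c, Function.Exact (S.f.app c).hom (S.g.app c).hom) : S.Exact := by
  rw [ShortComplex.exact_iff_isZero_homology]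
  refine Functor.isZero _ fun c => ?_
  refine IsZero.of_iso ?_ (S.mapHomologyIso ((evaluation C (ModuleCat.{u} R)).obj c)).symm
  rw [← ShortComplex.exact_iff_isZero_homology,
    ShortComplex.ShortExact.moduleCat_exact_iff_function_exact]
  exact h c

theorem CategoryTheory.ShortComplex.Exact.evaluation_app {C : Type u} [SmallCategory C] {R : Type}
    [CommRing R] {S : ShortComplex (C ⥤ ModuleCat.{u} R)} (hS : S.Exact) (c : C) :
    Function.Exact (S.f.app c).hom (S.g.app c).hom :=
  (ShortComplex.ShortExact.moduleCat_exact_iff_function_exact _).mp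
    (hS.map ((evaluation C (ModuleCat.{u} R)).obj c))

variable {R : Type} [CommRing R] {A B T : ChainComplex (ModuleCat.{u} R) ℕ}

/-- A linear map on the zeroth module that exhibits a module as the zeroth homology of an
otherwise exact complex. -/
structure IsAugmentation (A : ChainComplex (ModuleCat.{u} R) ℕ) {N : Type u} [AddCommGroup N]
    [Module R N] (ε : A.X 0 →ₗ[R] N) : Prop where
  surjective : Function.Surjective ε
  exact_zero : Function.Exact (A.diff 0) ε
  exact_succ : ∀ n, Function.Exact (A.diff (n + 1)) (A.diff n)

namespace IsAugmentation
variable {N : Type u} [AddCommGroup N] [Module R N] {ε : A.X 0 →ₗ[R] N}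

theorem cls_succ (h : IsAugmentation A ε) (n : ℕ) (z : A.cycles (n + 1)) :
    A.cls (n + 1) z = 0 := by
  obtain ⟨y, hy⟩ := (h.exact_succ n _).mp (diff_cycIncl n z)
  rw [← cycIncl_bdryMap] at hy
  rw [← cycIncl_injective _ hy, cls_bdryMap]

theorem subsingleton (h : IsAugmentation A ε) (n : ℕ) : Subsingleton (A.homology (n + 1)) := by
  refine ⟨fun x y => ?_⟩
  obtain ⟨x, rfl⟩ := cls_surjective (A := A) _ x
  obtain ⟨y, rfl⟩ := cls_surjective (A := A) _ y
  rw [h.cls_succ, h.cls_succ]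

theorem exists_equiv (h : IsAugmentation A ε) :
    ∃ e : A.homology 0 ≃ₗ[R] N, ∀ z, e (A.cls 0 z) = ε (A.cycIncl 0 z) := by
  let f : A.homology 0 →ₗ[R] N := descSurj (A.cls 0) (cls_surjective 0) (ε ∘ₗ A.cycIncl 0)
    fun z hz => by
      obtain ⟨y, rfl⟩ := (exact_bdryMap_cls 0 z).mp hz
      rw [LinearMap.comp_apply, cycIncl_bdryMap]
      exact h.exact_zero.apply_apply_eq_zero y
  have hf : ∀ z, f (A.cls 0 z) = ε (A.cycIncl 0 z) := descSurj_apply _ _ _ _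
  refine ⟨LinearEquiv.ofBijective f ⟨?_, fun y => ?_⟩, hf⟩
  · refine (injective_iff_map_eq_zero f).mpr fun x hx => ?_
    obtain ⟨z, rfl⟩ := cls_surjective (A := A) _ x
    rw [hf] at hx
    obtain ⟨y, hy⟩ := (h.exact_zero _).mp hx
    rw [← cycIncl_bdryMap] at hy
    rw [← cycIncl_injective _ hy, cls_bdryMap]
  · obtain ⟨x, rfl⟩ := h.surjective y
    obtain ⟨z, rfl⟩ := cycIncl_zero_surjective (A := A) x
    exact ⟨_, hf z⟩

/-- The homology is N in degree zero and zero elsewhere. Its flatness removes the Tor obstruction.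
-/
theorem flat_homology (h : IsAugmentation A ε) [Module.Flat R N] (n : ℕ) :
    Module.Flat R (A.homology n) := by
  rcases n with _ | n
  · obtain ⟨e, _⟩ := h.exists_equiv
    exact Module.Flat.of_linearEquiv e
  · have := h.subsingleton n
    infer_instance

end IsAugmentation

namespace TensorTotal
variable (D : TensorTotal A B T) {N N' N'' : Type u} [AddCommGroup N] [Module R N]
  [AddCommGroup N'] [Module R N'] [AddCommGroup N''] [Module R N'']
  {ε : A.X 0 →ₗ[R] N} {ε' : B.X 0 →ₗ[R] N'} {η : T.X 0 →ₗ[R] N''}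

/-- Tensoring with the flat homology of B keeps the inclusion of boundaries into cycles injective,
so the invariant of every cycle vanishes and the cycle is homologous to a sum of products of cycles.
These bound because one factor has positive degree and trivial homology. -/
theorem exact_diff (D : TensorTotal A B T) (hA : A.IsSplit) (hε : IsAugmentation A ε) (hε' : IsAugmentation B ε')
    [Module.Flat R N'] (n : ℕ) : Function.Exact (T.diff (n + 1)) (T.diff n) := by
  refine fun x => ⟨fun hx => ?_, ?_⟩
  · obtain ⟨x, rfl⟩ := (exact_cycIncl_diff n x).mp hx
    obtain ⟨z, t, ht⟩ := D.exists_eq_fam_add_diff hA x fun p q hpq => by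
      have := hε'.flat_homology q
      exact Module.Flat.rTensor_preserves_injective_linearMap (M := B.homology q) _
        (Submodule.subtype_injective (A.bdry p))
        ((D.rTensor_subtype_cls_bdryPart hA (n + 1) p q hpq x).trans (map_zero _).symm)
    obtain ⟨t', ht'⟩ := D.exists_diff_eq_fam (n + 1) z fun p q hpq => by
      have hz : TensorProduct.map (A.cls p) (B.cls q) = 0 := by
        refine TensorProduct.ext' fun a b => ?_
        rw [TensorProduct.map_tmul]
        rcases p with _ | p
        · obtain rfl : q = n + 1 := by omega
          rw [hε'.cls_succ, TensorProduct.tmul_zero]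
          rfl
        · rw [hε.cls_succ, TensorProduct.zero_tmul]
          rfl
      rw [hz]
      rfl
    exact ⟨t' + t, by rw [map_add, ht', ht]⟩
  · rintro ⟨y, rfl⟩
    exact diff_diff n y

/-- In degree zero everything is a product of cycles, and the augmentations identify the zeroth
homologies with N and N'. Injectivity of μ then turns vanishing under η into vanishing of the
product of classes, which therefore bounds. -/
theorem exact_augmentation (hε : IsAugmentation A ε) (hε' : IsAugmentation B ε')
    (μ : N ⊗[R] N' →ₗ[R] N'') (hμ : Function.Injective μ)
    (hη : ∀ t, η (D.inj 0 0 0 t) = μ (TensorProduct.map ε ε' t))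
    (hη₀ : ∀ t, η (T.diff 0 t) = 0) : Function.Exact (T.diff 0) η := by
  refine fun x => ⟨fun hx => ?_, ?_⟩
  · obtain ⟨e, he⟩ := hε.exists_equiv
    obtain ⟨e', he'⟩ := hε'.exists_equiv
    have hs : Function.Surjective (TensorProduct.map (A.cycIncl 0) (B.cycIncl 0)) :=
      TensorProduct.map_surjective cycIncl_zero_surjective cycIncl_zero_surjective
    obtain ⟨z, hz⟩ := hs (D.proj 0 0 0 x)
    let Z : ∀ p q, A.cycles p ⊗[R] B.cycles q := fun p q =>
      match p, q with
      | 0, 0 => z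
      | _, _ => 0
    have hx' : x = D.inj 0 0 0 (TensorProduct.map (A.cycIncl 0) (B.cycIncl 0) z) := by
      refine D.ext' fun p q hpq => ?_
      obtain ⟨rfl, rfl⟩ : p = 0 ∧ q = 0 := by omega
      rw [D.proj_inj 0 0 0 rfl, hz]
    obtain ⟨t, ht⟩ := D.exists_diff_eq_fam 0 Z fun p q hpq => by
      obtain ⟨rfl, rfl⟩ : p = 0 ∧ q = 0 := by omega
      change TensorProduct.map (A.cls 0) (B.cls 0) z = 0
      apply (TensorProduct.congr e e').injective
      rw [map_zero]
      rw [hx', hη] at hx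
      refine Eq.trans ?_ (hμ (hx.trans (map_zero μ).symm))
      change (TensorProduct.map e.toLinearMap e'.toLinearMap ∘ₗ TensorProduct.map (A.cls 0) (B.cls 0)) z =
        (TensorProduct.map ε ε' ∘ₗ TensorProduct.map (A.cycIncl 0) (B.cycIncl 0)) z
      rw [← TensorProduct.map_comp, ← TensorProduct.map_comp]
      congr 2
      · exact LinearMap.ext he
      · exact LinearMap.ext he'
    refine ⟨t, ht.trans (D.ext' fun p q hpq => ?_)⟩
    obtain ⟨rfl, rfl⟩ : p = 0 ∧ q = 0 := by omega
    rw [D.proj_fam 0 0 0 rfl, ← hz]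
    rfl
  · rintro ⟨y, rfl⟩
    exact hη₀ y

end TensorTotal

end Exact

/-! ### The total complex resolves the trivial module -/

section TotalResolution
open ChainComplex

theorem augmentation_eq {R : Type} [CommRing R] {C : Type u} [SmallCategory C]
    {Z : Cᵒᵖ ⥤ ModuleCat.{u} R} (P : ProjectiveResolution Z) : augmentation P = P.π.f 0 := by
  simp [augmentation, ChainComplex.toSingle₀Equiv]
  rfl

theorem epi_augmentation {R : Type} [CommRing R] {C : Type u} [SmallCategory C]
    {Z : Cᵒᵖ ⥤ ModuleCat.{u} R} (P : ProjectiveResolution Z) : Epi (augmentation P) := by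
  rw [augmentation_eq]
  exact (inferInstance : Epi (P.π.f 0))

theorem isAugmentation_evalComplex {R : Type} [CommRing R] {C : Type u} [SmallCategory C]
    {Z : Cᵒᵖ ⥤ ModuleCat.{u} R} (P : ProjectiveResolution Z) (c : C) :
    IsAugmentation (evalComplex P.complex c) ((augmentation P).app (Opposite.op c)).hom where
  surjective := by
    have := epi_augmentation P
    exact (ModuleCat.epi_iff_surjective ((augmentation P).app (Opposite.op c))).mp inferInstance
  exact_zero := by
    have h := P.exact₀.evaluation_app (Opposite.op c)
    rw [augmentation_eq]
    exact h
  exact_succ n := (P.exact_succ n).evaluation_app (Opposite.op c)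

variable {R : Type} [CommRing R] {G₁ G₂ : Type u} [Group G₁] [Group G₂]
  {F₁ : SubgroupFamily G₁} {F₂ : SubgroupFamily G₂}

/-- The multiplication of the values of the trivial modules is injective. -/
theorem trivialMul_app_injective (Z : (Orb (F₁.prod F₂))ᵒᵖ) :
    Function.Injective ((trivialMul R F₁ F₂).app Z).hom := by
  have h : Function.Injective (ULift.moduleEquiv.symm.toLinearMap ∘ₗ LinearMap.mul' R R ∘ₗ
      TensorProduct.map (ULift.moduleEquiv.{_, _, u} (R := R) (M := R)).toLinearMap
        (ULift.moduleEquiv.{_, _, u} (R := R) (M := R)).toLinearMap) := by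
    refine (ULift.moduleEquiv.symm.injective).comp (Function.Injective.comp (g := LinearMap.mul' R R)
      (TensorProduct.lid R R).injective ?_)
    exact (TensorProduct.congr (ULift.moduleEquiv (R := R) (M := R))
      (ULift.moduleEquiv (R := R) (M := R))).injective
  exact h

theorem augProd_app_tmul (P : ProjectiveResolution (trivialModule.{u} R F₁))
    (Q : ProjectiveResolution (trivialModule.{u} R F₂)) (Z : Orb (F₁.prod F₂))
    (t : (P.complex.X 0).obj (Opposite.op ((Orb.fst F₁ F₂).obj Z)) ⊗[R]
      (Q.complex.X 0).obj (Opposite.op ((Orb.snd F₁ F₂).obj Z))) :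
    ((augProd P Q).app (Opposite.op Z)).hom t = ((trivialMul R F₁ F₂).app (Opposite.op Z)).hom
      (TensorProduct.map ((augmentation P).app (Opposite.op ((Orb.fst F₁ F₂).obj Z))).hom
        ((augmentation Q).app (Opposite.op ((Orb.snd F₁ F₂).obj Z))).hom t) := by
  have h : (((augProd P Q).app (Opposite.op Z)).hom :
      (P.complex.X 0).obj (Opposite.op ((Orb.fst F₁ F₂).obj Z)) ⊗[R]
        (Q.complex.X 0).obj (Opposite.op ((Orb.snd F₁ F₂).obj Z)) →ₗ[R] _) =
      (((trivialMul R F₁ F₂).app (Opposite.op Z)).hom :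
        (trivialModule R F₁).obj (Opposite.op ((Orb.fst F₁ F₂).obj Z)) ⊗[R]
          (trivialModule R F₂).obj (Opposite.op ((Orb.snd F₁ F₂).obj Z)) →ₗ[R] _) ∘ₗ
      TensorProduct.map ((augmentation P).app (Opposite.op ((Orb.fst F₁ F₂).obj Z))).hom
        ((augmentation Q).app (Opposite.op ((Orb.snd F₁ F₂).obj Z))).hom :=
    TensorProduct.ext' fun a b => rfl
  exact LinearMap.congr_fun h t

theorem epi_totalAug₀ (P : ProjectiveResolution (trivialModule.{u} R F₁))
    (Q : ProjectiveResolution (trivialModule.{u} R F₂)) : Epi (totalAug₀ P Q) := by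
  have : ∀ Z, Epi ((totalAug₀ P Q).app Z) := fun Z => by
    rw [ModuleCat.epi_iff_surjective]
    rintro ⟨r⟩
    obtain ⟨a, ha⟩ := (isAugmentation_evalComplex P ((Orb.fst F₁ F₂).obj Z.unop)).surjective
      (ULift.up r)
    obtain ⟨b, hb⟩ := (isAugmentation_evalComplex Q ((Orb.snd F₁ F₂).obj Z.unop)).surjective
      (ULift.up 1)
    refine ⟨((extTotalι P.complex Q.complex 0 0 0 rfl).app Z).hom
      (extRightMk (Z := Z.unop) a b), ?_⟩
    have h := congrArg (fun k => (k.app Z).hom (extRightMk (Z := Z.unop) a b))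
      (extTotalι_totalAug₀ P Q)
    refine h.trans ((augProd_app_tmul P Q Z.unop (a ⊗ₜ b)).trans ?_)
    exact (congrArg₂ (fun x y => ((trivialMul R F₁ F₂).app Z).hom (x ⊗ₜ[R] y)) ha hb).trans
      (congrArg ULift.up (mul_one r))
  exact NatTrans.epi_of_epi_app _

/-- The total complex of two free resolutions is a projective resolution. -/
theorem isTotalResolution_of_isFreeResolution [IsDomain R] [IsPrincipalIdealRing R]
    {P : ProjectiveResolution (trivialModule.{u} R F₁)}
    {Q : ProjectiveResolution (trivialModule.{u} R F₂)} (hP : IsFreeResolution P)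
    (hQ : IsFreeResolution Q) : IsTotalResolution P Q where
  projective := projective_extTotal hP hQ
  quasiIso := by
    -- The algebraic total complex is applied at each orbit separately: values of free functors are
    -- free, and those of the trivial module are flat.
    have hA : ∀ X, (evalComplex P.complex X).IsSplit := fun X => isSplit_of_projective fun p =>
      have := (hP p).free X
      inferInstanceAs (Module.Projective R ((P.complex.X p).obj (Opposite.op X)))
    have hflat : ∀ X, Module.Flat R ((trivialModule.{u} R F₂).obj X) := fun X =>
      inferInstanceAs (Module.Flat R (ULift.{u} R))
    have hS : ∀ n, (extTotal P.complex Q.complex).ExactAt (n + 1) := fun n => by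
      rw [HomologicalComplex.exactAt_iff' _ (n + 2) (n + 1) n (by simp) (by simp)]
      exact Function.Exact.of_functor_evaluation _ fun Z =>
        TensorTotal.exact_diff (evalTensorTotal P.complex Q.complex Z.unop) (hA _)
          (isAugmentation_evalComplex P _) (isAugmentation_evalComplex Q _) n
    have := epi_totalAug₀ P Q
    refine ChainComplex.quasiIso_toSingle₀ _ (totalAug₀ P Q) (d_totalAug₀ P Q) ?_ hS
    refine Function.Exact.of_functor_evaluation _ fun Z => ?_
    refine TensorTotal.exact_augmentation (evalTensorTotal P.complex Q.complex Z.unop)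
      (isAugmentation_evalComplex P _) (isAugmentation_evalComplex Q _)
      ((trivialMul R F₁ F₂).app Z).hom (trivialMul_app_injective Z) (fun t => ?_) fun t => ?_
    · have h := congrArg (fun k => (k.app Z).hom t) (extTotalι_totalAug₀ P Q)
      exact (congrArg ((totalAug₀ P Q).app Z).hom
        (evalTensorTotal_inj P.complex Q.complex Z.unop 0 0 0 rfl t)).trans
        (h.trans (augProd_app_tmul P Q Z.unop t))
    · exact congrArg (fun k => (k.app Z).hom t) (d_totalAug₀ P Q)

end TotalResolution

/-! ### The homology cross product of algebraic complexes -/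

section CrossFamily
open ChainComplex

/-- A family indexed by a graph extends to a family of two variables. -/
theorem exists_extend_family {W : ℕ → ℕ → Type*} [∀ p q, Inhabited (W p q)] {m : ℕ} (g : ℕ → ℕ)
    (v : ∀ k : Fin m, W k (g k)) : ∃ t : ∀ p q, W p q, ∀ k : Fin m, t k (g k) = v k := by
  classical
  refine ⟨fun p q => if h : p < m ∧ g p = q then h.2 ▸ v ⟨p, h.1⟩ else default, fun k => ?_⟩
  exact dif_pos (⟨k.2, rfl⟩ : (k : ℕ) < m ∧ g k = g k)

variable {R : Type} [CommRing R] {A B T : ChainComplex (ModuleCat.{u} R) ℕ}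

namespace TensorTotal

/-- The maps `γ k` are given by the cross product of cycles. -/
def IsCrossFamily (D : TensorTotal A B T) (n : ℕ)
    (γ : ∀ k : Fin (n + 1), A.homology k ⊗[R] B.homology (n - k) →ₗ[R] T.homology n) : Prop :=
  ∀ (k : Fin (n + 1)) (z : A.cycles k ⊗[R] B.cycles (n - k)), ∃ x, T.cycIncl n x = D.inj n k (n - k)
      (TensorProduct.map (A.cycIncl k) (B.cycIncl (n - k)) z) ∧
    γ k (TensorProduct.map (A.cls k) (B.cls (n - k)) z) = T.cls n x

variable {D : TensorTotal A B T} {n : ℕ}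
  {γ : ∀ k : Fin (n + 1), A.homology k ⊗[R] B.homology (n - k) →ₗ[R] T.homology n}

/-- Chooses cycle representatives for all tensors at once. The entries off the line p + q = n are
arbitrary, since `cycFam` ignores them. -/
theorem exists_cycFam_lift (t : ∀ k : Fin (n + 1), A.homology k ⊗[R] B.homology (n - k)) :
    ∃ z : ∀ p q, A.cycles p ⊗[R] B.cycles q, ∀ k : Fin (n + 1),
      TensorProduct.map (A.cls k) (B.cls (n - k)) (z k (n - k)) = t k := by
  have h : ∀ k : Fin (n + 1), ∃ z, TensorProduct.map (A.cls k) (B.cls (n - k)) z = t k := fun k =>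
    TensorProduct.map_surjective (cls_surjective (A := A) _) (cls_surjective (A := B) _) (t k)
  choose v hv using h
  have : ∀ p q, Inhabited (A.cycles p ⊗[R] B.cycles q) := fun p q => ⟨0⟩
  obtain ⟨z, hz⟩ := exists_extend_family (W := fun p q => A.cycles p ⊗[R] B.cycles q)
    (fun k => n - k) v
  exact ⟨z, fun k => by rw [hz, hv]⟩

namespace IsCrossFamily

theorem exists_cycle (hγ : D.IsCrossFamily n γ) (z : ∀ p q, A.cycles p ⊗[R] B.cycles q) :
    ∃ x, T.cycIncl n x = D.cycFam n z ∧
      ∑ k, γ k (TensorProduct.map (A.cls k) (B.cls (n - k)) (z k (n - k))) = T.cls n x := by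
  choose x hx hx' using fun k : Fin (n + 1) => hγ k (z k (n - k))
  refine ⟨∑ k, x k, ?_, ?_⟩
  · rw [map_sum, cycFam, fam, Finset.Nat.sum_antidiagonal_eq_sum_range_succ (fun p q =>
      D.inj n p q (TensorProduct.map (A.cycIncl p) (B.cycIncl q) (z p q))), Finset.sum_range]
    exact Finset.sum_congr rfl fun k _ => hx k
  · rw [map_sum]
    exact Finset.sum_congr rfl fun k _ => hx' k

/-- Injectivity of the total cross product: a vanishing sum of cross products means that a sum of
products of cycles bounds, so every product of classes is zero. -/
theorem eq_zero (hγ : D.IsCrossFamily n γ) (h : A.IsSplit ∨ B.IsSplit)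
    (t : ∀ k : Fin (n + 1), A.homology k ⊗[R] B.homology (n - k)) (ht : ∑ k, γ k (t k) = 0)
    (k : Fin (n + 1)) : t k = 0 := by
  obtain ⟨z, hz⟩ := exists_cycFam_lift t
  obtain ⟨x, hx, hx'⟩ := hγ.exists_cycle z
  simp only [hz] at hx'
  obtain ⟨y, rfl⟩ := (exact_bdryMap_cls n x).mp (hx'.symm.trans ht)
  rw [cycIncl_bdryMap] at hx
  rw [← hz, D.map_cls_eq_zero_of_isSplit h n z y hx k (n - k) (by omega)]

theorem cokernelFamily_eq_zero (hγ : D.IsCrossFamily n γ) {W : ℕ → ℕ → ModuleCat.{u} R}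
    {ψ : ∀ p q, T.homology n →ₗ[R] W p q} (hψ : D.IsCokernelFamily n ψ)
    (t : ∀ k : Fin (n + 1), A.homology k ⊗[R] B.homology (n - k)) (p q : ℕ) (h : p + q + 1 = n) :
    ψ p q (∑ k, γ k (t k)) = 0 := by
  obtain ⟨z, hz⟩ := exists_cycFam_lift t
  obtain ⟨x, hx, hx'⟩ := hγ.exists_cycle z
  simp only [hz] at hx'
  rw [hx', hψ.eq_zero x z hx p q h]

/-- Exactness in the middle: a class with trivial Tor components has a representative that differs
from a sum of products of cycles by a boundary. -/
theorem exists_eq_sum (hγ : D.IsCrossFamily n γ) {W : ℕ → ℕ → ModuleCat.{u} R}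
    {ψ : ∀ p q, T.homology n →ₗ[R] W p q} (hψ : D.IsCokernelFamily n ψ) (y : T.homology n)
    (hy : ∀ p q, p + q + 1 = n → ψ p q y = 0) :
    ∃ t : ∀ k : Fin (n + 1), A.homology k ⊗[R] B.homology (n - k), y = ∑ k, γ k (t k) := by
  obtain ⟨x, rfl⟩ := cls_surjective (A := T) n y
  obtain ⟨z, w, hzw⟩ := hψ.exists_eq_add x hy
  obtain ⟨x', hx, hx'⟩ := hγ.exists_cycle z
  refine ⟨_, Eq.trans ?_ hx'.symm⟩
  have e : x = x' + T.bdryMap n w := cycIncl_injective n (by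
    rw [hzw, map_add, hx, cycIncl_bdryMap])
  rw [e, map_add, cls_bdryMap, add_zero]

theorem exists_retraction (hγ : D.IsCrossFamily n γ) (hA : A.IsSplit) (hB : B.IsSplit) :
    ∃ r : ∀ k : Fin (n + 1), T.homology n →ₗ[R] A.homology k ⊗[R] B.homology (n - k),
      ∀ (t : ∀ k : Fin (n + 1), A.homology k ⊗[R] B.homology (n - k)) k, r k (∑ l, γ l (t l)) = t k := by
  obtain ⟨r, hr⟩ := D.exists_retraction hA hB n
  refine ⟨fun k => r k (n - k), fun t k => ?_⟩
  obtain ⟨z, hz⟩ := exists_cycFam_lift t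
  obtain ⟨x, hx, hx'⟩ := hγ.exists_cycle z
  simp only [hz] at hx'
  rw [hx', hr x z hx k (n - k) (by omega), hz]

end IsCrossFamily

end TensorTotal

end CrossFamily

/-! ### The cross product for tensor products over orbit categories -/

section HomologyCross
open ChainComplex
variable {R : Type} [CommRing R] {G₁ G₂ : Type u} [Group G₁] [Group G₂]
  {F₁ : SubgroupFamily G₁} {F₂ : SubgroupFamily G₂}
  (K : ChainComplex ((Orb F₁)ᵒᵖ ⥤ ModuleCat.{u} R) ℕ)
  (L : ChainComplex ((Orb F₂)ᵒᵖ ⥤ ModuleCat.{u} R) ℕ)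
  (M : Orb F₁ ⥤ ModuleCat.{u} R) (M' : Orb F₂ ⥤ ModuleCat.{u} R)

theorem cycIncl_cyclesCross (p q n : ℕ) (h : p + q = n)
    (z : (tensorComplex K M).cycles p ⊗[R] (tensorComplex L M').cycles q) :
    (tensorComplex (extTotal K L) (extLeft F₁ F₂ M M')).cycIncl n
      ((cyclesCross K L M M' p q n h).hom z) =
    (crossTensorTotal K L M M').inj n p q
      (TensorProduct.map ((tensorComplex K M).cycIncl p) ((tensorComplex L M').cycIncl q) z) :=
  (LinearMap.congr_fun (congrArg ModuleCat.Hom.hom (cyclesCross_i K L M M' p q n h)) z).trans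
    (crossTensorTotal_inj K L M M' n p q h _).symm

theorem homologyCrossLin_map_cls (p q n : ℕ) (h : p + q = n)
    (z : (tensorComplex K M).cycles p ⊗[R] (tensorComplex L M').cycles q) :
    homologyCrossLin K L M M' p q n h
      (TensorProduct.map ((tensorComplex K M).cls p) ((tensorComplex L M').cls q) z) =
    (tensorComplex (extTotal K L) (extLeft F₁ F₂ M M')).cls n
      ((cyclesCross K L M M' p q n h).hom z) := by
  suffices e : homologyCrossLin K L M M' p q n h ∘ₗ
      TensorProduct.map ((tensorComplex K M).cls p) ((tensorComplex L M').cls q) =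
      (tensorComplex (extTotal K L) (extLeft F₁ F₂ M M')).cls n ∘ₗ
        (cyclesCross K L M M' p q n h).hom from LinearMap.congr_fun e z
  exact TensorProduct.ext' fun x y => homologyCrossLin_tmul K L M M' p q n h x y

theorem isCrossFamily_homologyCrossLin (n : ℕ) : (crossTensorTotal K L M M').IsCrossFamily n
    fun k : Fin (n + 1) => homologyCrossLin K L M M' k (n - k) n (by omega) := fun k z =>
  ⟨_, cycIncl_cyclesCross K L M M' k (n - k) n (by omega) z,
    homologyCrossLin_map_cls K L M M' k (n - k) n (by omega) z⟩

end HomologyCross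

/-! ### Finite coproducts and invariance of `Tor₁` -/

section Kunneth
open ChainComplex

theorem sum_sigma_π_ι {C : Type*} [Category* C] [Preadditive C] {m : ℕ} (f : Fin m → C)
    [HasCoproduct f] : ∑ k, Sigma.π f k ≫ Sigma.ι f k = 𝟙 (∐ f) := by
  refine Limits.Sigma.hom_ext _ _ fun k => ?_
  rw [Preadditive.comp_sum, Finset.sum_eq_single k]
  · rw [← Category.assoc, Sigma.ι_π_eq_id, Category.id_comp, Category.comp_id]
  · intro j _ hj
    rw [← Category.assoc, Sigma.ι_π_of_ne _ hj.symm, zero_comp]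
  · exact fun h => absurd (Finset.mem_univ _) h

theorem sum_comp_sigma_π {C : Type*} [Category* C] [Preadditive C] {m : ℕ} (f : Fin m → C)
    [HasCoproduct f] {X : C} (g : ∀ k, X ⟶ f k) (k : Fin m) :
    (∑ k, g k ≫ Sigma.ι f k) ≫ Sigma.π f k = g k := by
  rw [Preadditive.sum_comp, Finset.sum_eq_single k]
  · rw [Category.assoc, Sigma.ι_π_eq_id, Category.comp_id]
  · intro j _ hj
    rw [Category.assoc, Sigma.ι_π_of_ne _ hj, comp_zero]
  · exact fun h => absurd (Finset.mem_univ _) h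

variable {R : Type} [CommRing R]

theorem sum_sigma_π_ι_apply {m : ℕ} (f : Fin m → ModuleCat.{u} R) (v : (∐ f : ModuleCat.{u} R)) :
    ∑ k, (Sigma.ι f k).hom ((Sigma.π f k).hom v) = v := by
  have h := congrArg (fun l => l.hom v) (sum_sigma_π_ι f)
  rwa [ModuleCat.hom_sum, LinearMap.sum_apply] at h

/-- Isomorphic functors have isomorphic left derived functors. -/
noncomputable def leftDerivedIso {C D : Type*} [Category* C] [Category* D] [Abelian C]
    [HasProjectiveResolutions C] [Abelian D] {F G : C ⥤ D} [F.Additive] [G.Additive] (e : F ≅ G)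
    (n : ℕ) : F.leftDerived n ≅ G.leftDerived n where
  hom := NatTrans.leftDerived e.hom n
  inv := NatTrans.leftDerived e.inv n
  hom_inv_id := by rw [← NatTrans.leftDerived_comp, e.hom_inv_id, NatTrans.leftDerived_id]
  inv_hom_id := by rw [← NatTrans.leftDerived_comp, e.inv_hom_id, NatTrans.leftDerived_id]

/-- `Tor₁` respects isomorphisms. -/
noncomputable def modTorOneIso {X X' Y Y' : ModuleCat.{u} R} (e : X ≅ X') (e' : Y ≅ Y') :
    modTorOne R X Y ≅ modTorOne R X' Y' :=
  (((modTensor R).flip.obj Y).leftDerived 1).mapIso e ≪≫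
    (leftDerivedIso ((modTensor R).flip.mapIso e') 1).app X'

end Kunneth

/-! ### The exact sequence in Bredon homology -/

section BredonKunneth
open ChainComplex
variable {R : Type} [CommRing R]

/-- The tensor product of two isomorphisms, as a linear equivalence. -/
noncomputable def tensorIsoEquiv {X X' Y Y' : ModuleCat.{u} R} (e : X ≅ X') (e' : Y ≅ Y') :
    X ⊗[R] Y ≃ₗ[R] X' ⊗[R] Y' :=
  TensorProduct.congr e.toLinearEquiv e'.toLinearEquiv

/-- Bredon homology is computed by projective resolutions. -/
noncomputable def bredonIso {G : Type u} [Group G] {F : SubgroupFamily G}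
    (P : ProjectiveResolution (trivialModule.{u} R F)) (M : Orb F ⥤ ModuleCat.{u} R) (n : ℕ) :
    bredonHomology F n M ≅ (tensorComplex P.complex M).homology n :=
  P.isoLeftDerivedObj (tensorOver M) n

variable {G₁ G₂ : Type u} [Group G₁] [Group G₂]
  {F₁ : SubgroupFamily G₁} {F₂ : SubgroupFamily G₂}
  {P : ProjectiveResolution (trivialModule.{u} R F₁)}
  {Q : ProjectiveResolution (trivialModule.{u} R F₂)}
  (M : Orb F₁ ⥤ ModuleCat.{u} R) (M' : Orb F₂ ⥤ ModuleCat.{u} R)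

/-- The Bredon homology of a product is computed by the total complex of resolutions. -/
noncomputable def bredonTotalIso (hT : IsTotalResolution P Q) (n : ℕ) :
    bredonHomology (F₁.prod F₂) n (extLeft F₁ F₂ M M') ≅
      (tensorComplex (extTotal P.complex Q.complex) (extLeft F₁ F₂ M M')).homology n :=
  (totalResolution hT).isoLeftDerivedObj (tensorOver (extLeft F₁ F₂ M M')) n

theorem bredonCross_apply (hT : IsTotalResolution P Q) (p q n : ℕ) (h : p + q = n)
    (t : bredonHomology F₁ p M ⊗[R] bredonHomology F₂ q M') :
    (bredonCross M M' hT p q n h).hom t =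
      (bredonTotalIso M M' hT n).inv.hom
        (homologyCrossLin P.complex Q.complex M M' p q n h
          (tensorIsoEquiv (bredonIso P M p)
            (bredonIso Q M' q) t)) := by
  suffices e : ((bredonCross M M' hT p q n h).hom :
      bredonHomology F₁ p M ⊗[R] bredonHomology F₂ q M' →ₗ[R] _) =
      (bredonTotalIso M M' hT n).inv.hom ∘ₗ
        homologyCrossLin P.complex Q.complex M M' p q n h ∘ₗ
          (tensorIsoEquiv (bredonIso P M p)
            (bredonIso Q M' q)).toLinearMap from LinearMap.congr_fun e t
  exact TensorProduct.ext' fun x y => rfl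

/-- The component of an element of the sum of tensor products, computed by the resolutions. -/
noncomputable def kunnethComponent (P : ProjectiveResolution (trivialModule.{u} R F₁))
    (Q : ProjectiveResolution (trivialModule.{u} R F₂)) (n : ℕ) (k : Fin (n + 1)) :
    kunnethTensor F₁ F₂ M M' n →ₗ[R]
      (tensorComplex P.complex M).homology k ⊗[R] (tensorComplex Q.complex M').homology (n - k) :=
  (tensorIsoEquiv (bredonIso P M k)
    (bredonIso Q M' (n - k))).toLinearMap ∘ₗ
  (Sigma.π (fun k : Fin (n + 1) => ((modTensor R).obj (bredonHomology F₁ k M)).obj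
    (bredonHomology F₂ (n - k) M')) k).hom

/-- The element of the sum of tensor products with given components. -/
noncomputable def kunnethMk (P : ProjectiveResolution (trivialModule.{u} R F₁))
    (Q : ProjectiveResolution (trivialModule.{u} R F₂)) (n : ℕ) (k : Fin (n + 1)) :
    (tensorComplex P.complex M).homology k ⊗[R] (tensorComplex Q.complex M').homology (n - k) →ₗ[R]
      kunnethTensor F₁ F₂ M M' n :=
  (Sigma.ι (fun k : Fin (n + 1) => ((modTensor R).obj (bredonHomology F₁ k M)).obj
    (bredonHomology F₂ (n - k) M')) k).hom ∘ₗ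
  (tensorIsoEquiv (bredonIso P M k)
    (bredonIso Q M' (n - k))).symm.toLinearMap

theorem sum_kunnethMk_kunnethComponent (n : ℕ) (v : kunnethTensor F₁ F₂ M M' n) :
    ∑ k, kunnethMk M M' P Q n k (kunnethComponent M M' P Q n k v) = v := by
  refine (Finset.sum_congr rfl fun k _ => ?_).trans (sum_sigma_π_ι_apply (fun k : Fin (n + 1) =>
    ((modTensor R).obj (bredonHomology F₁ k M)).obj (bredonHomology F₂ (n - k) M')) v)
  exact congrArg (Sigma.ι (fun k : Fin (n + 1) => ((modTensor R).obj (bredonHomology F₁ k M)).obj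
    (bredonHomology F₂ (n - k) M')) k).hom (LinearEquiv.symm_apply_apply _ _)

theorem kunnethCross_kunnethMk (hT : IsTotalResolution P Q) (n : ℕ) (k : Fin (n + 1))
    (t : (tensorComplex P.complex M).homology k ⊗[R]
      (tensorComplex Q.complex M').homology (n - k)) :
    (kunnethCross M M' hT n).hom (kunnethMk M M' P Q n k t) =
      (bredonTotalIso M M' hT n).inv.hom
        (homologyCrossLin P.complex Q.complex M M' k (n - k) n (by omega) t) := by
  have h := congrArg (fun l => l.hom ((tensorIsoEquiv (bredonIso P M k)
    (bredonIso Q M' (n - k))).symm t)) (Sigma.ι_desc (fun k : Fin (n + 1) =>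
      bredonCross M M' hT k (n - k) n (by omega)) k)
  refine h.trans ((bredonCross_apply M M' hT k (n - k) n (by omega) _).trans ?_)
  rw [LinearEquiv.apply_symm_apply]

theorem kunnethCross_apply (hT : IsTotalResolution P Q) (n : ℕ)
    (v : kunnethTensor F₁ F₂ M M' n) :
    (bredonTotalIso M M' hT n).hom.hom
      ((kunnethCross M M' hT n).hom v) =
        ∑ k : Fin (n + 1), homologyCrossLin P.complex Q.complex M M' k (n - k) n (by omega)
          (kunnethComponent M M' P Q n k v) := by
  conv_lhs => rw [← sum_kunnethMk_kunnethComponent (P := P) (Q := Q) M M' n v]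
  rw [map_sum, map_sum]
  refine Finset.sum_congr rfl fun k _ => ?_
  rw [kunnethCross_kunnethMk]
  exact LinearMap.congr_fun (congrArg ModuleCat.Hom.hom
    (bredonTotalIso M M' hT n).inv_hom_id) _

theorem kunnethTor_ext {n : ℕ} {v w : kunnethTor F₁ F₂ M M' n}
    (h : ∀ k, (Sigma.π (fun k : Fin n => modTorOne R (bredonHomology F₁ k M)
      (bredonHomology F₂ (n - k - 1) M')) k).hom v = (Sigma.π (fun k : Fin n => modTorOne R
        (bredonHomology F₁ k M) (bredonHomology F₂ (n - k - 1) M')) k).hom w) : v = w := by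
  have e := sum_sigma_π_ι_apply (fun k : Fin n => modTorOne R (bredonHomology F₁ k M)
    (bredonHomology F₂ (n - k - 1) M'))
  refine (e v).symm.trans (Eq.trans (Finset.sum_congr rfl fun k _ => ?_) (e w))
  exact congrArg _ (h k)

/-- The algebraic theorem for the complexes computed by P and Q, transported along the comparison
with left derived functors. The same β serves the splitting clause. -/
theorem kunneth_shortExact [IsDomain R] [IsPrincipalIdealRing R] (hT : IsTotalResolution P Q)
    (h : (tensorComplex P.complex M).IsSplit ∨ (tensorComplex Q.complex M').IsSplit) (n : ℕ) :
    ∃ (β : bredonHomology (F₁.prod F₂) n (extLeft F₁ F₂ M M') ⟶ kunnethTor F₁ F₂ M M' n)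
      (w : kunnethCross M M' hT n ≫ β = 0),
      (ShortComplex.mk (kunnethCross M M' hT n) β w).ShortExact ∧
      ((tensorComplex P.complex M).IsSplit → (tensorComplex Q.complex M').IsSplit →
        Nonempty (ShortComplex.mk (kunnethCross M M' hT n) β w).Splitting) := by
  have hγ := isCrossFamily_homologyCrossLin P.complex Q.complex M M' n
  obtain ⟨ψ₀, hψ₀⟩ := (crossTensorTotal P.complex Q.complex M M').exists_isCokernelFamily h n
  have hψ := hψ₀.equiv fun p q => (modTorOneIso (bredonIso P M p)
    (bredonIso Q M' q)).symm.toLinearEquiv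
  set ψ := fun p q => (modTorOneIso (bredonIso P M p)
    (bredonIso Q M' q)).symm.toLinearEquiv.toLinearMap ∘ₗ ψ₀ p q
  let e := bredonTotalIso M M' hT n
  let f : Fin n → ModuleCat.{u} R := fun k =>
    modTorOne R (bredonHomology F₁ k M) (bredonHomology F₂ (n - k - 1) M')
  let β : bredonHomology (F₁.prod F₂) n (extLeft F₁ F₂ M M') ⟶ kunnethTor F₁ F₂ M M' n :=
    ∑ k : Fin n, (e.hom ≫ ModuleCat.ofHom (ψ k (n - k - 1))) ≫ Sigma.ι f k
  have hβ : ∀ y k, (Sigma.π f k).hom (β.hom y) = ψ k (n - k - 1) (e.hom.hom y) := by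
    intro y k
    exact congrArg (fun l => l.hom y)
      (sum_comp_sigma_π f (fun k => e.hom ≫ ModuleCat.ofHom (ψ k (n - k - 1))) k)
  have he : ∀ y, e.inv.hom (e.hom.hom y) = y := fun y =>
    LinearMap.congr_fun (congrArg ModuleCat.Hom.hom e.hom_inv_id) y
  have he' : ∀ y, e.hom.hom (e.inv.hom y) = y := fun y =>
    LinearMap.congr_fun (congrArg ModuleCat.Hom.hom e.inv_hom_id) y
  have w : kunnethCross M M' hT n ≫ β = 0 := by
    ext v
    refine kunnethTor_ext M M' fun k => ?_
    refine (hβ ((kunnethCross M M' hT n).hom v) k).trans ?_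
    rw [kunnethCross_apply]
    exact (hγ.cokernelFamily_eq_zero hψ _ k (n - k - 1) (by omega)).trans (map_zero _).symm
  have hinj : Function.Injective (kunnethCross M M' hT n).hom := by
    refine (injective_iff_map_eq_zero _).mpr fun v hv => ?_
    have h₁ := kunnethCross_apply M M' hT n v
    rw [hv, map_zero] at h₁
    rw [← sum_kunnethMk_kunnethComponent (P := P) (Q := Q) M M' n v]
    exact Finset.sum_eq_zero fun k _ => by rw [hγ.eq_zero h _ h₁.symm k, map_zero]
  have hsurj : Function.Surjective β.hom := fun v => by
    have : ∀ p q, Inhabited (modTorOne R (bredonHomology F₁ p M) (bredonHomology F₂ q M')) :=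
      fun p q => ⟨0⟩
    obtain ⟨t, ht⟩ := exists_extend_family
      (W := fun p q => modTorOne R (bredonHomology F₁ p M) (bredonHomology F₂ q M'))
      (fun k => n - k - 1) fun k : Fin n => (Sigma.π f k).hom v
    obtain ⟨y, hy⟩ := hψ.surjective t
    refine ⟨e.inv.hom y, kunnethTor_ext M M' fun k => ?_⟩
    refine (hβ (e.inv.hom y) k).trans ?_
    rw [he']
    exact (hy k (n - k - 1) (by omega)).trans (ht k)
  have hexact : (ShortComplex.mk (kunnethCross M M' hT n) β w).Exact := by
    refine (ShortComplex.moduleCat_exact_iff _).mpr fun y hy => ?_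
    obtain ⟨t, ht⟩ := hγ.exists_eq_sum hψ (e.hom.hom y) fun p q hpq => by
      -- The condition p + q + 1 = n puts every relevant pair on the graph indexing the summands of
      -- `kunnethTor`.
      obtain rfl : q = n - p - 1 := by omega
      have h₁ := hβ y ⟨p, by omega⟩
      exact h₁.symm.trans ((congrArg (Sigma.π f ⟨p, by omega⟩).hom hy).trans (map_zero _))
    refine ⟨∑ k, kunnethMk M M' P Q n k (t k), ?_⟩
    refine (map_sum (kunnethCross M M' hT n).hom _ _).trans ?_
    refine Eq.trans (Finset.sum_congr rfl fun k _ => kunnethCross_kunnethMk M M' hT n k (t k)) ?_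
    refine (map_sum e.inv.hom _ _).symm.trans ?_
    exact (congrArg e.inv.hom ht.symm).trans (he y)
  have hm : Mono (kunnethCross M M' hT n) := (ModuleCat.mono_iff_injective _).mpr hinj
  have hp : Epi β := (ModuleCat.epi_iff_surjective _).mpr hsurj
  refine ⟨β, w, ⟨hexact⟩, fun hA hB => ?_⟩
  obtain ⟨r, hr⟩ := hγ.exists_retraction hA hB
  -- A retraction of the first map suffices: in an exact sequence with epimorphic second map it
  -- determines a splitting.
  let ρ : bredonHomology (F₁.prod F₂) n (extLeft F₁ F₂ M M') ⟶ kunnethTensor F₁ F₂ M M' n :=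
    ModuleCat.ofHom ((∑ k, kunnethMk M M' P Q n k ∘ₗ r k) ∘ₗ e.hom.hom)
  refine ⟨ShortComplex.Splitting.ofExactOfRetraction _ hexact ρ ?_ hp⟩
  ext v
  change (∑ k, kunnethMk M M' P Q n k ∘ₗ r k) (e.hom.hom ((kunnethCross M M' hT n).hom v)) = v
  rw [kunnethCross_apply, LinearMap.sum_apply]
  conv_rhs => rw [← sum_kunnethMk_kunnethComponent (P := P) (Q := Q) M M' n v]
  exact Finset.sum_congr rfl fun k _ => congrArg (kunnethMk M M' P Q n k)
    (hr (fun k => kunnethComponent M M' P Q n k v) k)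

end BredonKunneth

/-! ### Representable functors and their tensor products -/

section FreeOn
variable {R : Type} [CommRing R] {C : Type u} [SmallCategory C]

theorem isFreeFunctor_freeOn (c : C) : IsFreeFunctor (freeOn.{u} R c) :=
  ⟨PUnit, fun _ => c, ⟨(coproductUniqueIso fun _ : PUnit => freeOn.{u} R c).symm⟩⟩

theorem isFreeFunctor_of_isZero {M : Cᵒᵖ ⥤ ModuleCat.{u} R} (h : IsZero M) : IsFreeFunctor M := by
  refine ⟨PEmpty, fun i => i.elim, ⟨h.iso ?_⟩⟩
  rw [IsZero.iff_id_eq_zero]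
  exact Limits.Sigma.hom_ext _ _ fun i => i.elim

/-- The generator of `R[?, c]` given by a morphism `d → c`. -/
noncomputable def freeOnSingle (R : Type) [CommRing R] {c d : C} (φ : d ⟶ c) :
    (freeOn.{u} R c).obj (Opposite.op d) :=
  (Finsupp.single φ (1 : R) : (d ⟶ c) →₀ R)

theorem freeOn_obj_hom_ext {c d : C} {X : Type*} [AddCommGroup X] [Module R X]
    {f g : (freeOn.{u} R c).obj (Opposite.op d) →ₗ[R] X}
    (h : ∀ φ : d ⟶ c, f (freeOnSingle R φ) = g (freeOnSingle R φ)) : f = g :=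
  Finsupp.lhom_ext' (M := R) (R := R) (N := X) (φ := f) (ψ := g)
    fun φ => LinearMap.ext_ring (h φ)

theorem freeOn_map_single {c d d' : C} (ψ : d' ⟶ d) (φ : d ⟶ c) :
    ((freeOn.{u} R c).map ψ.op).hom (freeOnSingle R φ) = freeOnSingle R (ψ ≫ φ) :=
  Finsupp.mapDomain_single (f := fun f => ψ ≫ f)

theorem freeOnDesc_single {c d : C} {M : Cᵒᵖ ⥤ ModuleCat.{u} R} (m : M.obj (Opposite.op c))
    (φ : d ⟶ c) :
    ((freeOnDesc m).app (Opposite.op d)).hom (freeOnSingle R φ) = (M.map φ.op).hom m := by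
  refine (Finsupp.lift_apply _ _ _ _ _).trans ?_
  refine (Finsupp.sum_single_index (a := φ) (b := (1 : R)) ?_).trans (one_smul R _)
  exact zero_smul R _

/-- The map `N(c) → R[?, c] ⊗ N`. -/
noncomputable def freeOnTensorι (c : C) (N : C ⥤ ModuleCat.{u} R) :
    N.obj c →ₗ[R] CoTensor (freeOn R c) N :=
  CoTensor.ι (freeOn R c) N c ∘ₗ
    TensorProduct.mk R ((freeOn R c).obj (Opposite.op c)) (N.obj c) (freeOnSingle R (𝟙 c))

theorem freeOnTensorι_map {c d : C} (N : C ⥤ ModuleCat.{u} R) (φ : d ⟶ c) (n : N.obj d) :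
    freeOnTensorι c N ((N.map φ).hom n) = CoTensor.ι (freeOn R c) N d (freeOnSingle R φ ⊗ₜ[R] n) := by
  refine (CoTensor.ι_rel φ (freeOnSingle R (𝟙 c)) n).symm.trans ?_
  rw [freeOn_map_single, Category.comp_id]

/-- The coend relation moves φ ⊗ n, for φ : d → c, to the identity of c tensor φ_*(n), so the
component at c generates. -/
theorem freeOnTensor_hom_ext {c : C} {N : C ⥤ ModuleCat.{u} R} {X : Type*} [AddCommGroup X]
    [Module R X] {f g : CoTensor (freeOn R c) N →ₗ[R] X}
    (h : ∀ n, f (freeOnTensorι c N n) = g (freeOnTensorι c N n)) : f = g := by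
  refine CoTensor.hom_ext fun d m n => ?_
  refine LinearMap.congr_fun (freeOn_obj_hom_ext
    (f := (f ∘ₗ CoTensor.ι (freeOn R c) N d) ∘ₗ (TensorProduct.mk R _ _).flip n)
    (g := (g ∘ₗ CoTensor.ι (freeOn R c) N d) ∘ₗ (TensorProduct.mk R _ _).flip n) fun φ => ?_) m
  have e := h ((N.map φ).hom n)
  rw [freeOnTensorι_map] at e
  exact e

/-- The map `R[d, c] ⊗ N(d) → N(c)`. -/
noncomputable def freeOnEval (c d : C) (N : C ⥤ ModuleCat.{u} R) :
    (freeOn R c).obj (Opposite.op d) →ₗ[R] N.obj d →ₗ[R] N.obj c :=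
  Finsupp.lift (N.obj d →ₗ[R] N.obj c) R (d ⟶ c) fun φ => (N.map φ).hom

theorem freeOnEval_single {c d : C} (N : C ⥤ ModuleCat.{u} R) (φ : d ⟶ c) :
    freeOnEval c d N (freeOnSingle R φ) = (N.map φ).hom := by
  refine (Finsupp.lift_apply _ _ _ _ _).trans ?_
  refine (Finsupp.sum_single_index (a := φ) (b := (1 : R)) ?_).trans (one_smul R _)
  exact zero_smul R _

/-- The map `R[?, c] ⊗ N → N(c)`. -/
noncomputable def freeOnTensorDesc (c : C) (N : C ⥤ ModuleCat.{u} R) :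
    CoTensor (freeOn R c) N →ₗ[R] N.obj c :=
  CoTensor.desc (fun d => TensorProduct.lift (freeOnEval c d N)) (by
    intro d d' φ m n
    refine LinearMap.congr_fun (freeOn_obj_hom_ext
      (f := (freeOnEval c d N).flip n ∘ₗ ((freeOn R c).map φ.op).hom)
      (g := (freeOnEval c d' N).flip ((N.map φ).hom n)) fun ψ => ?_) m
    rw [LinearMap.comp_apply, freeOn_map_single, LinearMap.flip_apply, LinearMap.flip_apply,
      freeOnEval_single, freeOnEval_single, N.map_comp]
    rfl)

theorem freeOnTensorDesc_ι (c : C) (N : C ⥤ ModuleCat.{u} R) (n : N.obj c) :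
    freeOnTensorDesc c N (freeOnTensorι c N n) = n := by
  refine (CoTensor.desc_ι _ _ _ _).trans ?_
  change freeOnEval c c N (freeOnSingle R (𝟙 c)) n = n
  rw [freeOnEval_single, N.map_id]
  rfl

/-- The Yoneda isomorphism `R[?, c] ⊗ N ≅ N(c)`. -/
noncomputable def freeOnTensorEquiv (c : C) (N : C ⥤ ModuleCat.{u} R) :
    N.obj c ≃ₗ[R] CoTensor (freeOn R c) N :=
  LinearEquiv.ofLinearMap (freeOnTensorι c N) (freeOnTensorDesc c N)
    (freeOnTensor_hom_ext fun n => congrArg (freeOnTensorι c N) (freeOnTensorDesc_ι c N n))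
    (LinearMap.ext (freeOnTensorDesc_ι c N))

theorem map_freeOnTensorι {c : C} {N N' : C ⥤ ModuleCat.{u} R} (f : N ⟶ N') (n : N.obj c) :
    CoTensor.map (𝟙 (freeOn R c)) f (freeOnTensorι c N n) =
      freeOnTensorι c N' ((f.app c).hom n) :=
  CoTensor.map_ι _ _ _ _ _

/-- The endomorphism `t_* - 1` of `R[?, c]` for an endomorphism `t` of `c`. -/
noncomputable def freeOnSubOne (R : Type) [CommRing R] {c : C} (t : c ⟶ c) :
    freeOn.{u} R c ⟶ freeOn.{u} R c :=
  freeOnDesc (freeOnSingle R t - freeOnSingle R (𝟙 c))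

theorem freeOnSubOne_single {c d : C} (t : c ⟶ c) (φ : d ⟶ c) :
    ((freeOnSubOne R t).app (Opposite.op d)).hom (freeOnSingle R φ) =
      freeOnSingle R (φ ≫ t) - freeOnSingle R φ := by
  rw [freeOnSubOne, freeOnDesc_single, map_sub, freeOn_map_single, freeOn_map_single,
    Category.comp_id]

/-- Under the Yoneda isomorphism t_* - 1 becomes t - 1 on the value of N at c. This makes the
homology in the counterexample explicit. -/
theorem map_freeOnSubOne {c : C} (t : c ⟶ c) (N : C ⥤ ModuleCat.{u} R) (n : N.obj c) :
    CoTensor.map (freeOnSubOne R t) (𝟙 N) (freeOnTensorι c N n) =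
      freeOnTensorι c N ((N.map t).hom n - n) := by
  refine (CoTensor.map_ι _ _ _ _ _).trans ?_
  have e := freeOnSubOne_single t (𝟙 c) (R := R)
  rw [Category.id_comp] at e
  rw [map_sub, freeOnTensorι_map]
  refine (congrArg (fun m => CoTensor.ι (freeOn R c) N c (m ⊗ₜ[R] n)) e).trans ?_
  rw [TensorProduct.sub_tmul, map_sub]
  rfl

theorem subsingleton_coTensor {M : Cᵒᵖ ⥤ ModuleCat.{u} R} (h : IsZero M)
    (N : C ⥤ ModuleCat.{u} R) : Subsingleton (CoTensor M N) :=
  ModuleCat.subsingleton_of_isZero ((tensorOver N).map_isZero h)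

end FreeOn

/-! ### The shift on finitely supported functions on the integers -/

section Shift
variable {R : Type*} [CommRing R] {S : Type*}

/-- A finitely supported function on the integers that is invariant under the shift vanishes. -/
theorem injective_shift_sub_one (e : S ≃ ℤ) {σ : S → S}
    (hσ : ∀ s, e (σ s) = e s + 1) {D : (S →₀ R) →ₗ[R] (S →₀ R)}
    (hD : ∀ s, D (Finsupp.single s 1) = Finsupp.single (σ s) 1 - Finsupp.single s 1) :
    Function.Injective D := by
  have hinj : Function.Injective σ := fun s s' h => e.injective (by
    have := hσ s
    rw [h, hσ] at this
    exact (add_right_cancel this).symm)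
  have hD' : D = Finsupp.lmapDomain R R σ - LinearMap.id :=
    Finsupp.lhom_ext' fun s => LinearMap.ext_ring (by simpa using hD s)
  refine (injective_iff_map_eq_zero _).mpr fun x hx => ?_
  have hx' : Finsupp.mapDomain σ x = x := by
    rw [hD', LinearMap.sub_apply, sub_eq_zero] at hx
    exact hx
  have h : ∀ n : ℤ, x (e.symm (n + 1)) = x (e.symm n) := fun n => by
    have : e.symm (n + 1) = σ (e.symm n) := by
      rw [Equiv.symm_apply_eq, hσ, Equiv.apply_symm_apply]
    rw [this]
    conv_lhs => rw [← hx']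
    exact Finsupp.mapDomain_apply hinj _ _
  have h₀ : ∀ n : ℤ, x (e.symm n) = x (e.symm 0) := fun n => by
    induction n using Int.induction_on with
    | zero => rfl
    | succ n ih => rw [h, ih]
    | pred n ih => rw [← ih, ← h, sub_add_cancel]
  -- A shift-invariant function is constant; having finite support on an infinite set, it vanishes.
  have : Infinite S := Infinite.of_injective e.symm e.symm.injective
  obtain ⟨s, hs⟩ := Infinite.exists_notMem_finset x.support
  rw [Finsupp.notMem_support_iff] at hs
  ext s'
  rw [← e.symm_apply_apply s', h₀, ← h₀ (e s), e.symm_apply_apply, hs]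
  rfl

/-- A finitely supported function on the integers of sum zero is a difference of a shift. -/
theorem exact_shift_sub_one (e : S ≃ ℤ) {σ : S → S}
    (hσ : ∀ s, e (σ s) = e s + 1) {D : (S →₀ R) →ₗ[R] (S →₀ R)}
    (hD : ∀ s, D (Finsupp.single s 1) = Finsupp.single (σ s) 1 - Finsupp.single s 1)
    {X : Type*} [AddCommGroup X] [Module R X] {ε : (S →₀ R) →ₗ[R] X}
    {v : X} (hv : ∀ r : R, r • v = 0 → r = 0) (hε : ∀ s, ε (Finsupp.single s 1) = v) :
    Function.Exact D ε := by
  -- Telescoping in both directions: all generators agree with the one at 0 modulo the range of D.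
  have key : ∀ n : ℤ, Finsupp.single (e.symm n) (1 : R) - Finsupp.single (e.symm 0) 1 ∈
      LinearMap.range D := fun n => by
    have hs : ∀ n : ℤ, Finsupp.single (e.symm (n + 1)) (1 : R) - Finsupp.single (e.symm n) 1 ∈
        LinearMap.range D := fun n => by
      have : e.symm (n + 1) = σ (e.symm n) := by
        rw [Equiv.symm_apply_eq, hσ, Equiv.apply_symm_apply]
      exact ⟨_, this ▸ hD (e.symm n)⟩
    induction n using Int.induction_on with
    | zero => simp
    | succ n ih =>
      have := add_mem (hs n) ih
      rwa [sub_add_sub_cancel] at this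
    | pred n ih =>
      have := sub_mem ih (hs (-n - 1))
      rw [sub_add_cancel] at this
      rwa [sub_sub_sub_cancel_left] at this
  have hε' : ∀ x, ε x = (Finsupp.lsum R fun _ : S => LinearMap.id (R := R)) x • v := fun x => by
    refine LinearMap.congr_fun (g := LinearMap.toSpanSingleton R X v ∘ₗ
      Finsupp.lsum R fun _ : S => LinearMap.id (R := R)) (Finsupp.lhom_ext' fun s =>
        LinearMap.ext_ring ?_) x
    simp [hε]
  -- Modulo the range of D a function is its coefficient sum times one generator. As v has trivial
  -- annihilator, ε x = 0 forces this sum to be zero.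
  have h₀ : ∀ x, x - (Finsupp.lsum R fun _ : S => LinearMap.id (R := R)) x •
      Finsupp.single (e.symm 0) (1 : R) ∈ LinearMap.range D := fun x => by
    induction x using Finsupp.induction_linear with
    | zero => simp
    | add x y hx hy =>
      rw [map_add, add_smul, add_sub_add_comm]
      exact add_mem hx hy
    | single s r =>
      have := Submodule.smul_mem _ r (key (e s))
      rw [e.symm_apply_apply, smul_sub] at this
      simpa using this
  intro x
  constructor
  · intro hx
    have := h₀ x
    rw [hε'] at hx
    rwa [hv _ hx, zero_smul, sub_zero] at this
  · rintro ⟨y, rfl⟩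
    refine LinearMap.congr_fun (g := 0) (f := ε ∘ₗ D) (Finsupp.lhom_ext' fun s =>
        LinearMap.ext_ring ?_) y
    simp [hD, hε]

end Shift

/-! ### A free resolution of length one of the constant functor -/

section Resolution
variable {R : Type} [CommRing R] {C : Type u} [SmallCategory C] {c : C}

/-- The augmentation `R[?, c] → R` to the constant functor. -/
noncomputable def freeOnAug (R : Type) [CommRing R] (c : C) :
    freeOn.{u} R c ⟶ (Functor.const Cᵒᵖ).obj (ModuleCat.of R (ULift.{u} R)) :=
  freeOnDesc (c := c) (M := (Functor.const Cᵒᵖ).obj (ModuleCat.of R (ULift.{u} R)))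
    (ULift.up (1 : R))

theorem freeOnAug_single {d : C} (φ : d ⟶ c) :
    ((freeOnAug R c).app (Opposite.op d)).hom (freeOnSingle R φ) = (ULift.up 1 : ULift.{u} R) :=
  freeOnDesc_single (M := (Functor.const Cᵒᵖ).obj (ModuleCat.of R (ULift.{u} R))) _ φ

theorem freeOnSubOne_aug (t : c ⟶ c) : freeOnSubOne R t ≫ freeOnAug R c = 0 := by
  refine freeOn_hom_ext ?_
  refine (congrArg ((freeOnAug R c).app (Opposite.op c)).hom
    (freeOnSubOne_single t (𝟙 c) (R := R))).trans ?_
  rw [map_sub, freeOnAug_single, freeOnAug_single, sub_self]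
  rfl

/-- At every object the morphisms to c form a copy of ℤ on which composition with t is translation
by one, so the sequence is pointwise that of the shift minus the identity followed by the
coefficient sum. -/
theorem shortExact_freeOnSubOne (t : c ⟶ c) (e : ∀ d, (d ⟶ c) ≃ ℤ)
    (he : ∀ d (φ : d ⟶ c), e d (φ ≫ t) = e d φ + 1) :
    (ShortComplex.mk (freeOnSubOne R t) (freeOnAug R c) (freeOnSubOne_aug t)).ShortExact where
  exact := Function.Exact.of_functor_evaluation _ fun d =>
    exact_shift_sub_one (S := d.unop ⟶ c) (e d.unop) (he d.unop) (freeOnSubOne_single t)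
      (v := (ULift.up 1 : ULift.{u} R)) (fun r hr => by simpa using congrArg ULift.down hr)
      freeOnAug_single
  mono_f := by
    have : ∀ d, Mono ((freeOnSubOne R t).app d) := fun d =>
      (ModuleCat.mono_iff_injective _).mpr (injective_shift_sub_one (S := d.unop ⟶ c) (e d.unop)
        (he d.unop) (freeOnSubOne_single t))
    exact NatTrans.mono_of_mono_app _
  epi_g := by
    have : ∀ d, Epi ((freeOnAug R c).app d) := fun d => by
      refine (ModuleCat.epi_iff_surjective _).mpr fun r => ?_
      refine ⟨(ULift.down r : R) • freeOnSingle R ((e d.unop).symm 0), ?_⟩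
      refine (map_smul _ _ _).trans ?_
      refine (congrArg (fun v => (ULift.down r : R) • v) (freeOnAug_single _)).trans ?_
      exact ULift.ext _ _ (mul_one _)
    exact NatTrans.epi_of_epi_app _

/-- The resolution `0 → R[?, c] → R[?, c] → R → 0` of the constant functor. -/
noncomputable def cyclicResolution (R : Type) [CommRing R] (t : c ⟶ c) (e : ∀ d, (d ⟶ c) ≃ ℤ)
    (he : ∀ d (φ : d ⟶ c), e d (φ ≫ t) = e d φ + 1) :
    ProjectiveResolution ((Functor.const Cᵒᵖ).obj (ModuleCat.of R (ULift.{u} R))) :=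
  twoTermResolution (freeOnSubOne R t) (freeOnAug R c) (freeOnSubOne_aug t)
    (shortExact_freeOnSubOne t e he)

theorem isFreeResolution_cyclicResolution (t : c ⟶ c) (e : ∀ d, (d ⟶ c) ≃ ℤ)
    (he : ∀ d (φ : d ⟶ c), e d (φ ≫ t) = e d φ + 1) :
    IsFreeResolution (cyclicResolution R t e he)
  | 0 => isFreeFunctor_freeOn c
  | 1 => isFreeFunctor_freeOn c
  | _ + 2 => isFreeFunctor_of_isZero (isZero_zero _)

theorem subsingleton_twoTerm_coTensor (j : freeOn.{u} R c ⟶ freeOn R c) (N : C ⥤ ModuleCat.{u} R)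
    (n : ℕ) : Subsingleton (CoTensor ((twoTerm j).X (n + 2)) N) :=
  subsingleton_coTensor (isZero_zero _) N

theorem isFreeComplex_twoTerm (j : freeOn.{u} R c ⟶ freeOn R c) (N : C ⥤ ModuleCat.{u} R)
    (hN : Module.Free R (N.obj c)) : IsFreeComplex (tensorComplex (twoTerm j) N)
  | 0 => Module.Free.of_equiv (freeOnTensorEquiv c N)
  | 1 => Module.Free.of_equiv (freeOnTensorEquiv c N)
  | n + 2 =>
    have : Subsingleton ((tensorComplex (twoTerm j) N).X (n + 2)) :=
      subsingleton_twoTerm_coTensor j N n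
    Module.Free.of_subsingleton R _

end Resolution

/-! ### Naturality in the coefficients and explicit products in low degrees -/

section CoefficientNaturality
variable {R : Type} [CommRing R] {G₁ G₂ : Type u} [Group G₁] [Group G₂]
  {F₁ : SubgroupFamily G₁} {F₂ : SubgroupFamily G₂}

theorem cross_natural_coefficients (P : (Orb F₁)ᵒᵖ ⥤ ModuleCat.{u} R)
    (Q : (Orb F₂)ᵒᵖ ⥤ ModuleCat.{u} R) {M N : Orb F₁ ⥤ ModuleCat.{u} R}
    {M' N' : Orb F₂ ⥤ ModuleCat.{u} R} (f : M ⟶ N) (f' : M' ⟶ N')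
    (x : CoTensor P M) (y : CoTensor Q M') :
    CoTensor.map (𝟙 _) (extLeftMap F₁ F₂ f f') (cross P Q M M' (x ⊗ₜ[R] y)) =
      cross P Q N N' (CoTensor.map (𝟙 P) f x ⊗ₜ[R] CoTensor.map (𝟙 Q) f' y) := by
  suffices h : CoTensor.map (𝟙 _) (extLeftMap F₁ F₂ f f') ∘ₗ cross P Q M M' =
      cross P Q N N' ∘ₗ TensorProduct.map (CoTensor.map (𝟙 P) f) (CoTensor.map (𝟙 Q) f') from
    LinearMap.congr_fun h (x ⊗ₜ[R] y)
  refine cross_ext fun X Y a m b m' => ?_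
  have hf : (f.app _).hom ((M.map (Orb.fstIso X Y).inv).hom m) =
      (N.map (Orb.fstIso X Y).inv).hom ((f.app _).hom m) :=
    congrArg (fun k => k.hom m) (f.naturality (Orb.fstIso X Y).inv)
  have hf' : (f'.app _).hom ((M'.map (Orb.sndIso X Y).inv).hom m') =
      (N'.map (Orb.sndIso X Y).inv).hom ((f'.app _).hom m') :=
    congrArg (fun k => k.hom m') (f'.naturality (Orb.sndIso X Y).inv)
  rw [LinearMap.comp_apply, cross_ι, crossAt_tmul, LinearMap.comp_apply, TensorProduct.map_tmul,
    CoTensor.map_ι, CoTensor.map_ι, CoTensor.map_ι, cross_ι, crossAt_tmul]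
  refine congrArg _ (congrArg₂ (fun a b => a ⊗ₜ[R] b) rfl ?_)
  exact congrArg₂ extLeftMk hf hf'

theorem CoTensor.map_map_coefficients {C : Type u} [SmallCategory C]
    {P P' : Cᵒᵖ ⥤ ModuleCat.{u} R} {M N : C ⥤ ModuleCat.{u} R} (g : P ⟶ P') (f : M ⟶ N)
    (x : CoTensor P M) : CoTensor.map (𝟙 P') f (CoTensor.map g (𝟙 M) x) =
      CoTensor.map g (𝟙 N) (CoTensor.map (𝟙 P) f x) :=
  congrArg (fun k => k.hom x) ((tensorOverMap f).naturality g)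

theorem chainCross_natural_coefficients (K : ChainComplex ((Orb F₁)ᵒᵖ ⥤ ModuleCat.{u} R) ℕ)
    (L : ChainComplex ((Orb F₂)ᵒᵖ ⥤ ModuleCat.{u} R) ℕ) {M N : Orb F₁ ⥤ ModuleCat.{u} R}
    {M' N' : Orb F₂ ⥤ ModuleCat.{u} R} (f : M ⟶ N) (f' : M' ⟶ N') (p q n : ℕ) (h : p + q = n)
    (x : CoTensor (K.X p) M) (y : CoTensor (L.X q) M') :
    CoTensor.map (𝟙 _) (extLeftMap F₁ F₂ f f') (chainCross K L M M' p q n h (x ⊗ₜ[R] y)) =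
      chainCross K L N N' p q n h
        (CoTensor.map (𝟙 _) f x ⊗ₜ[R] CoTensor.map (𝟙 _) f' y) := by
  refine (CoTensor.map_map_coefficients _ _ _).trans ?_
  exact congrArg (CoTensor.map (extTotalι K L p q n h) (𝟙 _))
    (cross_natural_coefficients _ _ f f' x y)

variable {K : ChainComplex ((Orb F₁)ᵒᵖ ⥤ ModuleCat.{u} R) ℕ}
  {L : ChainComplex ((Orb F₂)ᵒᵖ ⥤ ModuleCat.{u} R) ℕ}
  {M : Orb F₁ ⥤ ModuleCat.{u} R} {M' : Orb F₂ ⥤ ModuleCat.{u} R}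

theorem d_chainCross_one_zero (x : CoTensor (K.X 1) M) (y : CoTensor (L.X 0) M') :
    CoTensor.map ((extTotal K L).d 1 0) (𝟙 _) (chainCross K L M M' 1 0 1 rfl (x ⊗ₜ[R] y)) =
      chainCross K L M M' 0 0 0 rfl (CoTensor.map (K.d 1 0) (𝟙 M) x ⊗ₜ[R] y) := by
  rw [extTotal_d_apply, chainCross_D₁ 0 0 1 0 rfl rfl,
    chainCross_D₂_eq_zero 1 0 1 0 rfl x y (fun q' h => absurd h (Nat.succ_ne_zero q'))]
  exact (add_zero _).trans (one_smul _ _)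

theorem d_chainCross_zero_one (x : CoTensor (K.X 0) M) (y : CoTensor (L.X 1) M') :
    CoTensor.map ((extTotal K L).d 1 0) (𝟙 _) (chainCross K L M M' 0 1 1 rfl (x ⊗ₜ[R] y)) =
      chainCross K L M M' 0 0 0 rfl (x ⊗ₜ[R] CoTensor.map (L.d 1 0) (𝟙 M') y) := by
  rw [extTotal_d_apply, chainCross_D₂ 0 0 1 0 rfl rfl,
    chainCross_D₁_eq_zero 0 1 1 0 rfl x y (fun p' h => absurd h (Nat.succ_ne_zero p'))]
  exact (zero_add _).trans (one_smul _ _)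

/-- Among the low-degree formulas, only here does a sign -1 of the total complex occur. -/
theorem d_chainCross_one_one (x : CoTensor (K.X 1) M) (y : CoTensor (L.X 1) M') :
    CoTensor.map ((extTotal K L).d 2 1) (𝟙 _) (chainCross K L M M' 1 1 2 rfl (x ⊗ₜ[R] y)) =
      chainCross K L M M' 0 1 1 rfl (CoTensor.map (K.d 1 0) (𝟙 M) x ⊗ₜ[R] y) -
        chainCross K L M M' 1 0 1 rfl (x ⊗ₜ[R] CoTensor.map (L.d 1 0) (𝟙 M') y) := by
  rw [extTotal_d_apply, chainCross_D₁ 0 1 2 1 rfl rfl, chainCross_D₂ 1 0 2 1 rfl rfl, sub_eq_add_neg]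
  refine congrArg₂ (· + ·) (one_smul _ _) ?_
  exact (Units.neg_smul 1 _).trans (congrArg Neg.neg (one_smul _ _))

theorem exists_cycles_eq_of_d_one_zero (A : ChainComplex (ModuleCat.{u} R) ℕ) (x : A.X 1)
    (hx : (A.d 1 0).hom x = 0) : ∃ z, (A.iCycles 1).hom z = x :=
  (A.exact_cycIncl_diff 0 x).mp hx

/-- Let `d a₁ = k a₀` and `d b₁ = k b₀`. A morphism of coefficients that sends `a₀` to a boundary
`d e₁` sends the class of the cycle `a₁ × b₀ - a₀ × b₁` to the cross product of the classes of
`f a₁ - k e₁` and `b₀`. -/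
theorem exists_homologyMap_eq_cross {N : Orb F₁ ⥤ ModuleCat.{u} R} (f : M ⟶ N) (k : R)
    {a₁ : CoTensor (K.X 1) M} {a₀ : CoTensor (K.X 0) M} {b₁ : CoTensor (L.X 1) M'}
    {b₀ : CoTensor (L.X 0) M'} {e₁ : CoTensor (K.X 1) N}
    (ha : CoTensor.map (K.d 1 0) (𝟙 M) a₁ = k • a₀) (hb : CoTensor.map (L.d 1 0) (𝟙 M') b₁ = k • b₀)
    (he : CoTensor.map (K.d 1 0) (𝟙 N) e₁ = CoTensor.map (𝟙 _) f a₀)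
    (c : (tensorComplex K N).cycles 1) (b : (tensorComplex L M').cycles 0)
    (hc : ((tensorComplex K N).iCycles 1).hom c = CoTensor.map (𝟙 _) f a₁ - k • e₁)
    (hb' : ((tensorComplex L M').iCycles 0).hom b = b₀) :
    ∃ X, (HomologicalComplex.homologyMap ((NatTrans.mapHomologicalComplex
      (tensorOverMap (extLeftMap F₁ F₂ f (𝟙 M'))) (ComplexShape.down ℕ)).app (extTotal K L)) 1).hom X =
      homologyCrossLin K L N M' 1 0 1 rfl
        (((tensorComplex K N).homologyπ 1).hom c ⊗ₜ[R] ((tensorComplex L M').homologyπ 0).hom b) := by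
  -- This is a cycle because k a₀ × b₀ = a₀ × k b₀; it represents a class of Tor type.
  set x := chainCross K L M M' 1 0 1 rfl (a₁ ⊗ₜ[R] b₀) -
    chainCross K L M M' 0 1 1 rfl (a₀ ⊗ₜ[R] b₁) with hx
  set Φ := (NatTrans.mapHomologicalComplex
      (tensorOverMap (extLeftMap F₁ F₂ f (𝟙 M'))) (ComplexShape.down ℕ)).app (extTotal K L)
  obtain ⟨z, hz⟩ := exists_cycles_eq_of_d_one_zero
    (tensorComplex (extTotal K L) (extLeft F₁ F₂ M M')) x (by
      change CoTensor.map ((extTotal K L).d 1 0) (𝟙 _) x = 0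
      rw [hx, map_sub, d_chainCross_one_zero, d_chainCross_zero_one, ha, hb, TensorProduct.smul_tmul,
        sub_self])
  refine ⟨((tensorComplex (extTotal K L) (extLeft F₁ F₂ M M')).homologyπ 1).hom z, ?_⟩
  rw [homologyCrossLin_tmul]
  have e₁' : (HomologicalComplex.homologyMap Φ 1).hom
      (((tensorComplex (extTotal K L) (extLeft F₁ F₂ M M')).homologyπ 1).hom z) =
      ((tensorComplex (extTotal K L) (extLeft F₁ F₂ N M')).homologyπ 1).hom
        ((HomologicalComplex.cyclesMap Φ 1).hom z) :=
    congrArg (fun l => l.hom z) (HomologicalComplex.homologyπ_naturality Φ 1)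
  rw [e₁', ← sub_eq_zero]
  refine ((map_sub ((tensorComplex (extTotal K L) (extLeft F₁ F₂ N M')).homologyπ 1).hom _
    ((cyclesCross K L N M' 1 0 1 rfl).hom (c ⊗ₜ[R] b))).symm).trans ?_
  -- The boundary of -(e₁ × b₁) is k e₁ × b₀ - f a₀ × b₁, which is the image of x minus (f a₁ - k
  -- e₁) × b₀.
  refine homologyπ_eq_zero_of_exists _ _ _ (-chainCross K L N M' 1 1 2 rfl (e₁ ⊗ₜ[R] b₁)) ?_
  have e₂ : ((tensorComplex (extTotal K L) (extLeft F₁ F₂ N M')).iCycles 1).hom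
      ((HomologicalComplex.cyclesMap Φ 1).hom z) = CoTensor.map (𝟙 _) (extLeftMap F₁ F₂ f (𝟙 M')) x :=
    (congrArg (fun l => l.hom z) (HomologicalComplex.cyclesMap_i Φ 1)).trans
      (congrArg (CoTensor.map (𝟙 _) (extLeftMap F₁ F₂ f (𝟙 M'))) hz)
  have e₃ : ((tensorComplex (extTotal K L) (extLeft F₁ F₂ N M')).iCycles 1).hom
      ((cyclesCross K L N M' 1 0 1 rfl).hom (c ⊗ₜ[R] b)) =
      chainCross K L N M' 1 0 1 rfl ((CoTensor.map (𝟙 _) f a₁ - k • e₁) ⊗ₜ[R] b₀) := by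
    refine (congrArg (fun l => l.hom (c ⊗ₜ[R] b)) (cyclesCross_i K L N M' 1 0 1 rfl)).trans ?_
    exact (chainCrossOfCycles_tmul K L N M' 1 0 1 rfl c b).trans
      (congrArg₂ (fun s t => chainCross K L N M' 1 0 1 rfl (s ⊗ₜ[R] t)) hc hb')
  refine Eq.trans ?_ ((congrArg₂ (· - ·) e₂ e₃).symm.trans
    (map_sub ((tensorComplex (extTotal K L) (extLeft F₁ F₂ N M')).iCycles 1).hom _ _).symm)
  change CoTensor.map ((extTotal K L).d 2 1) (𝟙 _) _ = _
  have hid : ∀ (q : ℕ) (y : CoTensor (L.X q) M'), CoTensor.map (𝟙 (L.X q)) (𝟙 M') y = y := fun q y =>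
    congrArg (fun l => l.hom y) ((tensorOver M').map_id (L.X q))
  rw [map_neg, d_chainCross_one_one, he, hb, hx, map_sub, chainCross_natural_coefficients,
    chainCross_natural_coefficients, hid, hid, TensorProduct.sub_tmul, map_sub,
    TensorProduct.tmul_smul, TensorProduct.smul_tmul']
  abel

end CoefficientNaturality

/-! ### The obstruction to a natural left inverse -/

section Obstruction
variable {R : Type} [CommRing R] {G₁ G₂ : Type u} [Group G₁] [Group G₂]
  {F₁ : SubgroupFamily G₁} {F₂ : SubgroupFamily G₂}
  {P : ProjectiveResolution (trivialModule.{u} R F₁)}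
  {Q : ProjectiveResolution (trivialModule.{u} R F₂)}
  {M N : Orb F₁ ⥤ ModuleCat.{u} R} {M' : Orb F₂ ⥤ ModuleCat.{u} R}

theorem kunnethComponent_kunnethMk (n : ℕ) (k : Fin (n + 1))
    (t : (tensorComplex P.complex M).homology k ⊗[R]
      (tensorComplex Q.complex M').homology (n - k)) :
    kunnethComponent M M' P Q n k (kunnethMk M M' P Q n k t) = t := by
  have h := congrArg (fun l => l.hom ((tensorIsoEquiv (bredonIso P M k)
    (bredonIso Q M' (n - k))).symm t)) (Sigma.ι_π_eq_id (fun k : Fin (n + 1) =>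
      ((modTensor R).obj (bredonHomology F₁ k M)).obj (bredonHomology F₂ (n - k) M')) k)
  exact (congrArg (tensorIsoEquiv (bredonIso P M k) (bredonIso Q M' (n - k))) h).trans
    (LinearEquiv.apply_symm_apply _ _)

/-- Each of the two summands in total degree one contains a first homology group as a factor. -/
theorem kunnethTensor_one_eq_zero (h : ∀ x : (tensorComplex P.complex M).homology 1, x = 0)
    (h' : ∀ x : (tensorComplex Q.complex M').homology 1, x = 0)
    (v : kunnethTensor F₁ F₂ M M' 1) : v = 0 := by
  rw [← sum_kunnethMk_kunnethComponent (P := P) (Q := Q) M M' 1 v]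
  refine Finset.sum_eq_zero fun k _ => ?_
  refine (congrArg (kunnethMk M M' P Q 1 k) ?_).trans (map_zero _)
  refine TensorProduct.induction_on (motive := fun t => t = 0)
    (kunnethComponent M M' P Q 1 k v) rfl (fun x y => ?_) fun x y hx hy => by rw [hx, hy, add_zero]
  fin_cases k
  · exact (congrArg (fun y => x ⊗ₜ[R] y) (h' y)).trans (TensorProduct.tmul_zero _ _)
  · exact (congrArg (fun x => x ⊗ₜ[R] y) (h x)).trans (TensorProduct.zero_tmul _ _)

theorem bredonHomologyMap_bredonTotalIso (hT : IsTotalResolution P Q) (f : M ⟶ N) (n : ℕ)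
    (X : (tensorComplex (extTotal P.complex Q.complex) (extLeft F₁ F₂ M M')).homology n) :
    (bredonHomologyMap (F₁.prod F₂) n (extLeftMap F₁ F₂ f (𝟙 M'))).hom
      ((bredonTotalIso M M' hT n).inv.hom X) =
    (bredonTotalIso N M' hT n).inv.hom
      ((HomologicalComplex.homologyMap ((NatTrans.mapHomologicalComplex
        (tensorOverMap (extLeftMap F₁ F₂ f (𝟙 M'))) (ComplexShape.down ℕ)).app
          (extTotal P.complex Q.complex)) n).hom X) := by
  have h := ProjectiveResolution.leftDerived_app_eq (tensorOverMap (extLeftMap F₁ F₂ f (𝟙 M')))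
    (totalResolution hT) n
  have h' : (bredonTotalIso M M' hT n).inv ≫
      bredonHomologyMap (F₁.prod F₂) n (extLeftMap F₁ F₂ f (𝟙 M')) = _ :=
    (Iso.inv_comp_eq _).mpr h
  exact congrArg (fun l => l.hom X) h'

/-- If the homology cross product has left inverses compatible with a morphism of coefficients, and
the sum of the tensor products for the source vanishes, then every element of a summand whose cross
product comes from the source vanishes. -/
theorem eq_zero_of_natural_retraction (hT : IsTotalResolution P Q) (f : M ⟶ N) (n : ℕ)
    {r : bredonHomology (F₁.prod F₂) n (extLeft F₁ F₂ M M') ⟶ kunnethTensor F₁ F₂ M M' n}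
    {s : bredonHomology (F₁.prod F₂) n (extLeft F₁ F₂ N M') ⟶ kunnethTensor F₁ F₂ N M' n}
    (hs : kunnethCross N M' hT n ≫ s = 𝟙 _)
    (hrs : r ≫ kunnethTensorMap f (𝟙 M') n =
      bredonHomologyMap (F₁.prod F₂) n (extLeftMap F₁ F₂ f (𝟙 M')) ≫ s)
    (hM : ∀ v : kunnethTensor F₁ F₂ M M' n, v = 0) (k : Fin (n + 1))
    (t : (tensorComplex P.complex N).homology k ⊗[R]
      (tensorComplex Q.complex M').homology (n - k))
    (X : (tensorComplex (extTotal P.complex Q.complex) (extLeft F₁ F₂ M M')).homology n)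
    (hX : (HomologicalComplex.homologyMap ((NatTrans.mapHomologicalComplex
        (tensorOverMap (extLeftMap F₁ F₂ f (𝟙 M'))) (ComplexShape.down ℕ)).app
          (extTotal P.complex Q.complex)) n).hom X =
      homologyCrossLin P.complex Q.complex N M' k (n - k) n (by omega) t) : t = 0 := by
  have h := congrArg (fun l => l.hom ((bredonTotalIso M M' hT n).inv.hom X)) hrs
  have h₀ : (kunnethTensorMap f (𝟙 M') n).hom (r.hom ((bredonTotalIso M M' hT n).inv.hom X)) = 0 :=
    (congrArg (kunnethTensorMap f (𝟙 M') n).hom (hM _)).trans (map_zero _)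
  have h₁ : s.hom ((bredonHomologyMap (F₁.prod F₂) n (extLeftMap F₁ F₂ f (𝟙 M'))).hom
      ((bredonTotalIso M M' hT n).inv.hom X)) = 0 := h.symm.trans h₀
  rw [bredonHomologyMap_bredonTotalIso, hX, ← kunnethCross_kunnethMk] at h₁
  have h₂ : kunnethMk N M' P Q n k t = 0 :=
    (congrArg (fun l => l.hom (kunnethMk N M' P Q n k t)) hs).symm.trans h₁
  rw [← kunnethComponent_kunnethMk n k t, h₂, map_zero]

end Obstruction

/-! ### Homology of the resolution of length one -/

section TwoTermHomology
variable {R : Type} [CommRing R] {C : Type u} [SmallCategory C] {c : C} (t : c ⟶ c)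
  (N : C ⥤ ModuleCat.{u} R)

theorem twoTerm_d_freeOnTensorι (n : N.obj c) :
    CoTensor.map ((twoTerm (freeOnSubOne R t)).d 1 0) (𝟙 N) (freeOnTensorι c N n) =
      freeOnTensorι c N ((N.map t).hom n - n) := by
  rw [twoTerm_d_one_zero]
  exact map_freeOnSubOne t N n

/-- The 1-cycles are the elements of the value at c that are invariant under t. -/
theorem twoTerm_homology_one_eq_zero (h : ∀ n : N.obj c, (N.map t).hom n = n → n = 0)
    (x : (tensorComplex (twoTerm (freeOnSubOne R t)) N).homology 1) : x = 0 := by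
  obtain ⟨z, rfl⟩ := homologyπ_surjective _ _ x
  have hz := tensorComplex_cycle_d (twoTerm (freeOnSubOne R t)) N 1 0 z
  obtain ⟨n, hn⟩ := (freeOnTensorEquiv c N).surjective
    (((tensorComplex (twoTerm (freeOnSubOne R t)) N).iCycles 1).hom z)
  have hn' : (N.map t).hom n - n = 0 := (freeOnTensorEquiv c N).injective
    (((twoTerm_d_freeOnTensorι t N n).symm.trans ((congrArg (CoTensor.map
      ((twoTerm (freeOnSubOne R t)).d 1 0) (𝟙 N)) hn).trans hz)).trans (map_zero _).symm)
  rw [h n (sub_eq_zero.mp hn'), map_zero] at hn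
  have : z = 0 := (ModuleCat.mono_iff_injective _).mp
    (inferInstanceAs (Mono ((tensorComplex (twoTerm (freeOnSubOne R t)) N).iCycles 1)))
      (hn.symm.trans (map_zero _).symm)
  rw [this, map_zero]

/-- The homology in degree one maps to the value of the coefficients. -/
noncomputable def twoTermHomologyOne :
    (tensorComplex (twoTerm (freeOnSubOne R t)) N).homology 1 →ₗ[R] N.obj c :=
  descSurj ((tensorComplex (twoTerm (freeOnSubOne R t)) N).homologyπ 1).hom
    (homologyπ_surjective _ _)
    ((freeOnTensorEquiv c N).symm.toLinearMap ∘ₗ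
      ((tensorComplex (twoTerm (freeOnSubOne R t)) N).iCycles 1).hom) (by
    intro x hx
    obtain ⟨z, hz⟩ := exists_of_homologyπ_eq_zero _ _ x hx
    -- There are no nonzero chains in degree two, so a first homology class is its unique cycle.
    have : z = 0 := (subsingleton_twoTerm_coTensor (freeOnSubOne R t) N 0).elim _ _
    rw [this, map_zero] at hz
    exact (congrArg (freeOnTensorEquiv c N).symm hz.symm).trans (map_zero _))

theorem twoTermHomologyOne_π (x : (tensorComplex (twoTerm (freeOnSubOne R t)) N).cycles 1)
    (n : N.obj c) (hx : ((tensorComplex (twoTerm (freeOnSubOne R t)) N).iCycles 1).hom x =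
      freeOnTensorι c N n) :
    twoTermHomologyOne t N
      (((tensorComplex (twoTerm (freeOnSubOne R t)) N).homologyπ 1).hom x) = n :=
  (descSurj_apply _ _ _ _ x).trans
    ((congrArg (freeOnTensorEquiv c N).symm hx).trans ((freeOnTensorEquiv c N).symm_apply_apply n))

variable {X : Type u} [AddCommGroup X] [Module R X] (g : N.obj c →ₗ[R] X)
  (hg : ∀ n, g ((N.map t).hom n) = g n)

/-- The linear map on homology in degree zero given by an invariant linear map on the value of the
coefficients. -/
noncomputable def twoTermHomologyZeroDesc :
    (tensorComplex (twoTerm (freeOnSubOne R t)) N).homology 0 →ₗ[R] X :=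
  descSurj ((tensorComplex (twoTerm (freeOnSubOne R t)) N).homologyπ 0).hom
    (homologyπ_surjective _ _)
    (g ∘ₗ (freeOnTensorEquiv c N).symm.toLinearMap ∘ₗ
      ((tensorComplex (twoTerm (freeOnSubOne R t)) N).iCycles 0).hom) (by
    intro x hx
    obtain ⟨z, hz⟩ := exists_of_homologyπ_eq_zero _ _ x hx
    obtain ⟨n, rfl⟩ := (freeOnTensorEquiv c N).surjective z
    have h := hz.symm.trans (twoTerm_d_freeOnTensorι t N n)
    refine (congrArg (fun y => g ((freeOnTensorEquiv c N).symm y)) h).trans ?_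
    refine (congrArg g ((freeOnTensorEquiv c N).symm_apply_apply _)).trans ?_
    rw [map_sub, hg, sub_self])

theorem twoTermHomologyZeroDesc_π (x : (tensorComplex (twoTerm (freeOnSubOne R t)) N).cycles 0)
    (n : N.obj c) (hx : ((tensorComplex (twoTerm (freeOnSubOne R t)) N).iCycles 0).hom x =
      freeOnTensorι c N n) :
    twoTermHomologyZeroDesc t N g hg
      (((tensorComplex (twoTerm (freeOnSubOne R t)) N).homologyπ 0).hom x) = g n :=
  (descSurj_apply _ _ _ _ x).trans
    (congrArg g ((congrArg (freeOnTensorEquiv c N).symm hx).trans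
      ((freeOnTensorEquiv c N).symm_apply_apply n)))

end TwoTermHomology

/-! ### Free orbits and the infinite cyclic group -/

/-- The family consisting of the trivial subgroup. -/
def SubgroupFamily.bot (G : Type u) [Group G] : SubgroupFamily G where
  carrier := {⊥}
  nonempty := ⟨⊥, rfl⟩
  conj_mem := by
    rintro _ rfl g
    exact Subgroup.map_bot _

theorem SubgroupFamily.isSemiFull_bot (G : Type u) [Group G] : (SubgroupFamily.bot G).IsSemiFull := by
  rintro _ rfl _ rfl
  exact inf_idem _

namespace Orb

section
variable {G : Type u} [Group G]

/-- The free orbit. -/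
def free (G : Type u) [Group G] : Orb (SubgroupFamily.bot G) := ⟨⊥, rfl⟩

theorem mk_injective_of_bot (X : Orb (SubgroupFamily.bot G)) :
    Function.Injective (QuotientGroup.mk : G → G ⧸ X.sub) := fun a b h => by
  have h' := QuotientGroup.eq.mp h
  rw [show X.sub = ⊥ from X.mem, Subgroup.mem_bot] at h'
  exact inv_mul_eq_one.mp h'

/-- The group element describing a morphism of free orbits. -/
noncomputable def elt {X Y : Orb (SubgroupFamily.bot G)} (φ : X ⟶ Y) : G :=
  Quotient.out (toMap φ ((1 : G) : G ⧸ X.sub))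

theorem mk_elt {X Y : Orb (SubgroupFamily.bot G)} (φ : X ⟶ Y) :
    ((elt φ : G) : G ⧸ Y.sub) = toMap φ ((1 : G) : G ⧸ X.sub) := Quotient.out_eq _

theorem elt_id (X : Orb (SubgroupFamily.bot G)) : elt (𝟙 X) = 1 :=
  mk_injective_of_bot X (mk_elt (𝟙 X))

theorem elt_comp {X Y Z : Orb (SubgroupFamily.bot G)} (φ : X ⟶ Y) (ψ : Y ⟶ Z) :
    elt (φ ≫ ψ) = elt φ * elt ψ := by
  refine mk_injective_of_bot Z ?_
  rw [mk_elt, toMap_comp, ← mk_elt, toMap_mk, ← mk_elt]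
  rfl

/-- With the trivial stabilizer an equivariant map is determined by the image of the base point,
which can be any point. -/
theorem elt_bijective (X Y : Orb (SubgroupFamily.bot G)) :
    Function.Bijective (elt : (X ⟶ Y) → G) := by
  refine ⟨fun φ ψ h => hom_ext (by rw [← mk_elt, ← mk_elt, h]), fun g => ?_⟩
  refine ⟨ofFixed X Y ((g : G) : G ⧸ Y.sub) fun h hh => ?_, mk_injective_of_bot Y ?_⟩
  · rw [show X.sub = ⊥ from X.mem, Subgroup.mem_bot] at hh
    rw [hh, one_smul]
  · rw [mk_elt, ofFixed_mk, one_smul]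

end

/-- The orbit category of the infinite cyclic group with respect to the trivial subgroup. -/
abbrev Cyc : Type u := Orb (SubgroupFamily.bot (ULift.{u} (Multiplicative ℤ)))

/-- The degree of a morphism of free orbits of the infinite cyclic group. -/
noncomputable def degEquiv (X Y : Cyc.{u}) : (X ⟶ Y) ≃ ℤ :=
  (Equiv.ofBijective _ (elt_bijective X Y)).trans (Equiv.ulift.trans Multiplicative.toAdd)

theorem degEquiv_id (X : Cyc.{u}) : degEquiv X X (𝟙 X) = 0 :=
  congrArg (fun g : ULift (Multiplicative ℤ) => g.down.toAdd) (elt_id X)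

theorem degEquiv_comp {X Y Z : Cyc.{u}} (φ : X ⟶ Y) (ψ : Y ⟶ Z) :
    degEquiv X Z (φ ≫ ψ) = degEquiv X Y φ + degEquiv Y Z ψ :=
  congrArg (fun g : ULift (Multiplicative ℤ) => g.down.toAdd) (elt_comp φ ψ)

/-- The free orbit of the infinite cyclic group. -/
def cyc : Cyc.{u} := free _

/-- The translation by a generator of the infinite cyclic group. -/
noncomputable def shift : cyc.{u} ⟶ cyc := (degEquiv cyc cyc).symm 1

theorem degEquiv_comp_shift (X : Cyc.{u}) (φ : X ⟶ cyc) :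
    degEquiv X cyc (φ ≫ shift) = degEquiv X cyc φ + 1 := by
  rw [degEquiv_comp, shift, Equiv.apply_symm_apply]

variable {R : Type} [CommRing R]

/-- The left module with value `A` on which a generator of the infinite cyclic group acts by `σ`. -/
noncomputable def rep {A : Type u} [AddCommGroup A] [Module R A] (σ : A ≃ₗ[R] A) :
    Cyc.{u} ⥤ ModuleCat.{u} R where
  obj _ := ModuleCat.of R A
  map {X Y} φ := ModuleCat.ofHom (σ ^ degEquiv X Y φ : A ≃ₗ[R] A).toLinearMap
  map_id X := by
    rw [degEquiv_id]
    rfl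
  map_comp φ ψ := by
    -- Products of automorphisms compose from right to left, morphisms from left to right; the
    -- degrees commute.
    rw [degEquiv_comp, add_comm, zpow_add]
    rfl

theorem rep_map_shift {A : Type u} [AddCommGroup A] [Module R A] (σ : A ≃ₗ[R] A) (a : A) :
    ((rep σ).map shift.{u}).hom a = σ a := by
  change (σ ^ degEquiv cyc cyc shift : A ≃ₗ[R] A) a = σ a
  rw [shift, Equiv.apply_symm_apply, zpow_one]

theorem zpow_intertwines {A B : Type*} [AddCommGroup A] [Module R A] [AddCommGroup B] [Module R B]
    {σ : A ≃ₗ[R] A} {τ : B ≃ₗ[R] B} {f : A →ₗ[R] B} (h : ∀ a, f (σ a) = τ (f a)) (n : ℤ) (a : A) :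
    f ((σ ^ n : A ≃ₗ[R] A) a) = (τ ^ n : B ≃ₗ[R] B) (f a) := by
  have h' : ∀ a, f ((σ⁻¹ : A ≃ₗ[R] A) a) = (τ⁻¹ : B ≃ₗ[R] B) (f a) := fun a => by
    refine τ.injective ?_
    rw [← h]
    exact (congrArg f (σ.apply_symm_apply a)).trans (τ.apply_symm_apply _).symm
  induction n using Int.induction_on generalizing a with
  | zero => rfl
  | succ n ih =>
    rw [zpow_add_one, zpow_add_one]
    exact (ih _).trans (congrArg _ (h a))
  | pred n ih =>
    rw [zpow_sub_one, zpow_sub_one]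
    exact (ih _).trans (congrArg _ (h' a))

/-- The morphism of left modules given by an equivariant map. -/
noncomputable def repMap {A B : Type u} [AddCommGroup A] [Module R A] [AddCommGroup B] [Module R B]
    {σ : A ≃ₗ[R] A} {τ : B ≃ₗ[R] B} (f : A →ₗ[R] B) (h : ∀ a, f (σ a) = τ (f a)) :
    rep σ ⟶ rep τ where
  app _ := ModuleCat.ofHom f
  naturality X Y φ := by
    ext a
    exact zpow_intertwines h (degEquiv X Y φ) a

end Orb

/-! ### The counterexample: sign and swap representations -/

namespace Orb

/-- The free resolution `0 → ℤ[?, G] → ℤ[?, G] → ℤ → 0` for the infinite cyclic group. -/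
noncomputable def cycResolution :
    ProjectiveResolution (trivialModule.{u} ℤ (SubgroupFamily.bot (ULift.{u} (Multiplicative ℤ)))) :=
  cyclicResolution ℤ shift (fun d => degEquiv d cyc) degEquiv_comp_shift

theorem isFreeResolution_cycResolution : IsFreeResolution cycResolution.{u} :=
  isFreeResolution_cyclicResolution _ _ _

/-- The sign representation of the infinite cyclic group. -/
noncomputable abbrev signRep : Cyc.{u} ⥤ ModuleCat.{u} ℤ :=
  rep (LinearEquiv.neg ℤ : ULift.{u} ℤ ≃ₗ[ℤ] ULift.{u} ℤ)

/-- The representation of the infinite cyclic group on a free group of rank two that swaps the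
coordinates. -/
noncomputable abbrev swapRep : Cyc.{u} ⥤ ModuleCat.{u} ℤ :=
  rep (LinearEquiv.prodComm ℤ (ULift.{u} ℤ) (ULift.{u} ℤ))

/-- The antidiagonal embedding of the sign representation. -/
noncomputable def antidiag : signRep.{u} ⟶ swapRep :=
  repMap (LinearMap.prod LinearMap.id (-LinearMap.id)) fun a => by simp

theorem isFreeComplex_signRep : IsFreeComplex (tensorComplex cycResolution.{u}.complex signRep) :=
  isFreeComplex_twoTerm (freeOnSubOne ℤ shift) signRep
    (inferInstanceAs (Module.Free ℤ (ULift.{u} ℤ)))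

theorem isFreeComplex_swapRep : IsFreeComplex (tensorComplex cycResolution.{u}.complex swapRep) :=
  isFreeComplex_twoTerm (freeOnSubOne ℤ shift) swapRep
    (inferInstanceAs (Module.Free ℤ (ULift.{u} ℤ × ULift.{u} ℤ)))

/-- An integer equal to its negative is zero. -/
theorem signRep_homology_one (x : (tensorComplex cycResolution.{u}.complex signRep).homology 1) :
    x = 0 := by
  refine twoTerm_homology_one_eq_zero shift signRep (fun n hn => ?_) x
  have h := (rep_map_shift (LinearEquiv.neg ℤ : ULift.{u} ℤ ≃ₗ[ℤ] ULift.{u} ℤ) n).symm.trans hn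
  have h' : -(n : ULift.{u} ℤ).down = (n : ULift.{u} ℤ).down := congrArg ULift.down h
  exact ULift.ext _ _ (show (n : ULift.{u} ℤ).down = 0 by omega)

/-- Reduction modulo two. -/
noncomputable def parity : signRep.{u}.obj cyc →ₗ[ℤ] ULift.{u} (ZMod 2) :=
  ULift.moduleEquiv.symm.toLinearMap ∘ₗ (Int.castAddHom (ZMod 2)).toIntLinearMap ∘ₗ
    (ULift.moduleEquiv (R := ℤ) (M := ℤ)).toLinearMap

/-- Since -n and n agree modulo two, parity is defined on the zeroth homology of the sign
representation and detects its generator. -/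
theorem parity_map_shift (n : signRep.{u}.obj cyc) :
    parity ((signRep.map shift).hom n) = parity n := by
  refine (congrArg _ (rep_map_shift _ n)).trans (ULift.ext _ _ ?_)
  change ((-(n : ULift.{u} ℤ).down : ℤ) : ZMod 2) = (((n : ULift.{u} ℤ).down : ℤ) : ZMod 2)
  rw [Int.cast_neg, ZMod.neg_eq_self_mod_two]

/-- The pairing of the homology of the two representations with values in `ℤ/2`. -/
noncomputable def signSwapPairing :
    (tensorComplex (twoTerm (freeOnSubOne ℤ shift.{u})) swapRep).homology 1 ⊗[ℤ]
      (tensorComplex (twoTerm (freeOnSubOne ℤ shift.{u})) signRep).homology 0 →ₗ[ℤ]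
        ULift.{u} (ZMod 2) :=
  TensorProduct.lift (((LinearMap.lsmul ℤ (ULift.{u} (ZMod 2))) ∘ₗ
    (ULift.moduleEquiv (R := ℤ) (M := ℤ)).toLinearMap ∘ₗ LinearMap.fst ℤ (ULift.{u} ℤ) (ULift.{u} ℤ) ∘ₗ
    twoTermHomologyOne shift swapRep).compl₂
    (twoTermHomologyZeroDesc shift signRep parity parity_map_shift))

theorem signSwapPairing_tmul
    (x : (tensorComplex (twoTerm (freeOnSubOne ℤ shift.{u})) swapRep).cycles 1)
    (m : ULift.{u} ℤ × ULift.{u} ℤ)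
    (hx : ((tensorComplex (twoTerm (freeOnSubOne ℤ shift.{u})) swapRep).iCycles 1).hom x =
      freeOnTensorι cyc swapRep m)
    (y : (tensorComplex (twoTerm (freeOnSubOne ℤ shift.{u})) signRep).cycles 0) (n : ULift.{u} ℤ)
    (hy : ((tensorComplex (twoTerm (freeOnSubOne ℤ shift.{u})) signRep).iCycles 0).hom y =
      freeOnTensorι cyc signRep n) :
    signSwapPairing
      (((tensorComplex (twoTerm (freeOnSubOne ℤ shift.{u})) swapRep).homologyπ 1).hom x ⊗ₜ[ℤ]
      ((tensorComplex (twoTerm (freeOnSubOne ℤ shift.{u})) signRep).homologyπ 0).hom y) =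
      ULift.up ((m.1.down : ZMod 2) * n.down) := by
  have h₁ := twoTermHomologyOne_π shift swapRep x m hx
  have h₂ := twoTermHomologyZeroDesc_π shift signRep parity parity_map_shift y n hy
  refine (congrArg₂ (fun (a : ULift.{u} ℤ × ULift.{u} ℤ) (b : ULift.{u} (ZMod 2)) => a.1.down • b)
    h₁ h₂).trans ?_
  exact ULift.ext _ _ (zsmul_eq_mul _ _)

/-- The homology cross product for two infinite cyclic groups has no natural left inverse. -/
theorem not_exists_natural_retraction
    (hT : IsTotalResolution cycResolution.{u} cycResolution.{u})
    {r : bredonHomology _ 1 (extLeft _ _ signRep.{u} signRep.{u}) ⟶ kunnethTensor _ _ signRep signRep 1}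
    {s : bredonHomology _ 1 (extLeft _ _ swapRep.{u} signRep.{u}) ⟶ kunnethTensor _ _ swapRep signRep 1}
    (hs : kunnethCross swapRep signRep hT 1 ≫ s = 𝟙 _) :
    r ≫ kunnethTensorMap antidiag (𝟙 signRep) 1 ≠
      bredonHomologyMap _ 1 (extLeftMap _ _ antidiag (𝟙 signRep)) ≫ s := by
  intro hrs
  let K := twoTerm (freeOnSubOne ℤ shift.{u})
  have hd : ∀ n : ULift.{u} ℤ, CoTensor.map (K.d 1 0) (𝟙 signRep) (freeOnTensorι cyc signRep n) =
      (-2 : ℤ) • freeOnTensorι cyc signRep n := fun n => by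
    refine (twoTerm_d_freeOnTensorι shift signRep n).trans ((congrArg _ ?_).trans (map_smul _ _ _))
    refine (congrArg (· - n) (rep_map_shift _ n)).trans ?_
    change -n - n = (-2 : ℤ) • n
    abel
  have hf : ∀ n : ULift.{u} ℤ, CoTensor.map (𝟙 _) antidiag (freeOnTensorι cyc signRep n) =
      freeOnTensorι cyc swapRep ((n, -n) : ULift.{u} ℤ × ULift.{u} ℤ) := map_freeOnTensorι antidiag
  have he : ∀ m : ULift.{u} ℤ × ULift.{u} ℤ,
      CoTensor.map (K.d 1 0) (𝟙 swapRep) (freeOnTensorι cyc swapRep m) =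
        freeOnTensorι cyc swapRep (m.swap - m) := fun m =>
    (twoTerm_d_freeOnTensorι shift swapRep m).trans
      (congrArg (freeOnTensorι cyc swapRep) (congrArg (· - m) (rep_map_shift _ m)))
  -- The element e₁ = (0, 1) bounds the antidiagonal image (1, -1) of the generator of the sign
  -- representation.
  have hswap : ((ULift.up 0, ULift.up 1) : ULift.{u} ℤ × ULift.{u} ℤ).swap -
      (ULift.up 0, ULift.up 1) = (ULift.up 1, -ULift.up 1) := by
    ext <;> rfl
  -- With k = -2 the cycle f a₁ - k e₁ is (1, -1) + 2 (0, 1) = (1, 1), the generator of the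
  -- invariants of the swap.
  have hdiag : ((ULift.up 1, ULift.up 1) : ULift.{u} ℤ × ULift.{u} ℤ) =
      (ULift.up 1, -ULift.up 1) - (-2 : ℤ) • (ULift.up 0, ULift.up 1) := by
    ext <;> rfl
  have hι : freeOnTensorι cyc swapRep
        ((ULift.up 1, ULift.up 1) : ULift.{u} ℤ × ULift.{u} ℤ) =
      freeOnTensorι cyc swapRep ((ULift.up 1, -ULift.up 1) : ULift.{u} ℤ × ULift.{u} ℤ) -
        (-2 : ℤ) • freeOnTensorι cyc swapRep
          ((ULift.up 0, ULift.up 1) : ULift.{u} ℤ × ULift.{u} ℤ) :=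
    (congrArg (freeOnTensorι cyc swapRep) hdiag).trans
      ((map_sub (freeOnTensorι cyc swapRep) _ _).trans
        (congrArg (_ - ·) (map_smul (freeOnTensorι cyc swapRep) (-2 : ℤ) _)))
  obtain ⟨b, hb⟩ := (tensorComplex K signRep).cycIncl_zero_surjective
    (freeOnTensorι cyc signRep (ULift.up 1 : ULift.{u} ℤ))
  obtain ⟨z, hz⟩ := exists_cycles_eq_of_d_one_zero (tensorComplex K swapRep)
    (freeOnTensorι cyc swapRep ((ULift.up 1, ULift.up 1) : ULift.{u} ℤ × ULift.{u} ℤ))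
    ((he _).trans ((congrArg _ (sub_self _)).trans (map_zero _)))
  obtain ⟨X, hX⟩ := exists_homologyMap_eq_cross (K := K) (L := K) antidiag (-2 : ℤ)
    (hd (ULift.up 1)) (hd (ULift.up 1)) (e₁ := freeOnTensorι cyc swapRep
      ((ULift.up 0, ULift.up 1) : ULift.{u} ℤ × ULift.{u} ℤ))
    ((he _).trans ((congrArg (freeOnTensorι cyc swapRep) hswap).trans (hf _).symm)) z b
    (hz.trans (hι.trans (congrArg (· - _) (hf _).symm))) hb
  -- The index 1 selects the summand H₁ ⊗ H₀. Naturality forces [(1, 1)] ⊗ [1] to vanish there,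
  -- while the pairing with values in ℤ/2 sends it to 1.
  have h := eq_zero_of_natural_retraction hT antidiag 1 hs hrs
    (kunnethTensor_one_eq_zero signRep_homology_one signRep_homology_one) 1 _ X hX
  have h' := (signSwapPairing_tmul z _ hz b _ hb).symm.trans
    ((congrArg signSwapPairing h).trans (map_zero _))
  have h₀ : ((1 : ℤ) : ZMod 2) * ((1 : ℤ) : ZMod 2) = 0 := congrArg ULift.down h'
  revert h₀
  decide

end Orb

/-! ### The Künneth formula and the failure of natural splitting -/

theorem IsFreeComplex.isSplit {R : Type} [CommRing R] [IsDomain R] [IsPrincipalIdealRing R]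
    {A : ChainComplex (ModuleCat.{u} R) ℕ} (h : IsFreeComplex A) : A.IsSplit :=
  ChainComplex.isSplit_of_projective fun p => have := h p; inferInstance

theorem mainTheorem9 :
    (∀ (G₁ G₂ : Type u) [Group G₁] [Group G₂] (F₁ : SubgroupFamily G₁) (F₂ : SubgroupFamily G₂)
      (M : Orb F₁ ⥤ ModuleCat.{u} ℤ) (M' : Orb F₂ ⥤ ModuleCat.{u} ℤ)
      (P : ProjectiveResolution (trivialModule.{u} ℤ F₁))
      (Q : ProjectiveResolution (trivialModule.{u} ℤ F₂)),
      IsFreeResolution P → IsFreeResolution Q →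
      (IsFreeComplex (tensorComplex P.complex M) ∨ IsFreeComplex (tensorComplex Q.complex M')) →
      ∃ hT : IsTotalResolution P Q, ∀ n : ℕ,
        ∃ (β : bredonHomology (F₁.prod F₂) n (extLeft F₁ F₂ M M') ⟶ kunnethTor F₁ F₂ M M' n)
          (w : kunnethCross M M' hT n ≫ β = 0),
          (ShortComplex.mk (kunnethCross M M' hT n) β w).ShortExact ∧
          (IsFreeComplex (tensorComplex P.complex M) →
            IsFreeComplex (tensorComplex Q.complex M') →
            Nonempty (ShortComplex.mk (kunnethCross M M' hT n) β w).Splitting)) ∧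
    (∃ (G₁ G₂ : Type u) (_ : Group G₁) (_ : Group G₂) (F₁ : SubgroupFamily G₁)
      (F₂ : SubgroupFamily G₂) (P : ProjectiveResolution (trivialModule.{u} ℤ F₁))
      (Q : ProjectiveResolution (trivialModule.{u} ℤ F₂)) (hT : IsTotalResolution P Q) (n : ℕ),
      F₁.IsSemiFull ∧ F₂.IsSemiFull ∧ IsFreeResolution P ∧ IsFreeResolution Q ∧
      ¬ ∃ r : ∀ (M : Orb F₁ ⥤ ModuleCat.{u} ℤ) (M' : Orb F₂ ⥤ ModuleCat.{u} ℤ),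
          IsFreeComplex (tensorComplex P.complex M) →
          IsFreeComplex (tensorComplex Q.complex M') →
          (bredonHomology (F₁.prod F₂) n (extLeft F₁ F₂ M M') ⟶ kunnethTensor F₁ F₂ M M' n),
        (∀ M M' hM hM', kunnethCross M M' hT n ≫ r M M' hM hM' = 𝟙 _) ∧
        (∀ (M N : Orb F₁ ⥤ ModuleCat.{u} ℤ) (M' N' : Orb F₂ ⥤ ModuleCat.{u} ℤ)
          (hM : IsFreeComplex (tensorComplex P.complex M))
          (hM' : IsFreeComplex (tensorComplex Q.complex M'))
          (hN : IsFreeComplex (tensorComplex P.complex N))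
          (hN' : IsFreeComplex (tensorComplex Q.complex N'))
          (f : M ⟶ N) (f' : M' ⟶ N'),
          r M M' hM hM' ≫ kunnethTensorMap f f' n =
            bredonHomologyMap (F₁.prod F₂) n (extLeftMap F₁ F₂ f f') ≫ r N N' hN hN')) := by
  exact ⟨fun G₁ G₂ _ _ F₁ F₂ M M' P Q hP hQ h =>
      ⟨isTotalResolution_of_isFreeResolution hP hQ, fun n => by
        obtain ⟨β, w, hS, hsplit⟩ := kunneth_shortExact M M'
          (isTotalResolution_of_isFreeResolution hP hQ)
          (h.imp IsFreeComplex.isSplit IsFreeComplex.isSplit) n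
        exact ⟨β, w, hS, fun h₁ h₂ => hsplit h₁.isSplit h₂.isSplit⟩⟩,
    ULift (Multiplicative ℤ), ULift (Multiplicative ℤ), inferInstance, inferInstance,
    SubgroupFamily.bot _, SubgroupFamily.bot _, Orb.cycResolution, Orb.cycResolution,
    isTotalResolution_of_isFreeResolution Orb.isFreeResolution_cycResolution
      Orb.isFreeResolution_cycResolution, 1, SubgroupFamily.isSemiFull_bot _,
    SubgroupFamily.isSemiFull_bot _, Orb.isFreeResolution_cycResolution,
    Orb.isFreeResolution_cycResolution, fun ⟨r, hr, hnat⟩ =>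
      Orb.not_exists_natural_retraction _
        (hr Orb.swapRep Orb.signRep Orb.isFreeComplex_swapRep Orb.isFreeComplex_signRep)
        (hnat _ _ _ _ Orb.isFreeComplex_signRep Orb.isFreeComplex_signRep
          Orb.isFreeComplex_swapRep Orb.isFreeComplex_signRep Orb.antidiag (𝟙 Orb.signRep))⟩
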